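/- **Setting.** For each $n$ let $p=p_n\ge 1$ be an integer and let $X_n$ be a random vector in $\mathbb{R}^{p}$ with a density $f_{X_n}$. For $x,y\in\mathbb{R}^p$ write $M(x,y)=\mathrm{E}\exp\{(x+iy)^\top X_n\}$ and, locally, $K=\log M=U+iV$ with $U,V$ real; $U^{(x,k)},V^{(x,k)}$ denote $k$-th order derivatives in $x$. Let $A_n\subset\mathbb{R}^p$ be a set of points at which $f_{X_n}$ is continuous, and suppose that each $s\in A_n$ has a saddlepoint $\hat t_n=\hat t_n(s)$, i.e. a point in the interior of $\{x: M(x,0)<\infty\}$ with $\frac{\partial}{\partial x}K(x,0)|_{x=\hat t_n}=s$; let $T_n$ be the set of these saddlepoints. The saddlepoint approximation is $$\hat f_{X_n}(s)=\frac{\exp\{K(\hat t_n,0)-\hat t_n^\top s\}}{(2\pi)^{p/2}\det\{U^{(x,2)}(\hat t_n,0)\}^{1/2}} .$$ Let $c_\infty\in[0,1/2]$, $c_3,c_4,\alpha\in\mathbb{R}$, $\delta>0$, $\eta_1>0$, $\eta_2,\dots,\eta_6\in\mathbb{R}$ be constants not depending on $n$, $\gamma_n^2=p\log(n)/n$, let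 $B(r)$ be the Euclidean ball of radius $r$ about $0$ in $\mathbb{R}^p$, and put $$r_n=\max\left(\frac{p^{3+2c_\infty}}{n^{3-2c_3}},\ \frac{p^{2+2c_\infty}}{n^{2-c_4}}\right).$$ **Assumptions**, for all sufficiently large $n$ and with all constants in $O(\cdot)$ uniform: * (7′) for all $s\in A_n$, with $\hat t_n$ its saddlepoint, the following integral converges absolutely and $$\left|\frac{\det\{U^{(x,2)}(\hat t_n,0)\}^{1/2}}{(2\pi)^{p/2}}\int_{B(\delta)^C}\exp\{K(\hat t_n,y)-K(\hat t_n,0)-iy^\top s\}\,dy\right|=O(r_n),$$ where $\exp K$ is read as $M$; * (8′) for all $\hat t_n\in T_n$ and $y\in B(\delta)$, the eigenvalues of $U^{(x,2)}(\hat t_n,y)$ lie in $[\eta_1 n,\eta_2 n]$, and $\|\{U^{(x,2)}(\hat t_n,y)\}^{-1/2}\|_\infty=O(p^{c_\infty}/n^{1/2})$, where $\|\cdot\|_\infty$ is the maximal absolute row sum; * (9′) for all $\hat t_n\in T_n$ and $l\le p$, the eigenvalues of the matrix $[U^{(x,3)}_{jkl}(\hat t_n,0)]_{j,k}$ lie in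 $[\eta_3n^{c_3},\eta_4n^{c_3}]$; * (10′) for all $\hat t_n\in T_n$, $y\in B(2^{1/2}\gamma_n)$ and $l,m\le p$, the eigenvalues of the matrices $[U^{(x,4)}_{jklm}(\hat t_n,y)]_{j,k}$ and $[V^{(x,4)}_{jklm}(\hat t_n,y)]_{j,k}$ lie in $[\eta_5n^{c_4},\eta_6n^{c_4}]$. **Corollary.** Let $p=O(n^\alpha)$ with $\alpha<1$ and $\alpha<(4-2c_4)/(5+4c_\infty)$, and let $\eta_1p_n\ge 4(2-c_4)$ for all large $n$ (which is automatic if $p_n\to\infty$). Then, under Assumptions 7′–10′, $$\frac{f_{X_n}(s_n)}{\hat f_{X_n}(s_n)}=1+O\left\{\max\left(\frac{p^{3+2c_\infty}}{n^{3-2c_3}},\ \frac{p^{2+2c_\infty}}{n^{2-c_4}}\right)\right\}$$ uniformly in $s_n\in A_n$. -/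

import Mathlib

open Filter MeasureTheory Asymptotics

open scoped Topology RealInnerProductSpace

noncomputable section

namespace Saddlepoint

/-- Euclidean space `ℝ^p`. -/
abbrev E (p : ℕ) : Type := EuclideanSpace ℝ (Fin p)

section Fixed

variable {p : ℕ}

/-- `f` is a probability density (with respect to Lebesgue measure) of the law `μ`. -/
def IsDensity (μ : Measure (E p)) (f : E p → ℝ) : Prop :=
  Measurable f ∧ (∀ x, 0 ≤ f x) ∧ μ = volume.withDensity (fun x => ENNReal.ofReal (f x))

/-- The set of real arguments at which the moment generating function of `μ` is finite. -/
def mgfDomain (μ : Measure (E p)) : Set (E p) :=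
  {x | Integrable (fun w => Real.exp ⟪x, w⟫) μ}

/-- The moment generating function at the complex argument `x + i y`. -/
def mgfC (μ : Measure (E p)) (x y : E p) : ℂ :=
  ∫ w, Complex.exp ((⟪x, w⟫ : ℂ) + Complex.I * (⟪y, w⟫ : ℂ)) ∂μ

/-- The cumulant generating function at the real argument `x`. -/
def cgf (μ : Measure (E p)) (x : E p) : ℝ :=
  Real.log (∫ w, Real.exp ⟪x, w⟫ ∂μ)

/-- `t` is a saddlepoint for `s`: it lies in the interior of the domain of the moment generating
function and the gradient of the cumulant generating function at `t` is `s`. -/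
def IsSaddlepoint (μ : Measure (E p)) (s t : E p) : Prop :=
  t ∈ interior (mgfDomain μ) ∧ HasGradientAt (cgf μ) s t

/-- The branch of `x ↦ K(x, y) - K(t, y)` near `x = t` that vanishes at `x = t`, where `K = log M`
is the cumulant generating function at `x + i y`. Where `M(t, y) ≠ 0` the quotient is close to `1`
for `x` near `t`, so this is smooth there and its derivatives at `t` of order at least one are those
of any local branch of `K`. -/
def localCgf (μ : Measure (E p)) (t y x : E p) : ℂ :=
  Complex.log (mgfC μ x y / mgfC μ t y)

/-- The real part `U` (up to a constant) of the cumulant generating function, near `t + i y`. -/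
def localU (μ : Measure (E p)) (t y x : E p) : ℝ := (localCgf μ t y x).re

/-- The imaginary part `V` (up to a constant) of the cumulant generating function,
near `t + i y`. -/
def localV (μ : Measure (E p)) (t y x : E p) : ℝ := (localCgf μ t y x).im

/-- Standard basis vector. -/
def e (j : Fin p) : E p := EuclideanSpace.single j 1

/-- The matrix of second partial derivatives of `U` along the real axes at `t + i y`. -/
def U2 (μ : Measure (E p)) (t y : E p) : Matrix (Fin p) (Fin p) ℝ :=
  Matrix.of fun j k => iteratedFDeriv ℝ 2 (localU μ t y) t ![e j, e k]

/-- The matrix with entries `∂_j ∂_k ∂_l U` (derivatives along the real axes) at `t + i y`. -/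
def U3 (μ : Measure (E p)) (t y : E p) (l : Fin p) : Matrix (Fin p) (Fin p) ℝ :=
  Matrix.of fun j k => iteratedFDeriv ℝ 3 (localU μ t y) t ![e j, e k, e l]

/-- The matrix with entries `∂_j ∂_k ∂_l ∂_m U` (derivatives along the real axes) at `t + i y`. -/
def U4 (μ : Measure (E p)) (t y : E p) (l m : Fin p) : Matrix (Fin p) (Fin p) ℝ :=
  Matrix.of fun j k => iteratedFDeriv ℝ 4 (localU μ t y) t ![e j, e k, e l, e m]

/-- The matrix with entries `∂_j ∂_k ∂_l ∂_m V` (derivatives along the real axes) at `t + i y`. -/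
def V4 (μ : Measure (E p)) (t y : E p) (l m : Fin p) : Matrix (Fin p) (Fin p) ℝ :=
  Matrix.of fun j k => iteratedFDeriv ℝ 4 (localV μ t y) t ![e j, e k, e l, e m]

/-- All eigenvalues of the (real symmetric) matrix `A` lie in `[a, b]`. -/
def EigenvaluesIn (A : Matrix (Fin p) (Fin p) ℝ) (a b : ℝ) : Prop :=
  ∀ r ∈ spectrum ℝ A, a ≤ r ∧ r ≤ b

/-- The norm `‖A‖_∞`, the maximal absolute row sum. -/
def rowSumNorm (A : Matrix (Fin p) (Fin p) ℝ) : ℝ := ⨆ j, ∑ k, |A j k|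

/-- `‖A^{-1/2}‖_∞ ≤ b`, where `A^{-1/2}` is the (unique) positive semidefinite matrix whose square
is the inverse of `A`. -/
def InvSqrtRowSumNormLE (A : Matrix (Fin p) (Fin p) ℝ) (b : ℝ) : Prop :=
  ∃ S : Matrix (Fin p) (Fin p) ℝ, S.PosSemidef ∧ S * S * A = 1 ∧ rowSumNorm S ≤ b

/-- The saddlepoint approximation to the density at `s`, with saddlepoint `t`. -/
def approx (μ : Measure (E p)) (s t : E p) : ℝ :=
  Real.exp (cgf μ t - ⟪t, s⟫) / ((2 * Real.pi) ^ ((p : ℝ) / 2) * Real.sqrt (U2 μ t 0).det)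

/-- The integrand `exp{K(t, y) - K(t, 0) - i yᵀ s}`, with `exp K` written as `M`, so that it makes
sense also where `M` vanishes. -/
def integrand (μ : Measure (E p)) (s t y : E p) : ℂ :=
  mgfC μ t y / mgfC μ t 0 * Complex.exp (-(Complex.I * (⟪y, s⟫ : ℂ)))

end Fixed

/-- `max {p^(3 + 2 c∞) / n^(3 - 2 c₃), p^(2 + 2 c∞) / n^(2 - c₄)}`. -/
def rate (p : ℕ → ℕ) (cinf c3 c4 : ℝ) (n : ℕ) : ℝ :=
  max ((p n : ℝ) ^ (3 + 2 * cinf) / (n : ℝ) ^ (3 - 2 * c3))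
    ((p n : ℝ) ^ (2 + 2 * cinf) / (n : ℝ) ^ (2 - c4))

/-- `γ_n`, where `γ_n² = p log n / n`. -/
def gam (p : ℕ → ℕ) (n : ℕ) : ℝ := Real.sqrt (Real.log n * p n / n)

variable {p : ℕ → ℕ}

/-- The normalized integral outside the ball of radius `δ` exists and is `O(a n)`, uniformly over
`s ∈ A n`; `t n s` is the saddlepoint for `s`. -/
def UniformTail (μ : ∀ n, Measure (E (p n))) (A : ∀ n, Set (E (p n)))
    (t : ∀ n, E (p n) → E (p n)) (δ : ℝ) (a : ℕ → ℝ) : Prop :=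
  ∃ C : ℝ, ∀ᶠ n in atTop, ∀ s ∈ A n,
    IntegrableOn (integrand (μ n) s (t n s)) (Metric.ball 0 δ)ᶜ ∧
    ‖((Real.sqrt (U2 (μ n) (t n s) 0).det / (2 * Real.pi) ^ ((p n : ℝ) / 2) : ℝ) : ℂ) *
        ∫ y in (Metric.ball 0 δ)ᶜ, integrand (μ n) s (t n s) y‖ ≤ C * a n

/-- Uniform condition on the second derivative of `U` over the set `T n` of saddlepoints. -/
def UniformHessian (μ : ∀ n, Measure (E (p n))) (T : ∀ n, Set (E (p n)))
    (δ η₁ η₂ cinf : ℝ) : Prop :=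
  (∀ᶠ n in atTop, ∀ t ∈ T n, ∀ y ∈ Metric.ball (0 : E (p n)) δ,
    EigenvaluesIn (U2 (μ n) t y) (η₁ * n) (η₂ * n)) ∧
  ∃ C : ℝ, ∀ᶠ n in atTop, ∀ t ∈ T n, ∀ y ∈ Metric.ball (0 : E (p n)) δ,
    InvSqrtRowSumNormLE (U2 (μ n) t y) (C * ((p n : ℝ) ^ cinf / Real.sqrt n))

/-- Uniform condition on the third derivative of `U` over the set `T n` of saddlepoints. -/
def UniformThird (μ : ∀ n, Measure (E (p n))) (T : ∀ n, Set (E (p n))) (η₃ η₄ c3 : ℝ) : Prop :=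
  ∀ᶠ n in atTop, ∀ t ∈ T n, ∀ l : Fin (p n),
    EigenvaluesIn (U3 (μ n) t 0 l) (η₃ * (n : ℝ) ^ c3) (η₄ * (n : ℝ) ^ c3)

/-- Uniform condition on the fourth derivatives of `U` and `V` over the set `T n` of
saddlepoints. -/
def UniformFourth (μ : ∀ n, Measure (E (p n))) (T : ∀ n, Set (E (p n))) (η₅ η₆ c4 : ℝ) : Prop :=
  ∀ᶠ n in atTop, ∀ t ∈ T n, ∀ y ∈ Metric.ball (0 : E (p n)) (Real.sqrt 2 * gam p n),
    ∀ l m : Fin (p n),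
      EigenvaluesIn (U4 (μ n) t y l m) (η₅ * (n : ℝ) ^ c4) (η₆ * (n : ℝ) ^ c4) ∧
      EigenvaluesIn (V4 (μ n) t y l m) (η₅ * (n : ℝ) ^ c4) (η₆ * (n : ℝ) ^ c4)

end Saddlepoint

end

/-! Fourier inversion of the exponentially tilted density writes the ratio of density and
approximation as `det(U2)^{1/2} (2π)^{-p/2}` times the integral of M(t,y)/M(t,0) e^{-i⟨y,s⟩}
(`div_approx`). The part outside the δ-ball is the tail hypothesis. Inside, M has no zeros, hence a
smooth logarithm (`exists_log_mgfC`), and the substitution y = S w with S = U2^{-1/2} turns the real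
part of the integrand into e^{-‖w‖²/2} e^{P(w)} cos Θ(w); the real part suffices because the ratio
is real. Since V = 0 at real arguments and the n-th derivative in y carries a factor i^n, P has no
cubic term, and the saddlepoint equation removes the linear term of Θ. So P is of fourth order with
size b = R²a₄/N, and Θ of third order with size b₃ = R a₃/N (`jetBound_modPart`,
`jetBound_phasePart`), where R bounds the row sums of S and N the spectrum of U2 from below.

It remains to show that the Gaussian mean of e^P cos Θ - 1 is O(b p² + b₃² p³), which is the stated
rate. Pointwise estimates are too weak: expanding in coordinates gives only |P| ≤ p b ‖w‖⁴, which is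
b p³ at the typical size ‖w‖² ≈ p. The Gaussian weight is however invariant under sign changes of
coordinates. Averaged over all signs, P² and Θ² obey dimension-free bounds by an Efron-Stein
inequality (`JetBound.signAvg_sq_le`), and e^{cP} is controlled by a Hoeffding argument
(`JetBound.signAvg_exp_le`). The cosine lets Θ enter only through Θ².

The exponential moments are needed for ‖w‖² ≤ ρ² of order p log n and stay bounded if p b² ρ⁸ does,
that is, if p^{5/2+2c∞} log² n / n^{2-c4} tends to 0; this is the second condition on α. Beyond ρ
the pointwise bound on P and the decay of |M| along rays (`re_log_le`) leave Gaussian tails of size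
n^{-const·p}, negligible because of the lower bound on η₁ p. -/

/-! ### Averaging over a commuting family of involutions -/

namespace SignAverage

variable {X ι : Type*}

/-- Average of `g` over the involution `σ j`. -/
noncomputable def avg (σ : ι → X → X) (j : ι) (g : X → ℝ) (x : X) : ℝ := (g x + g (σ j x)) / 2

/-- The part of `g` that is odd under the involution `σ j`. -/
noncomputable def dif (σ : ι → X → X) (j : ι) (g : X → ℝ) (x : X) : ℝ := (g x - g (σ j x)) / 2

/-- Iterated average over the involutions in a list. -/
noncomputable def avgL (σ : ι → X → X) (l : List ι) (g : X → ℝ) : X → ℝ := l.foldr (avg σ) g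

variable {σ : ι → X → X}

@[simp] lemma avgL_nil (g : X → ℝ) : avgL σ [] g = g := rfl

@[simp] lemma avgL_cons (j : ι) (l : List ι) (g : X → ℝ) :
    avgL σ (j :: l) g = avg σ j (avgL σ l g) := rfl

lemma avgL_mono {s : Set X} (hs : ∀ j, ∀ x ∈ s, σ j x ∈ s) (l : List ι) {f g : X → ℝ}
    (h : ∀ x ∈ s, f x ≤ g x) : ∀ x ∈ s, avgL σ l f x ≤ avgL σ l g x := by
  induction l with
  | nil => simpa using h
  | cons j l ih =>
    intro x hx
    have h1 := ih x hx
    have h2 := ih _ (hs j x hx)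
    simp only [avgL_cons, avg]
    linarith

lemma avgL_const (l : List ι) (c : ℝ) : avgL σ l (fun _ => c) = fun _ => c := by
  induction l with
  | nil => rfl
  | cons j l ih => funext x; simp [avg, ih]

lemma avgL_le_of_le {s : Set X} (hs : ∀ j, ∀ x ∈ s, σ j x ∈ s) (l : List ι) {f : X → ℝ} {c : ℝ}
    (h : ∀ x ∈ s, f x ≤ c) : ∀ x ∈ s, avgL σ l f x ≤ c := by
  intro x hx
  simpa [avgL_const] using avgL_mono (σ := σ) hs l (g := fun _ => c) h x hx

lemma avgL_add (l : List ι) (f g : X → ℝ) :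
    avgL σ l (fun x => f x + g x) = fun x => avgL σ l f x + avgL σ l g x := by
  induction l with
  | nil => rfl
  | cons j l ih => funext x; simp only [avgL_cons, ih, avg]; ring

lemma avgL_smul (l : List ι) (c : ℝ) (f : X → ℝ) :
    avgL σ l (fun x => c * f x) = fun x => c * avgL σ l f x := by
  induction l with
  | nil => rfl
  | cons j l ih => funext x; simp only [avgL_cons, ih, avg]; ring

lemma abs_avgL_le {s : Set X} (hs : ∀ j, ∀ x ∈ s, σ j x ∈ s) (l : List ι) {f : X → ℝ} {c : ℝ}
    (h : ∀ x ∈ s, |f x| ≤ c) : ∀ x ∈ s, |avgL σ l f x| ≤ c := by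
  intro x hx
  rw [abs_le]
  refine ⟨?_, avgL_le_of_le hs l (fun y hy => (abs_le.1 (h y hy)).2) x hx⟩
  have := avgL_le_of_le hs l (f := fun y => (-1) * f y) (c := c)
    (fun y hy => by have := (abs_le.1 (h y hy)).1; linarith) x hx
  rw [avgL_smul] at this
  linarith

lemma sq_avgL_le (l : List ι) (f : X → ℝ) (x : X) :
    avgL σ l f x ^ 2 ≤ avgL σ l (fun y => f y ^ 2) x := by
  induction l generalizing x with
  | nil => simp
  | cons j l ih =>
    have h1 := ih x
    have h2 := ih (σ j x)
    simp only [avgL_cons, avg]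
    nlinarith [sq_nonneg (avgL σ l f x - avgL σ l f (σ j x))]

variable (hσ : ∀ j x, σ j (σ j x) = x) (hc : ∀ j k x, σ j (σ k x) = σ k (σ j x))

include hc in
lemma avgL_comp (l : List ι) (k : ι) (g : X → ℝ) (x : X) :
    avgL σ l g (σ k x) = avgL σ l (fun y => g (σ k y)) x := by
  induction l generalizing x with
  | nil => rfl
  | cons j l ih => simp only [avgL_cons, avg, ← ih, hc j k]

include hc in
lemma dif_avgL (l : List ι) (k : ι) (g : X → ℝ) :
    dif σ k (avgL σ l g) = avgL σ l (dif σ k g) := by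
  funext x
  have : dif σ k g = fun x => (1 / 2 : ℝ) * g x + (-1 / 2) * g (σ k x) := by
    funext x; simp only [dif]; ring
  rw [this, avgL_add, avgL_smul, avgL_smul]
  simp only [dif]
  rw [avgL_comp hc]
  ring

include hc in
lemma avg_avgL (l : List ι) (k : ι) (g : X → ℝ) :
    avg σ k (avgL σ l g) = avgL σ l (avg σ k g) := by
  funext x
  have : avg σ k g = fun x => (1 / 2 : ℝ) * g x + (1 / 2) * g (σ k x) := by
    funext x; simp only [avg]; ring
  rw [this, avgL_add, avgL_smul, avgL_smul]
  simp only [avg]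
  rw [avgL_comp hc]
  ring

include hσ in
lemma avg_idem (k : ι) (g : X → ℝ) : avg σ k (avg σ k g) = avg σ k g := by
  funext x; simp only [avg, hσ]; ring

include hσ hc in
lemma avgL_avg_of_mem (l : List ι) {k : ι} (hk : k ∈ l) (g : X → ℝ) :
    avgL σ l (avg σ k g) = avgL σ l g := by
  induction l with
  | nil => simp at hk
  | cons j l ih =>
    simp only [avgL_cons]
    rcases List.mem_cons.1 hk with rfl | h
    · rw [← avg_avgL hc, avg_idem hσ]
    · rw [ih h]

include hσ hc in
-- Allows averaging over some of the involutions beforehand, so that a bound on the partial average,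
-- at every point, carries over to the full one.
lemma avgL_avgL_of_subset (l l' : List ι) (h : ∀ k ∈ l', k ∈ l) (g : X → ℝ) :
    avgL σ l (avgL σ l' g) = avgL σ l g := by
  induction l' with
  | nil => rfl
  | cons j l' ih =>
    rw [avgL_cons, avgL_avg_of_mem hσ hc l (h j (by simp)), ih fun k hk => h k (by simp [hk])]

include hσ hc in
/-- The Poincaré (Efron-Stein) inequality for averages over commuting involutions. -/
lemma avgL_sq_le (l : List ι) (g : X → ℝ) (x : X) :
    avgL σ l (fun y => g y ^ 2) x ≤
      avgL σ l g x ^ 2 + (l.map fun j => avgL σ l (fun y => dif σ j g y ^ 2) x).sum := by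
  induction l generalizing x with
  | nil => simp
  | cons j l ih =>
    have h1 := ih x
    have h2 := ih (σ j x)
    -- With u, v the values of the inner average at x and `σ j x`, (u² + v²)/2 = ((u+v)/2)² +
    -- ((u-v)/2)²; Jensen bounds the last square by the average of (`dif σ j g`)².
    have hd := fun y => sq_avgL_le (σ := σ) l (dif σ j g) y
    have hd1 := hd x
    have hd2 := hd (σ j x)
    rw [← dif_avgL hc] at hd1 hd2
    have hsum : (l.map fun k => avg σ j (avgL σ l fun y => dif σ k g y ^ 2) x).sum =
        ((l.map fun k => avgL σ l (fun y => dif σ k g y ^ 2) x).sum +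
          (l.map fun k => avgL σ l (fun y => dif σ k g y ^ 2) (σ j x)).sum) / 2 := by
      rw [← List.sum_map_add, div_eq_mul_inv, ← List.sum_map_mul_right]
      rfl
    simp only [List.map_cons, List.sum_cons, avgL_cons]
    rw [hsum]
    simp only [avg]
    simp only [dif, hσ] at hd1 hd2 h1 h2 ⊢
    nlinarith

include hc in
/-- Sub-Gaussian bound for exponentials of functions with bounded differences. -/
lemma avgL_exp_le {s : Set X} (hs : ∀ j, ∀ x ∈ s, σ j x ∈ s) (l : List ι) (g : X → ℝ) (d : ι → ℝ)
    (hd : ∀ j, ∀ x ∈ s, |dif σ j g x| ≤ d j) :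
    ∀ x ∈ s, avgL σ l (fun y => Real.exp (g y)) x ≤
      Real.exp (avgL σ l g x + (l.map fun j => d j ^ 2 / 2).sum) := by
  induction l with
  | nil => simp
  | cons j l ih =>
    intro x hx
    have h1 := ih x hx
    have h2 := ih _ (hs j x hx)
    set S := (l.map fun j => d j ^ 2 / 2).sum
    have hj : |dif σ j (avgL σ l g) x| ≤ d j := by
      rw [dif_avgL hc]
      exact abs_avgL_le hs l (hd j) x hx
    set u := avgL σ l g x
    set v := avgL σ l g (σ j x)
    -- Hoeffding's step: the two-point average of exp is exp of the mean times a cosh of the half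
    -- difference, and cosh a ≤ exp(a²/2).
    have hcosh : Real.cosh ((u - v) / 2) ≤ Real.exp (d j ^ 2 / 2) := by
      refine (Real.cosh_le_exp_half_sq _).trans (Real.exp_le_exp.2 ?_)
      have : ((u - v) / 2) ^ 2 ≤ d j ^ 2 := sq_le_sq' (by have := (abs_le.1 hj).1; simpa [dif] using this)
        (by have := (abs_le.1 hj).2; simpa [dif] using this)
      linarith
    have key : (Real.exp (u + S) + Real.exp (v + S)) / 2 =
        Real.exp ((u + v) / 2 + S) * Real.cosh ((u - v) / 2) := by
      rw [Real.cosh_eq, mul_div_assoc', mul_add, ← Real.exp_add, ← Real.exp_add]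
      ring_nf
    calc avgL σ (j :: l) (fun y => Real.exp (g y)) x
        ≤ (Real.exp (u + S) + Real.exp (v + S)) / 2 := by
          simp only [avgL_cons, avg]; linarith
      _ = Real.exp ((u + v) / 2 + S) * Real.cosh ((u - v) / 2) := key
      _ ≤ Real.exp ((u + v) / 2 + S) * Real.exp (d j ^ 2 / 2) := by gcongr
      _ = _ := by
          rw [← Real.exp_add]
          simp only [List.map_cons, List.sum_cons, avgL_cons, avg]
          congr 1
          ring

/-- Comparison of an iterated average with the value at the point where the corresponding
coordinates are set to zero. -/
lemma abs_avgL_sub_le {s : Set X} (hs : ∀ j, ∀ x ∈ s, σ j x ∈ s) {z : ι → X → X}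
    (hz : ∀ j, ∀ x ∈ s, z j x ∈ s) (hzσ : ∀ j k x, j ≠ k → z j (σ k x) = σ k (z j x))
    (g : X → ℝ) (c : ι → ℝ) (l : List ι) (hl : l.Nodup)
    (h : ∀ j ∈ l, ∀ x ∈ s, |avg σ j g x - g (z j x)| ≤ c j) :
    ∀ x ∈ s, |avgL σ l g x - g (l.foldr z x)| ≤ (l.map c).sum := by
  have hmem : ∀ l : List ι, ∀ x ∈ s, l.foldr z x ∈ s := by
    intro l x hx
    induction l with
    | nil => simpa
    | cons j l ih => exact hz j _ ih
  have hcomm : ∀ l : List ι, ∀ k ∉ l, ∀ x, l.foldr z (σ k x) = σ k (l.foldr z x) := by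
    intro l k hk x
    induction l with
    | nil => rfl
    | cons j l ih =>
      simp only [List.mem_cons, not_or] at hk
      simp only [List.foldr_cons, ih hk.2, hzσ j k _ (Ne.symm hk.1)]
  induction l with
  | nil => simp
  | cons j l ih =>
    intro x hx
    have ih := ih hl.of_cons fun k hk => h k (by simp [hk])
    have h1 := ih x hx
    have h2 := ih _ (hs j x hx)
    -- As j does not occur in l, zeroing along l commutes with `σ j`, so h1 and h2 compare with the
    -- two values whose mean is treated in h3: the errors telescope.
    rw [hcomm l j (List.nodup_cons.1 hl).1] at h2
    have h3 := h j (by simp) _ (hmem l x hx)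
    simp only [avg, List.foldr_cons, avgL_cons, List.map_cons, List.sum_cons] at h3 ⊢
    rw [abs_le] at *
    constructor <;> linarith [h1.1, h1.2, h2.1, h2.2, h3.1, h3.2]

end SignAverage

/-! ### Sign changes of coordinates and moments over random signs -/

namespace Saddlepoint

variable {p : ℕ}

/-- Change of sign of a coordinate. -/
noncomputable def flip (j : Fin p) (w : E p) : E p := w - (2 * w j) • e j

/-- Setting a coordinate to zero. -/
noncomputable def zeroC (j : Fin p) (w : E p) : E p := w - w j • e j

/-- A centred coordinate box. -/
def box (r : Fin p → ℝ) : Set (E p) := {x | ∀ j, |x j| ≤ r j}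

lemma e_apply (j k : Fin p) : (e j : E p) k = if k = j then 1 else 0 := by
  simp [e]

lemma norm_e (j : Fin p) : ‖(e j : E p)‖ = 1 := by simp [e]

lemma flip_apply (j k : Fin p) (w : E p) : flip j w k = if k = j then -w k else w k := by
  simp only [flip, PiLp.sub_apply, PiLp.smul_apply, e_apply, smul_eq_mul]
  split_ifs with h
  · subst h; ring
  · ring

lemma zeroC_apply (j k : Fin p) (w : E p) : zeroC j w k = if k = j then 0 else w k := by
  simp only [zeroC, PiLp.sub_apply, PiLp.smul_apply, e_apply, smul_eq_mul]
  split_ifs with h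
  · subst h; ring
  · ring

lemma flip_flip (j : Fin p) (w : E p) : flip j (flip j w) = w := by
  ext k; simp only [flip_apply]; split_ifs <;> simp

lemma flip_comm (j k : Fin p) (w : E p) : flip j (flip k w) = flip k (flip j w) := by
  ext l; simp only [flip_apply]; split_ifs <;> simp

lemma zeroC_flip (j k : Fin p) (w : E p) (_ : j ≠ k) : zeroC j (flip k w) = flip k (zeroC j w) := by
  ext l; simp only [flip_apply, zeroC_apply]; split_ifs <;> simp

lemma zeroC_add_smul (j : Fin p) (w : E p) : zeroC j w + w j • e j = w := by simp [zeroC]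

lemma zeroC_sub_smul (j : Fin p) (w : E p) : zeroC j w + (-w j) • e j = flip j w := by
  simp only [zeroC, flip]; module

lemma flip_mem_box (r : Fin p → ℝ) (j : Fin p) : ∀ x ∈ box r, flip j x ∈ box r := by
  intro x hx k
  rw [flip_apply]
  split_ifs
  · simpa using hx k
  · exact hx k

lemma zeroC_mem_box (r : Fin p → ℝ) (j : Fin p) : ∀ x ∈ box r, zeroC j x ∈ box r := by
  intro x hx k
  rw [zeroC_apply]
  split_ifs
  · simpa using (abs_nonneg _).trans (hx k)
  · exact hx k

lemma foldr_zeroC_apply (l : List (Fin p)) (x : E p) (k : Fin p) :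
    (l.foldr zeroC x) k = if k ∈ l then 0 else x k := by
  induction l with
  | nil => simp
  | cons j l ih =>
    simp only [List.foldr_cons, zeroC_apply, ih, List.mem_cons]
    by_cases h1 : k = j <;> simp [h1]

/-- Average over all changes of signs of the coordinates. -/
noncomputable def signAvg (g : E p → ℝ) : E p → ℝ := SignAverage.avgL flip (List.finRange p) g

open SignAverage

/-- Zeroing the coordinates one at a time leads from x to 0, where g vanishes. -/
lemma abs_signAvg_le {g : E p → ℝ} {r : Fin p → ℝ} {B : ℝ} (h0 : g 0 = 0)
    (ha : ∀ j, ∀ x ∈ box r, |avg flip j g x - g (zeroC j x)| ≤ r j ^ 2 * B) :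
    ∀ x ∈ box r, |signAvg g x| ≤ (∑ j, r j ^ 2) * B := by
  intro x hx
  have := abs_avgL_sub_le (flip_mem_box r) (zeroC_mem_box r) zeroC_flip g (fun j => r j ^ 2 * B)
    (List.finRange p) (List.nodup_finRange p) (fun j _ => ha j) x hx
  have hz : (List.finRange p).foldr zeroC x = 0 := by
    ext k; simp [foldr_zeroC_apply]
  rw [hz, h0, sub_zero, ← Fin.sum_univ_def, ← Finset.sum_mul] at this
  exact this

/-- The Poincaré inequality a second time, for the odd part `dif flip j g` and only the flips k ≠ j.
These leave the j-th coordinate fixed, so zeroing the others compares the mean with the value at y j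
• e j; the variance comes from mixed differences. -/
lemma signAvg_sq_dif_le {g : E p → ℝ} {r : Fin p → ℝ} {B₂ B₃ : ℝ} (j : Fin p) (hr : ∀ j, 0 ≤ r j)
    (hB₃ : 0 ≤ B₃)
    (hb : ∀ k, j ≠ k → ∀ x ∈ box r, |dif flip k (dif flip j g) x| ≤ r j * r k * B₂)
    (hcc : ∀ k, j ≠ k → ∀ x ∈ box r,
      |avg flip k (dif flip j g) x - dif flip j g (zeroC k x)| ≤ r k ^ 2 * (r j * B₃))
    (he : ∀ s, |s| ≤ r j → |dif flip j g (s • e j)| ≤ r j ^ 2 * B₂) :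
    ∀ x ∈ box r, signAvg (fun y => dif flip j g y ^ 2) x ≤
      (r j ^ 2 * B₂ + r j * B₃ * ∑ k, r k ^ 2) ^ 2 + ∑ k, (r j * r k * B₂) ^ 2 := by
  intro x hx
  set l' := (List.finRange p).filter (· ≠ j) with hl'
  have hmem : ∀ k, k ∈ l' ↔ k ≠ j := by intro k; simp [hl']
  have hnd : l'.Nodup := (List.nodup_finRange p).filter _
  rw [signAvg, ← avgL_avgL_of_subset flip_flip flip_comm (List.finRange p) l' (by simp)]
  refine avgL_le_of_le (flip_mem_box r) _ (fun y hy => ?_) x hx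
  refine (avgL_sq_le flip_flip flip_comm l' _ y).trans ?_
  have hsumle : ∀ f : Fin p → ℝ, (∀ k, 0 ≤ f k) → (l'.map f).sum ≤ ∑ k, f k := by
    intro f hf
    rw [← List.sum_toFinset _ hnd]
    exact Finset.sum_le_sum_of_subset_of_nonneg (Finset.subset_univ _) fun k _ _ => hf k
  refine add_le_add ?_ ?_
  · have h1 := abs_avgL_sub_le (flip_mem_box r) (zeroC_mem_box r) zeroC_flip (dif flip j g)
      (fun k => r k ^ 2 * (r j * B₃)) l' hnd (fun k hk => hcc k ((hmem k).1 hk).symm) y hy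
    have hz : l'.foldr zeroC y = y j • e j := by
      ext k
      simp only [foldr_zeroC_apply, hmem, PiLp.smul_apply, e_apply, smul_eq_mul]
      by_cases h : k = j <;> simp [h]
    rw [hz] at h1
    have h2 := he (y j) (hy j)
    have h3 := hsumle (fun k => r k ^ 2 * (r j * B₃)) fun k =>
      mul_nonneg (sq_nonneg _) (mul_nonneg (hr j) hB₃)
    rw [← Finset.sum_mul] at h3
    rw [← sq_abs]
    refine pow_le_pow_left₀ (abs_nonneg _) ?_ 2
    have h4 := abs_sub_abs_le_abs_sub (avgL flip l' (dif flip j g) y) (dif flip j g (y j • e j))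
    linarith
  · refine le_trans ?_ (hsumle (fun k => (r j * r k * B₂) ^ 2) fun k => sq_nonneg _)
    refine List.sum_le_sum fun k hk => ?_
    refine avgL_le_of_le (flip_mem_box r) _ (fun u hu => ?_) y hy
    rw [← sq_abs]
    exact pow_le_pow_left₀ (abs_nonneg _) (hb k ((hmem k).1 hk).symm u hu) 2

/-- Second moment over random signs of a function with bounded mixed differences. -/
lemma signAvg_sq_le {g : E p → ℝ} {r : Fin p → ℝ} {B₂ B₃ : ℝ} (hr : ∀ j, 0 ≤ r j)
    (hB₃ : 0 ≤ B₃) (h0 : g 0 = 0)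
    (ha : ∀ j, ∀ x ∈ box r, |avg flip j g x - g (zeroC j x)| ≤ r j ^ 2 * B₂)
    (hb : ∀ j k, j ≠ k → ∀ x ∈ box r, |dif flip k (dif flip j g) x| ≤ r j * r k * B₂)
    (hcc : ∀ j k, j ≠ k → ∀ x ∈ box r,
      |avg flip k (dif flip j g) x - dif flip j g (zeroC k x)| ≤ r k ^ 2 * (r j * B₃))
    (he : ∀ j s, |s| ≤ r j → |dif flip j g (s • e j)| ≤ r j ^ 2 * B₂) :
    ∀ x ∈ box r, signAvg (fun y => g y ^ 2) x ≤
      4 * B₂ ^ 2 * (∑ j, r j ^ 2) ^ 2 + 2 * B₃ ^ 2 * (∑ j, r j ^ 2) ^ 3 := by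
  intro x hx
  set R := ∑ j, r j ^ 2 with hR
  have hR0 : 0 ≤ R := Finset.sum_nonneg fun j _ => sq_nonneg _
  have h1 := abs_signAvg_le h0 ha x hx
  have h2 := avgL_sq_le flip_flip flip_comm (List.finRange p) g x
  rw [← Fin.sum_univ_def] at h2
  -- Summed over j this is 3 B₂² R² + 2 B₃² R³; the squared mean, at most B₂² R², brings the first
  -- coefficient to 4.
  have h3 : ∑ j, signAvg (fun y => dif flip j g y ^ 2) x ≤
      ∑ j, ((2 * R * B₂ ^ 2 * r j ^ 2 + 2 * B₃ ^ 2 * R ^ 2 * r j ^ 2) + R * B₂ ^ 2 * r j ^ 2) := by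
    refine Finset.sum_le_sum fun j _ => ?_
    refine (signAvg_sq_dif_le j hr hB₃ (hb j) (hcc j) (he j) x hx).trans ?_
    have hle : r j ^ 2 ≤ R := Finset.single_le_sum (f := fun j => r j ^ 2)
      (fun j _ => sq_nonneg _) (Finset.mem_univ j)
    have h5 : ∑ k, (r j * r k * B₂) ^ 2 = R * B₂ ^ 2 * r j ^ 2 := by
      rw [hR, Finset.sum_mul, Finset.sum_mul]
      exact Finset.sum_congr rfl fun k _ => by ring
    rw [h5]
    have h6 : (r j ^ 2 * B₂ + r j * B₃ * R) ^ 2 ≤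
        2 * (r j ^ 2 * B₂) ^ 2 + 2 * (r j * B₃ * R) ^ 2 := by
      nlinarith [sq_nonneg (r j ^ 2 * B₂ - r j * B₃ * R)]
    have h7 : (r j ^ 2 * B₂) ^ 2 ≤ R * B₂ ^ 2 * r j ^ 2 := by
      have : r j ^ 2 * (B₂ ^ 2 * r j ^ 2) ≤ R * (B₂ ^ 2 * r j ^ 2) := by gcongr
      nlinarith
    nlinarith
  have h4 : signAvg g x ^ 2 ≤ (R * B₂) ^ 2 := by
    rw [← sq_abs]
    exact pow_le_pow_left₀ (abs_nonneg _) h1 2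
  rw [Finset.sum_add_distrib, Finset.sum_add_distrib, ← Finset.mul_sum, ← Finset.mul_sum,
    ← Finset.mul_sum, ← hR] at h3
  change signAvg (fun y => g y ^ 2) x ≤ signAvg g x ^ 2 + _ at h2
  change signAvg (fun y => g y ^ 2) x ≤ _
  have h8 : ∑ j, avgL flip (List.finRange p) (fun y => dif flip j g y ^ 2) x =
    ∑ j, signAvg (fun y => dif flip j g y ^ 2) x := rfl
  nlinarith

end Saddlepoint

/-! ### Mean value bounds for differences and averages in coordinate directions -/

namespace Saddlepoint

variable {p : ℕ}

open SignAverage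

lemma abs_sub_le_of_hasDerivAt {f f' : ℝ → ℝ} {C : ℝ}
    (hf : ∀ s ∈ Set.Icc (0 : ℝ) 1, HasDerivAt f (f' s) s)
    (hC : ∀ s ∈ Set.Icc (0 : ℝ) 1, |f' s| ≤ C) : |f 1 - f 0| ≤ C := by
  have := (convex_Icc (0 : ℝ) 1).norm_image_sub_le_of_norm_hasDerivWithin_le
    (fun s hs => (hf s hs).hasDerivWithinAt) (fun s hs => by simpa using hC s hs)
    (Set.left_mem_Icc.2 zero_le_one) (Set.right_mem_Icc.2 zero_le_one)
  simpa using this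

lemma sum_mul_e (x : E p) : ∑ j, x j • e j = x := by
  ext k
  simp [e_apply]

lemma sum_abs_le (x : E p) : ∑ j, |x j| ≤ √p * ‖x‖ := by
  have h := Finset.sum_mul_sq_le_sq_mul_sq Finset.univ (fun _ : Fin p => (1 : ℝ)) (fun j => |x j|)
  simp only [one_mul, one_pow, Finset.sum_const, Finset.card_univ, Fintype.card_fin, nsmul_eq_mul,
    mul_one, sq_abs] at h
  refine abs_le_of_sq_le_sq' ?_ (by positivity) |>.2
  rw [mul_pow, Real.sq_sqrt (Nat.cast_nonneg p), EuclideanSpace.norm_sq_eq]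
  simpa using h

lemma norm_le_of_mem_box {r : Fin p → ℝ} {x : E p} (hx : x ∈ box r) :
    ‖x‖ ≤ √(∑ j, r j ^ 2) := by
  rw [EuclideanSpace.norm_eq]
  refine Real.sqrt_le_sqrt (Finset.sum_le_sum fun j _ => ?_)
  simpa using pow_le_pow_left₀ (abs_nonneg _) (hx j) 2

/-! ### Differences along coordinate directions -/

/-- `G'` is the derivative of `G` in the `j`-th coordinate direction, at all points of `s`. -/
def HasPartial (G G' : E p → ℝ) (j : Fin p) (s : Set (E p)) : Prop :=
  ∀ y ∈ s, HasDerivAt (fun u : ℝ => G (y + u • e j)) (G' y) 0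

lemma zeroC_add_mem_box {r : Fin p → ℝ} {x : E p} (hx : x ∈ box r) {j : Fin p} {s : ℝ}
    (hs : |s| ≤ r j) : zeroC j x + s • e j ∈ box r := by
  intro k
  simp only [PiLp.add_apply, zeroC_apply, PiLp.smul_apply, e_apply, smul_eq_mul]
  split_ifs with h
  · subst h; simpa using hs
  · simpa using hx k

lemma HasPartial.hasDerivAt {G G' : E p → ℝ} {j : Fin p} {s : Set (E p)} (h : HasPartial G G' j s)
    {z : E p} {u : ℝ} (hz : z + u • e j ∈ s) :
    HasDerivAt (fun u : ℝ => G (z + u • e j)) (G' (z + u • e j)) u := by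
  have h1 := h _ hz
  have h2 : HasDerivAt (fun v : ℝ => v - u) 1 u := (hasDerivAt_id u).sub_const u
  have h3 := HasDerivAt.comp (h₂ := fun w : ℝ => G (z + u • e j + w • e j)) u (by simpa using h1) h2
  rw [mul_one] at h3
  refine h3.congr_of_eventuallyEq (Eventually.of_forall fun v => ?_)
  simp only [Function.comp]
  congr 1
  module

lemma HasPartial.abs_dif_le {G G' : E p → ℝ} {j : Fin p} {r : Fin p → ℝ} {M : ℝ}
    (h : HasPartial G G' j (box r)) (hM : ∀ x ∈ box r, |G' x| ≤ M) :
    ∀ x ∈ box r, |dif flip j G x| ≤ r j * M := by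
  intro x hx
  have hM0 : 0 ≤ M := (abs_nonneg _).trans (hM x hx)
  have hmem : ∀ s ∈ Set.Icc (-r j) (r j), zeroC j x + s • e j ∈ box r := fun s hs =>
    zeroC_add_mem_box hx (abs_le.2 hs)
  have h1 := (convex_Icc (-r j) (r j)).norm_image_sub_le_of_norm_hasDerivWithin_le
    (f := fun s : ℝ => G (zeroC j x + s • e j)) (f' := fun s => G' (zeroC j x + s • e j)) (C := M)
    (fun s hs => (h.hasDerivAt (hmem s hs)).hasDerivWithinAt)
    (fun s hs => by simpa using hM _ (hmem s hs))
    (x := -x j) (y := x j) (by have := abs_le.1 (hx j); constructor <;> linarith)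
    (abs_le.1 (hx j))
  simp only [zeroC_add_smul, zeroC_sub_smul, Real.norm_eq_abs] at h1
  rw [dif, abs_div, abs_two]
  have h2 : |x j - -x j| = 2 * |x j| := by
    rw [sub_neg_eq_add, ← two_mul, abs_mul, abs_two]
  rw [h2] at h1
  have := mul_le_mul_of_nonneg_left (hx j) hM0
  linarith

lemma HasPartial.dif {G G' : E p → ℝ} {j k : Fin p} {r : Fin p → ℝ} (hjk : j ≠ k)
    (h : HasPartial G G' k (box r)) : HasPartial (dif flip j G) (dif flip j G') k (box r) := by
  intro y hy
  have h1 := h y hy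
  have h2 := h _ (flip_mem_box r j y hy)
  refine ((h1.sub h2).div_const 2).congr_of_eventuallyEq (Eventually.of_forall fun u => ?_)
  have : flip j (y + u • e k) = flip j y + u • e k := by
    ext l
    simp only [flip_apply, PiLp.add_apply, PiLp.smul_apply, e_apply, smul_eq_mul]
    by_cases h1 : l = j
    · subst h1; simp [hjk]
    · simp [h1]
  simp [SignAverage.dif, this]

/-- The even function s ↦ (G(z + s x_j e_j) + G(z - s x_j e_j))/2 has derivative x_j times the odd
part of G', which is itself a difference bounded through G''. First-order terms cancel, hence the
factor r_j². -/
lemma HasPartial.abs_avg_sub_le {G G' G'' : E p → ℝ} {j : Fin p} {r : Fin p → ℝ} {M : ℝ}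
    (h : HasPartial G G' j (box r)) (h' : HasPartial G' G'' j (box r))
    (hM : ∀ x ∈ box r, |G'' x| ≤ M) :
    ∀ x ∈ box r, |avg flip j G x - G (zeroC j x)| ≤ r j ^ 2 * M := by
  intro x hx
  have hM0 : 0 ≤ M := (abs_nonneg _).trans (hM x hx)
  have hr : 0 ≤ r j := (abs_nonneg _).trans (hx j)
  have hmem : ∀ c : ℝ, |c| ≤ 1 → zeroC j x + (c * x j) • e j ∈ box r := fun c hc =>
    zeroC_add_mem_box hx (by rw [abs_mul]; nlinarith [hx j, abs_nonneg (x j)])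
  have hd : ∀ c : ℝ, |c| ≤ 1 → HasDerivAt (fun c : ℝ => G (zeroC j x + (c * x j) • e j))
      (G' (zeroC j x + (c * x j) • e j) * x j) c := fun c hc =>
    HasDerivAt.comp (h₂ := fun u : ℝ => G (zeroC j x + u • e j)) c (h.hasDerivAt (hmem c hc))
      (hasDerivAt_mul_const (x j))
  have key := abs_sub_le_of_hasDerivAt (C := r j ^ 2 * M)
    (f := fun s => (G (zeroC j x + (s * x j) • e j) + G (zeroC j x + (-s * x j) • e j)) / 2)
    (f' := fun s => (G' (zeroC j x + (s * x j) • e j) * x j +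
      (G' (zeroC j x + (-s * x j) • e j) * x j) * (-1)) / 2) ?_ ?_
  · simp only [one_mul, neg_mul, zero_mul, neg_zero, zero_smul, add_zero, zeroC_add_smul,
      zeroC_sub_smul, add_self_div_two] at key
    exact key
  · intro s hs
    have h1 : |s| ≤ 1 := abs_le.2 ⟨by linarith [hs.1], hs.2⟩
    exact ((hd s h1).add (HasDerivAt.comp (h₂ := fun c : ℝ => G (zeroC j x + (c * x j) • e j)) s
      (hd (-s) (by simpa using h1)) (hasDerivAt_neg s))).div_const 2
  · intro s hs
    have h1 : |s| ≤ 1 := abs_le.2 ⟨by linarith [hs.1], hs.2⟩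
    have h2 := h'.abs_dif_le hM _ (hmem s h1)
    have h3 : flip j (zeroC j x + (s * x j) • e j) = zeroC j x + (-s * x j) • e j := by
      ext k
      simp only [flip_apply, zeroC_apply, PiLp.add_apply, PiLp.smul_apply, e_apply, smul_eq_mul]
      split_ifs <;> simp
    rw [SignAverage.dif, h3] at h2
    rw [show (G' (zeroC j x + (s * x j) • e j) * x j +
      (G' (zeroC j x + (-s * x j) • e j) * x j) * (-1)) / 2 = ((G' (zeroC j x + (s * x j) • e j) -
        G' (zeroC j x + (-s * x j) • e j)) / 2) * x j by ring, abs_mul]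
    calc _ ≤ (r j * M) * r j := mul_le_mul h2 (hx j) (abs_nonneg _) (by positivity)
      _ = _ := by ring

/-! ### Functions with bounded fourth derivatives -/

lemma hasDerivAt_iteratedFDeriv {F V : Type*} [NormedAddCommGroup F] [NormedSpace ℝ F]
    [NormedAddCommGroup V] [NormedSpace ℝ V] {n : ℕ} {g : V → F} {x v : V} {s : ℝ}
    (hg : ContDiffAt ℝ (n + 1) g (x + s • v)) (m : Fin n → V) :
    HasDerivAt (fun s : ℝ => iteratedFDeriv ℝ n g (x + s • v) m)
      (iteratedFDeriv ℝ (n + 1) g (x + s • v) (Fin.cons v m)) s := by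
  have h1 : DifferentiableAt ℝ (iteratedFDeriv ℝ n g) (x + s • v) :=
    hg.differentiableAt_iteratedFDeriv (by exact_mod_cast Nat.lt_succ_self n)
  have h2 : HasDerivAt (fun s : ℝ => x + s • v) v s := by
    simpa using ((hasDerivAt_id s).smul_const v).const_add x
  have h3 := h1.hasFDerivAt.comp_hasDerivAt s h2
  have h4 := (ContinuousMultilinearMap.apply ℝ (fun _ : Fin n => V) F m).hasFDerivAt.comp_hasDerivAt
    s h3
  convert h4 using 1
  · rfl
  · rw [iteratedFDeriv_succ_apply_left]
    simp

lemma iteratedFDeriv_cons_eq_sum {n : ℕ} (g : E p → ℝ) (x v : E p) (m : Fin n → E p) :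
    iteratedFDeriv ℝ (n + 1) g x (Fin.cons v m) =
      ∑ j, v j * iteratedFDeriv ℝ (n + 1) g x (Fin.cons (e j) m) := by
  have h := fun w : E p => ContinuousMultilinearMap.curryLeft_apply (iteratedFDeriv ℝ (n + 1) g x) w m
  rw [← h]
  conv_lhs => rw [← sum_mul_e v]
  rw [map_sum, sum_apply]
  refine Finset.sum_congr rfl fun j _ => ?_
  rw [map_smul, smul_apply, h, smul_eq_mul]

/-- `g` vanishes to third order at `0`, with a bound on its third derivative at `0` and on its
fourth derivatives on `Ω`. -/
structure JetBound (g : E p → ℝ) (Ω : Set (E p)) (b₃ b : ℝ) : Prop where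
  smooth : ∀ x ∈ Ω, ContDiffAt ℝ 4 g x
  zero : g 0 = 0
  d1 : ∀ v, iteratedFDeriv ℝ 1 g 0 ![v] = 0
  d2 : ∀ u v, iteratedFDeriv ℝ 2 g 0 ![u, v] = 0
  -- Two slots are restricted to basis vectors: there only the absolute column sums of S help, while
  -- in the other slots the Euclidean operator norm is available.
  d3 : ∀ u j k, |iteratedFDeriv ℝ 3 g 0 ![u, e j, e k]| ≤ b₃ * ‖u‖
  d4 : ∀ x ∈ Ω, ∀ u v j k, |iteratedFDeriv ℝ 4 g x ![u, v, e j, e k]| ≤ b * ‖u‖ * ‖v‖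

namespace JetBound

variable {g : E p → ℝ} {Ω : Set (E p)} {b₃ b : ℝ}

lemma ray (hΩ : Convex ℝ Ω) (h0 : 0 ∈ Ω) {x : E p} (hx : x ∈ Ω) {s : ℝ} (hs : s ∈ Set.Icc (0 : ℝ) 1) :
    0 + s • x ∈ Ω := by
  rw [zero_add]
  exact (hΩ.starConvex h0).smul_mem hx hs.1 hs.2

lemma norm_ray {x : E p} {s : ℝ} (hs : s ∈ Set.Icc (0 : ℝ) 1) : ‖0 + s • x‖ ≤ ‖x‖ := by
  rw [zero_add, norm_smul, Real.norm_of_nonneg hs.1]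
  exact mul_le_of_le_one_left (norm_nonneg _) hs.2

/-- Each order of derivative is recovered from the next by integrating along the ray from 0; the
factorials of Taylor's formula are given away. -/
lemma abs_sub_le_ray (h : JetBound g Ω b₃ b) (hΩ : Convex ℝ Ω) (h0 : 0 ∈ Ω) {x : E p} (hx : x ∈ Ω)
    {n : ℕ} (hn : n + 1 ≤ 4) (m : Fin n → E p) {C : ℝ}
    (hC : ∀ y ∈ Ω, ‖y‖ ≤ ‖x‖ → |iteratedFDeriv ℝ (n + 1) g y (Fin.cons x m)| ≤ C) :
    |iteratedFDeriv ℝ n g x m - iteratedFDeriv ℝ n g 0 m| ≤ C := by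
  have := abs_sub_le_of_hasDerivAt (C := C)
    (f := fun s : ℝ => iteratedFDeriv ℝ n g (0 + s • x) m)
    (fun s hs => hasDerivAt_iteratedFDeriv ((h.smooth _ (ray hΩ h0 hx hs)).of_le
      (by exact_mod_cast hn)) m)
    (fun s hs => hC _ (ray hΩ h0 hx hs) (norm_ray hs))
  simpa using this

lemma third (h : JetBound g Ω b₃ b) (hΩ : Convex ℝ Ω) (h0 : 0 ∈ Ω)
    {x : E p} (hx : x ∈ Ω) (u : E p) (j k : Fin p) :
    |iteratedFDeriv ℝ 3 g x ![u, e j, e k]| ≤ (b₃ + b * ‖x‖) * ‖u‖ := by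
  have h1 := h.abs_sub_le_ray hΩ h0 hx (n := 3) (by norm_num) ![u, e j, e k]
    (C := b * ‖x‖ * ‖u‖) fun y hy _ => h.d4 y hy x u j k
  have h2 := h.d3 u j k
  have := abs_sub_abs_le_abs_sub (iteratedFDeriv ℝ 3 g x ![u, e j, e k])
    (iteratedFDeriv ℝ 3 g 0 ![u, e j, e k])
  linarith

lemma second (h : JetBound g Ω b₃ b) (hΩ : Convex ℝ Ω) (h0 : 0 ∈ Ω) (hb : 0 ≤ b)
    {x : E p} (hx : x ∈ Ω) (j k : Fin p) :
    |iteratedFDeriv ℝ 2 g x ![e j, e k]| ≤ (b₃ + b * ‖x‖) * ‖x‖ := by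
  have h1 := h.abs_sub_le_ray hΩ h0 hx (n := 2) (by norm_num) ![e j, e k]
    (C := (b₃ + b * ‖x‖) * ‖x‖) fun y hy hyx =>
      (h.third hΩ h0 hy x j k).trans (by gcongr)
  rwa [h.d2, sub_zero] at h1

/-- `second` controls only matrix entries, so the ray direction is expanded in basis vectors, and
Cauchy-Schwarz costs √p. -/
lemma first (h : JetBound g Ω b₃ b) (hΩ : Convex ℝ Ω) (h0 : 0 ∈ Ω) (hb₃ : 0 ≤ b₃) (hb : 0 ≤ b)
    {x : E p} (hx : x ∈ Ω) (k : Fin p) :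
    |iteratedFDeriv ℝ 1 g x ![e k]| ≤ √p * ‖x‖ * ((b₃ + b * ‖x‖) * ‖x‖) := by
  have h1 := h.abs_sub_le_ray hΩ h0 hx (n := 1) (by norm_num) ![e k]
    (C := √p * ‖x‖ * ((b₃ + b * ‖x‖) * ‖x‖)) fun y hy hyx => ?_
  · rwa [h.d1, sub_zero] at h1
  rw [iteratedFDeriv_cons_eq_sum]
  calc _ ≤ ∑ j, |x j| * ((b₃ + b * ‖x‖) * ‖x‖) := by
        refine (Finset.abs_sum_le_sum_abs _ _).trans (Finset.sum_le_sum fun j _ => ?_)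
        rw [abs_mul]
        refine mul_le_mul_of_nonneg_left ?_ (abs_nonneg _)
        exact (h.second hΩ h0 hb hy j k).trans (by gcongr)
    _ = (∑ j, |x j|) * ((b₃ + b * ‖x‖) * ‖x‖) := by rw [Finset.sum_mul]
    _ ≤ _ := by gcongr; exact sum_abs_le x

/-- A second expansion costs another √p. The resulting factor p is too large for the main term; this
bound serves for integrability and for the region outside the central ball. -/
lemma abs_le (h : JetBound g Ω b₃ b) (hΩ : Convex ℝ Ω) (h0 : 0 ∈ Ω) (hb₃ : 0 ≤ b₃) (hb : 0 ≤ b)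
    {x : E p} (hx : x ∈ Ω) : |g x| ≤ p * (b₃ + b * ‖x‖) * ‖x‖ ^ 3 := by
  have h1 := h.abs_sub_le_ray hΩ h0 hx (n := 0) (by norm_num) ![]
    (C := √p * ‖x‖ * (√p * ‖x‖ * ((b₃ + b * ‖x‖) * ‖x‖))) fun y hy hyx => ?_
  · simp only [iteratedFDeriv_zero_apply, h.zero, sub_zero] at h1
    refine h1.trans (le_of_eq ?_)
    nth_rw 3 [← Real.mul_self_sqrt (Nat.cast_nonneg p)]
    ring
  rw [iteratedFDeriv_cons_eq_sum]
  calc _ ≤ ∑ j, |x j| * (√p * ‖x‖ * ((b₃ + b * ‖x‖) * ‖x‖)) := by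
        refine (Finset.abs_sum_le_sum_abs _ _).trans (Finset.sum_le_sum fun j _ => ?_)
        rw [abs_mul]
        refine mul_le_mul_of_nonneg_left ?_ (abs_nonneg _)
        exact (h.first hΩ h0 hb₃ hb hy j).trans (by gcongr)
    _ = (∑ j, |x j|) * (√p * ‖x‖ * ((b₃ + b * ‖x‖) * ‖x‖)) := by rw [Finset.sum_mul]
    _ ≤ _ := by gcongr; exact sum_abs_le x

lemma hasPartial (h : JetBound g Ω b₃ b) {s : Set (E p)} (hs : s ⊆ Ω) {n : ℕ} (hn : n + 1 ≤ 4)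
    (m : Fin n → E p) (j : Fin p) :
    HasPartial (fun y => iteratedFDeriv ℝ n g y m)
      (fun y => iteratedFDeriv ℝ (n + 1) g y (Fin.cons (e j) m)) j s := by
  intro y hy
  simpa using hasDerivAt_iteratedFDeriv (s := 0) (x := y) (v := e j) (g := g) (n := n)
    (by simpa using (h.smooth y (hs hy)).of_le (by exact_mod_cast hn)) m

lemma box_subset {w : E p} (hw : Metric.closedBall 0 ‖w‖ ⊆ Ω) : box (fun j => |w j|) ⊆ Ω := by
  intro x hx
  refine hw ?_
  have := norm_le_of_mem_box hx
  rw [mem_closedBall_zero_iff, EuclideanSpace.norm_eq w]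
  simpa using this

lemma norm_le_of_mem_box' {w x : E p} (hx : x ∈ box (fun j => |w j|)) : ‖x‖ ≤ ‖w‖ := by
  have := norm_le_of_mem_box hx
  rw [EuclideanSpace.norm_eq w]
  simpa using this

lemma sum_sq_eq (w : E p) : ∑ j, |w j| ^ 2 = ‖w‖ ^ 2 := by
  rw [EuclideanSpace.norm_sq_eq]
  simp

lemma partial_zero (h : JetBound g Ω b₃ b) {s : Set (E p)} (hs : s ⊆ Ω) (j : Fin p) :
    HasPartial g (fun y => iteratedFDeriv ℝ 1 g y ![e j]) j s :=
  h.hasPartial hs (n := 0) (by norm_num) ![] j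

lemma partial_one (h : JetBound g Ω b₃ b) {s : Set (E p)} (hs : s ⊆ Ω) (j k : Fin p) :
    HasPartial (fun y => iteratedFDeriv ℝ 1 g y ![e j])
      (fun y => iteratedFDeriv ℝ 2 g y ![e k, e j]) k s :=
  h.hasPartial hs (n := 1) (by norm_num) ![e j] k

lemma partial_two (h : JetBound g Ω b₃ b) {s : Set (E p)} (hs : s ⊆ Ω) (i j k : Fin p) :
    HasPartial (fun y => iteratedFDeriv ℝ 2 g y ![e i, e j])
      (fun y => iteratedFDeriv ℝ 3 g y ![e k, e i, e j]) k s :=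
  h.hasPartial hs (n := 2) (by norm_num) ![e i, e j] k

lemma abs_avg_sub_le (h : JetBound g Ω b₃ b) (hΩ : Convex ℝ Ω) (hb : 0 ≤ b)
    (hb₃ : 0 ≤ b₃) {w : E p} (hw : Metric.closedBall 0 ‖w‖ ⊆ Ω) (j : Fin p) :
    ∀ x ∈ box (fun j => |w j|),
      |avg flip j g x - g (zeroC j x)| ≤ |w j| ^ 2 * ((b₃ + b * ‖w‖) * ‖w‖) := by
  have h0 : (0 : E p) ∈ Ω := hw (by simp)
  have hbox := box_subset hw
  refine (h.partial_zero hbox j).abs_avg_sub_le (h.partial_one hbox j j) fun x hx => ?_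
  have hxw := norm_le_of_mem_box' hx
  exact (h.second hΩ h0 hb (hbox hx) j j).trans (by gcongr)

/-- Second moment over random signs. -/
theorem signAvg_sq_le (h : JetBound g Ω b₃ b) (hΩ : Convex ℝ Ω) (hb₃ : 0 ≤ b₃) (hb : 0 ≤ b)
    {w : E p} (hw : Metric.closedBall 0 ‖w‖ ⊆ Ω) :
    signAvg (fun y => g y ^ 2) w ≤ 6 * (b₃ + b * ‖w‖) ^ 2 * ‖w‖ ^ 6 := by
  have h0 : (0 : E p) ∈ Ω := hw (by simp)
  have hbox := box_subset hw
  set B₃ := b₃ + b * ‖w‖ with hB₃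
  have hB₃0 : 0 ≤ B₃ := by positivity
  have h2 : ∀ j k, ∀ x ∈ box (fun j => |w j|), |iteratedFDeriv ℝ 2 g x ![e j, e k]| ≤ B₃ * ‖w‖ := by
    intro j k x hx
    have hxw := norm_le_of_mem_box' hx
    exact (h.second hΩ h0 hb (hbox hx) j k).trans (by rw [hB₃]; gcongr)
  have h3 : ∀ i j k, ∀ x ∈ box (fun j => |w j|), |iteratedFDeriv ℝ 3 g x ![e i, e j, e k]| ≤ B₃ := by
    intro i j k x hx
    have hxw := norm_le_of_mem_box' hx
    refine (h.third hΩ h0 (hbox hx) (e i) j k).trans ?_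
    rw [norm_e, mul_one, hB₃]
    gcongr
  -- With B₂ = B₃‖w‖ both terms are multiples of B₃²‖w‖⁶, with total coefficient 4 + 2 = 6.
  have key := Saddlepoint.signAvg_sq_le (g := g) (r := fun j => |w j|) (B₂ := B₃ * ‖w‖) (B₃ := B₃)
    (fun j => abs_nonneg _) hB₃0 h.zero
    (h.abs_avg_sub_le hΩ hb hb₃ hw) ?_ ?_ ?_ w (fun j => le_rfl)
  · rw [sum_sq_eq] at key
    refine key.trans (le_of_eq ?_)
    ring
  · intro j k hjk x hx
    have := ((h.partial_zero hbox k).dif hjk).abs_dif_le (M := |w j| * (B₃ * ‖w‖))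
      (fun y hy => (h.partial_one hbox k j).abs_dif_le (fun z hz => h2 j k z hz) y hy) x hx
    refine this.trans (le_of_eq ?_)
    ring
  · intro j k hjk
    exact ((h.partial_zero hbox k).dif hjk).abs_avg_sub_le ((h.partial_one hbox k k).dif hjk)
      (fun y hy => (h.partial_two hbox k k j).abs_dif_le (fun z hz => h3 j k k z hz) y hy)
  · intro j s hs
    -- The box shrinks to a segment of the j-th axis. There only the pure second derivative in
    -- direction j enters the first derivative, so no √p is lost.
    set r' : Fin p → ℝ := fun k => if k = j then |w j| else 0 with hr'
    have hsub : box r' ⊆ box (fun j => |w j|) := by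
      intro x hx k
      refine (hx k).trans ?_
      simp only [hr']
      split_ifs with hk
      · rw [hk]
      · exact abs_nonneg _
    have hmem : s • e j ∈ box r' := by
      intro k
      simp only [hr', PiLp.smul_apply, e_apply, smul_eq_mul]
      split_ifs <;> simp [hs]
    have := (h.partial_zero (hsub.trans hbox) j).abs_dif_le (M := |w j| * (B₃ * ‖w‖))
      (fun y hy => ?_) _ hmem
    · simp only [hr', if_true] at this
      refine this.trans (le_of_eq ?_)
      ring
    · have hy' : y = y j • e j := by
        ext k
        have := hy k
        simp only [hr'] at this
        simp only [PiLp.smul_apply, e_apply, smul_eq_mul]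
        split_ifs at this ⊢ with hk
        · simp [hk]
        · simpa using this
      have hyn := norm_le_of_mem_box' (hsub hy)
      have := h.abs_sub_le_ray hΩ h0 (hbox (hsub hy)) (n := 1) (by norm_num) ![e j]
        (C := |w j| * (B₃ * ‖w‖)) fun z hz hzy => ?_
      · rwa [h.d1, sub_zero] at this
      rw [iteratedFDeriv_cons_eq_sum, Finset.sum_eq_single j, abs_mul]
      · refine mul_le_mul ?_ ?_ (abs_nonneg _) (abs_nonneg _)
        · have := hy j
          simpa only [hr', if_true] using this
        · refine (h.second hΩ h0 hb hz j j).trans ?_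
          rw [hB₃]
          gcongr <;> exact hzy.trans hyn
      · intro k _ hk
        have := hy k
        simp only [hr', if_neg hk] at this
        rw [abs_nonpos_iff.1 this, zero_mul]
      · simp

/-- Exponential moment over random signs. -/
theorem signAvg_exp_le (h : JetBound g Ω b₃ b) (hΩ : Convex ℝ Ω) (hb₃ : 0 ≤ b₃) (hb : 0 ≤ b)
    {w : E p} (hw : Metric.closedBall 0 ‖w‖ ⊆ Ω) (c : ℝ) :
    signAvg (fun y => Real.exp (c * g y)) w ≤
      Real.exp (|c| * ((b₃ + b * ‖w‖) * ‖w‖ ^ 3) +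
        c ^ 2 * (p * (b₃ + b * ‖w‖) ^ 2 * ‖w‖ ^ 6) / 2) := by
  have h0 : (0 : E p) ∈ Ω := hw (by simp)
  have hbox := box_subset hw
  set B₃ := b₃ + b * ‖w‖ with hB₃
  have hB₃0 : 0 ≤ B₃ := by positivity
  -- The √p of `first` is tolerable here: it is squared and occurs only in the sub-Gaussian variance
  -- term, as the factor p.
  have hd : ∀ j, ∀ x ∈ box (fun j => |w j|), |dif flip j (fun y => c * g y) x| ≤
      |c| * (|w j| * (√p * ‖w‖ * (B₃ * ‖w‖))) := by
    intro j x hx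
    have h1 : dif flip j (fun y => c * g y) x = c * dif flip j g x := by simp only [dif]; ring
    rw [h1, abs_mul]
    refine mul_le_mul_of_nonneg_left ?_ (abs_nonneg _)
    refine (h.partial_zero hbox j).abs_dif_le (fun y hy => ?_) x hx
    have hyw := norm_le_of_mem_box' hy
    exact (h.first hΩ h0 hb₃ hb (hbox hy) j).trans (by rw [hB₃]; gcongr)
  refine (avgL_exp_le flip_comm (flip_mem_box fun j => |w j|) (List.finRange p)
    (fun y => c * g y) _ hd w (fun j => le_rfl)).trans (Real.exp_le_exp.2 ?_)
  refine add_le_add ?_ ?_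
  · rw [avgL_smul]
    refine (le_abs_self _).trans ?_
    rw [abs_mul]
    refine mul_le_mul_of_nonneg_left ?_ (abs_nonneg _)
    refine (abs_signAvg_le h.zero (h.abs_avg_sub_le hΩ hb hb₃ hw) w (fun j => le_rfl)).trans ?_
    rw [sum_sq_eq]
    refine le_of_eq ?_
    ring
  · rw [← Fin.sum_univ_def, ← Finset.sum_div]
    refine div_le_div_of_nonneg_right (le_of_eq ?_) two_pos.le
    have : ∀ j, (|c| * (|w j| * (√p * ‖w‖ * (B₃ * ‖w‖)))) ^ 2 =
        (c ^ 2 * (p * B₃ ^ 2 * ‖w‖ ^ 4)) * |w j| ^ 2 := by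
      intro j
      have := Real.sq_sqrt (Nat.cast_nonneg (α := ℝ) p)
      rw [mul_pow, mul_pow, mul_pow, mul_pow, mul_pow, this, sq_abs c]
      ring
    rw [Finset.sum_congr rfl fun j _ => this j, ← Finset.mul_sum, sum_sq_eq]
    ring

end JetBound

end Saddlepoint

/-! ### Sign changes preserve Lebesgue measure -/

namespace Saddlepoint

variable {p : ℕ}

open SignAverage

/-- Change of sign of a coordinate, as a linear isometry. -/
noncomputable def flipIsometry (j : Fin p) : E p ≃ₗᵢ[ℝ] E p where
  toLinearEquiv := LinearEquiv.ofInvolutive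
    { toFun := flip j
      map_add' := fun x y => by ext k; simp only [flip_apply, PiLp.add_apply]; split_ifs <;> ring
      map_smul' := fun c x => by
        ext k; simp only [flip_apply, PiLp.smul_apply, smul_eq_mul, RingHom.id_apply]
        split_ifs <;> ring }
    (flip_flip j)
  norm_map' := fun x => by
    change ‖flip j x‖ = ‖x‖
    rw [EuclideanSpace.norm_eq, EuclideanSpace.norm_eq]
    congr 1
    refine Finset.sum_congr rfl fun k _ => ?_
    rw [flip_apply]
    split_ifs <;> simp

lemma norm_flip (j : Fin p) (x : E p) : ‖flip j x‖ = ‖x‖ := (flipIsometry j).norm_map x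

lemma measurePreserving_flip (j : Fin p) : MeasurePreserving (flip j : E p → E p) :=
  (flipIsometry j).measurePreserving

lemma integrable_comp_flip {G : E p → ℝ} (hG : Integrable G) (j : Fin p) :
    Integrable (fun x => G (flip j x)) :=
  (measurePreserving_flip j).integrable_comp_of_integrable hG

lemma integral_comp_flip (G : E p → ℝ) (j : Fin p) : ∫ x, G (flip j x) = ∫ x, G x :=
  (measurePreserving_flip j).integral_comp
    (flipIsometry j).toHomeomorph.toMeasurableEquiv.measurableEmbedding G

lemma integral_signAvg {G : E p → ℝ} (hG : Integrable G) :
    Integrable (signAvg G) ∧ ∫ x, signAvg G x = ∫ x, G x := by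
  unfold signAvg
  induction List.finRange p with
  | nil => exact ⟨hG, rfl⟩
  | cons j l ih =>
    obtain ⟨h1, h2⟩ := ih
    refine ⟨(h1.add (integrable_comp_flip h1 j)).div_const 2, ?_⟩
    simp only [avgL_cons, avg]
    rw [integral_div, integral_add h1 (integrable_comp_flip h1 j), integral_comp_flip, h2]
    ring

/-! ### Gaussian integrals -/

lemma integrable_exp_neg_mul_sq {c : ℝ} (hc : 0 < c) :
    Integrable (fun w : E p => Real.exp (-c * ‖w‖ ^ 2)) := by
  have := GaussianFourier.integrable_cexp_neg_mul_sq_norm_add (V := E p) (b := (c : ℂ))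
    (by simpa using hc) 0 0
  refine (this.norm).congr (Eventually.of_forall fun w => ?_)
  simp only [Complex.norm_exp]
  congr 1
  simp [← Complex.ofReal_pow, ← Complex.ofReal_mul]

lemma integral_exp_neg_mul_sq {c : ℝ} (hc : 0 < c) :
    ∫ w : E p, Real.exp (-c * ‖w‖ ^ 2) = (Real.pi / c) ^ ((p : ℝ) / 2) := by
  rw [GaussianFourier.integral_rexp_neg_mul_sq_norm hc, finrank_euclideanSpace, Fintype.card_fin]

/-- The normalizing constant of the standard Gaussian density. -/
noncomputable def gaussZ (p : ℕ) : ℝ := (2 * Real.pi) ^ ((p : ℝ) / 2)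

lemma gaussZ_pos (p : ℕ) : 0 < gaussZ p := by unfold gaussZ; positivity

lemma integral_exp_eq_gaussZ_mul {c : ℝ} (hc : 0 < c) :
    ∫ w : E p, Real.exp (-c * ‖w‖ ^ 2) = (1 / (2 * c)) ^ ((p : ℝ) / 2) * gaussZ p := by
  rw [integral_exp_neg_mul_sq hc, gaussZ, ← Real.mul_rpow (by positivity) (by positivity)]
  congr 1
  field_simp

/-- Weakening the Gaussian exponent by ‖w‖²/(4p) multiplies the integral by (1 - 1/(2p))^{-p/2},
which Bernoulli's inequality bounds independently of p. -/
lemma integral_exp_moment_le (hp : 1 ≤ p) :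
    ∫ w : E p, Real.exp (-(1 / 2 - 1 / (4 * p)) * ‖w‖ ^ 2) ≤ 2 * gaussZ p := by
  have hp' : (1 : ℝ) ≤ p := by exact_mod_cast hp
  have hx : (1 : ℝ) / (4 * p) ≤ 1 / 4 := by
    rw [div_le_div_iff₀ (by positivity) (by norm_num)]; linarith
  have hx0 : (0 : ℝ) < 1 / (4 * p) := by positivity
  rw [integral_exp_eq_gaussZ_mul (by linarith)]
  refine mul_le_mul_of_nonneg_right ?_ (gaussZ_pos p).le
  have h1 : (1 : ℝ) / 2 ≤ (1 - 1 / (2 * p)) ^ p := by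
    have := one_add_mul_le_pow (a := -(1 / (2 * (p : ℝ)))) (by
      have : (1 : ℝ) / (2 * p) ≤ 1 / 2 := by
        rw [div_le_div_iff₀ (by positivity) (by norm_num)]; linarith
      linarith) p
    have h2 : 1 + (p : ℝ) * -(1 / (2 * (p : ℝ))) = 1 / 2 := by field_simp; norm_num
    rw [h2] at this
    simpa [sub_eq_add_neg] using this
  have h3 : (1 : ℝ) / (2 * (1 / 2 - 1 / (4 * p))) = (1 - 1 / (2 * (p : ℝ)))⁻¹ := by
    rw [one_div]; congr 1; field_simp; ring
  have h4 : (0 : ℝ) < 1 - 1 / (2 * p) := by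
    have : (1 : ℝ) / (2 * p) ≤ 1 / 2 := by
      rw [div_le_div_iff₀ (by positivity) (by norm_num)]; linarith
    linarith
  rw [h3]
  have h5 : (1 : ℝ) ≤ (1 - 1 / (2 * (p : ℝ)))⁻¹ := by
    rw [one_le_inv₀ h4]
    have : (0 : ℝ) < 1 / (2 * p) := by positivity
    linarith
  calc ((1 - 1 / (2 * (p : ℝ)))⁻¹) ^ ((p : ℝ) / 2) ≤ ((1 - 1 / (2 * (p : ℝ)))⁻¹) ^ (p : ℝ) :=
        Real.rpow_le_rpow_of_exponent_le h5 (by linarith)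
    _ = ((1 - 1 / (2 * (p : ℝ))) ^ p)⁻¹ := by rw [Real.rpow_natCast, inv_pow]
    _ ≤ (1 / 2)⁻¹ := inv_anti₀ (by norm_num) h1
    _ = 2 := by norm_num

/-- One term of the exponential series. With `integral_exp_moment_le` it yields Gaussian moments of
‖w‖^(2k) of the right order p^k. -/
lemma norm_pow_le_exp (hp : 1 ≤ p) (k : ℕ) (w : E p) :
    ‖w‖ ^ (2 * k) ≤ k.factorial * (4 * p) ^ k * Real.exp (1 / (4 * p) * ‖w‖ ^ 2) := by
  have hp' : (1 : ℝ) ≤ p := by exact_mod_cast hp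
  have h := Real.pow_div_factorial_le_exp (1 / (4 * p) * ‖w‖ ^ 2) (by positivity) k
  rw [div_le_iff₀ (by positivity)] at h
  calc ‖w‖ ^ (2 * k) = (4 * p) ^ k * (1 / (4 * p) * ‖w‖ ^ 2) ^ k := by
        rw [← mul_pow, pow_mul]; congr 1; field_simp
    _ ≤ (4 * p) ^ k * (Real.exp (1 / (4 * p) * ‖w‖ ^ 2) * k.factorial) := by gcongr
    _ = _ := by ring

/-! ### The central part of the integral -/

/-- From |e^x - 1| ≤ |x| e^{|x|} and the weighted arithmetic-geometric mean inequality, so that only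
the second moment and exponential moments of x are needed. The weight τ will be of the order of the
root mean square of x. -/
lemma abs_exp_mul_cos_sub_one_le (x y τ : ℝ) (hτ : 0 < τ) :
    |Real.exp x * Real.cos y - 1| ≤
      x ^ 2 / (2 * τ) + τ / 2 * (Real.exp (2 * x) + Real.exp (-2 * x)) + y ^ 2 / 2 := by
  have h1 : |Real.exp x - 1| ≤ |x| * Real.exp |x| := by
    rcases le_total 0 x with hx | hx
    · rw [abs_of_nonneg hx, abs_of_nonneg (by have := Real.add_one_le_exp x; linarith)]
      have := Real.add_one_le_exp (-x)
      have h2 : Real.exp x * Real.exp (-x) = 1 := by rw [← Real.exp_add]; simp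
      nlinarith [Real.exp_pos x]
    · rw [abs_of_nonpos hx, abs_of_nonpos (by simpa using hx)]
      have h2 := Real.add_one_le_exp x
      have h3 : 1 ≤ Real.exp (-x) := Real.one_le_exp (by linarith)
      nlinarith
  have h2 : |x| * Real.exp |x| ≤ x ^ 2 / (2 * τ) + τ / 2 * Real.exp (2 * |x|) := by
    have h3 : Real.exp (2 * |x|) = Real.exp |x| ^ 2 := by rw [← Real.exp_nat_mul]; norm_num
    rw [h3, ← sq_abs x, ← sub_nonneg]
    have : |x| ^ 2 / (2 * τ) + τ / 2 * Real.exp |x| ^ 2 - |x| * Real.exp |x| =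
        (|x| - τ * Real.exp |x|) ^ 2 / (2 * τ) := by field_simp; ring
    rw [this]
    positivity
  have h4 : Real.exp (2 * |x|) ≤ Real.exp (2 * x) + Real.exp (-2 * x) := by
    rcases abs_choice x with h | h <;> rw [h]
    · linarith [Real.exp_pos (-2 * x)]
    · rw [show 2 * -x = -2 * x by ring]; linarith [Real.exp_pos (2 * x)]
  have h5 : |Real.cos y - 1| ≤ y ^ 2 / 2 := by
    rw [abs_of_nonpos (by linarith [Real.cos_le_one y])]
    linarith [Real.one_sub_sq_div_two_le_cos (x := y)]
  have h6 : |Real.exp x * Real.cos y - 1| ≤ |Real.exp x - 1| + |Real.cos y - 1| := by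
    have : Real.exp x * Real.cos y - 1 = (Real.exp x - 1) * Real.cos y + (Real.cos y - 1) := by ring
    rw [this]
    refine (abs_add_le _ _).trans (add_le_add_left ?_ _)
    rw [abs_mul]
    exact mul_le_of_le_one_right (abs_nonneg _) (Real.abs_cos_le_one y)
  have h7 : τ / 2 * Real.exp (2 * |x|) ≤ τ / 2 * (Real.exp (2 * x) + Real.exp (-2 * x)) := by
    gcongr
  linarith

/-- Pointwise bound for the average over signs in the central part. -/
lemma signAvg_abs_exp_mul_cos_sub_one_le {P Θ : E p → ℝ} {Ω : Set (E p)} {b₃ b ρ : ℝ} (hp : 1 ≤ p)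
    (hP : JetBound P Ω 0 b) (hΘ : JetBound Θ Ω b₃ b) (hΩ : Convex ℝ Ω) (hb₃ : 0 ≤ b₃) (hb : 0 < b)
    {w : E p} (hw : Metric.closedBall 0 ‖w‖ ⊆ Ω) (hwρ : ‖w‖ ≤ ρ) (hbp : b * p ^ 2 ≤ 1)
    (hρ : 2 * b * ρ ^ 4 + 2 * p * b ^ 2 * ρ ^ 8 ≤ 1) :
    signAvg (fun x => |Real.exp (P x) * Real.cos (Θ x) - 1|) w ≤
      100000 * (b * p ^ 2 + b₃ ^ 2 * p ^ 3) * Real.exp (1 / (4 * p) * ‖w‖ ^ 2) := by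
  have hp' : (1 : ℝ) ≤ p := by exact_mod_cast hp
  have hτ : 0 < b * p ^ 2 := by positivity
  -- Here τ = b p²: the mean of P² is of order b² p⁴, which balances P²/τ against τ.
  have h1 : signAvg (fun x => |Real.exp (P x) * Real.cos (Θ x) - 1|) w ≤
      (1 / (2 * (b * p ^ 2)) * signAvg (fun x => P x ^ 2) w + b * p ^ 2 / 2 *
        (signAvg (fun x => Real.exp (2 * P x)) w + signAvg (fun x => Real.exp (-2 * P x)) w)) +
      1 / 2 * signAvg (fun x => Θ x ^ 2) w := by
    simp only [signAvg]
    rw [← congrFun (avgL_smul _ _ fun x => P x ^ 2) w, ← congrFun (avgL_smul _ _ fun x => Θ x ^ 2) w,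
      ← congrFun (avgL_add _ _ _) w, ← congrFun (avgL_smul _ _ _) w,
      ← congrFun (avgL_add _ _ _) w, ← congrFun (avgL_add _ _ _) w]
    refine avgL_mono (s := Set.univ) (fun _ _ _ => trivial) _ (fun x _ => ?_) w trivial
    refine (abs_exp_mul_cos_sub_one_le (P x) (Θ x) (b * p ^ 2) hτ).trans (le_of_eq ?_)
    ring
  have h2 := hP.signAvg_sq_le hΩ le_rfl hb.le hw
  have h3 := hΘ.signAvg_sq_le hΩ hb₃ hb.le hw
  -- The hypothesis hρ says precisely that the exponent is at most 1, and e < 3.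
  have hexp : ∀ c : ℝ, |c| = 2 → signAvg (fun x => Real.exp (c * P x)) w ≤ 3 := by
    intro c hc
    refine (hP.signAvg_exp_le hΩ le_rfl hb.le hw c).trans ?_
    refine le_trans (Real.exp_le_exp.2 ?_) (Real.exp_one_lt_d9.le.trans (by norm_num : _ ≤ (3 : ℝ)))
    refine le_trans ?_ hρ
    have hc2 : c ^ 2 = 4 := by rw [← sq_abs, hc]; norm_num
    rw [hc, hc2, zero_add]
    have h4 : ‖w‖ ^ 4 ≤ ρ ^ 4 := by gcongr
    have h8 : ‖w‖ ^ 8 ≤ ρ ^ 8 := by gcongr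
    calc 2 * (b * ‖w‖ * ‖w‖ ^ 3) + 4 * (p * (b * ‖w‖) ^ 2 * ‖w‖ ^ 6) / 2
        = 2 * b * ‖w‖ ^ 4 + 2 * p * b ^ 2 * ‖w‖ ^ 8 := by ring
      _ ≤ _ := by gcongr
  have e1 := hexp 2 (by norm_num)
  have e2 := hexp (-2) (by norm_num)
  set X := Real.exp (1 / (4 * p) * ‖w‖ ^ 2) with hX
  have hX1 : 1 ≤ X := Real.one_le_exp (by positivity)
  have m3 := norm_pow_le_exp hp 3 w
  have m4 := norm_pow_le_exp hp 4 w
  rw [← hX] at m3 m4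
  norm_num [Nat.factorial, mul_pow] at m3 m4
  have t1 : 1 / (2 * (b * p ^ 2)) * signAvg (fun x => P x ^ 2) w ≤ 18432 * (b * p ^ 2) * X := by
    calc _ ≤ 1 / (2 * (b * p ^ 2)) * (6 * (0 + b * ‖w‖) ^ 2 * ‖w‖ ^ 6) := by gcongr
      _ = 1 / (2 * (b * p ^ 2)) * (6 * b ^ 2) * ‖w‖ ^ 8 := by ring
      _ ≤ 1 / (2 * (b * p ^ 2)) * (6 * b ^ 2) * (24 * (256 * p ^ 4) * X) := by gcongr
      _ = _ := by field_simp; norm_num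
  have t2 : b * p ^ 2 / 2 * (signAvg (fun x => Real.exp (2 * P x)) w +
      signAvg (fun x => Real.exp (-2 * P x)) w) ≤ 3 * (b * p ^ 2) * X := by
    calc _ ≤ b * p ^ 2 / 2 * (3 + 3) := by gcongr
      _ = 3 * (b * p ^ 2) * 1 := by ring
      _ ≤ _ := by gcongr
  have t3 : 1 / 2 * signAvg (fun x => Θ x ^ 2) w ≤
      2304 * (b₃ ^ 2 * p ^ 3) * X + 36864 * (b * p ^ 2) * X := by
    have hq : (b₃ + b * ‖w‖) ^ 2 ≤ 2 * b₃ ^ 2 + 2 * (b * ‖w‖) ^ 2 := by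
      nlinarith [sq_nonneg (b₃ - b * ‖w‖)]
    have hbb : b ^ 2 * p ^ 4 ≤ b * p ^ 2 := by nlinarith
    calc _ ≤ 1 / 2 * (6 * (2 * b₃ ^ 2 + 2 * (b * ‖w‖) ^ 2) * ‖w‖ ^ 6) := by
          refine mul_le_mul_of_nonneg_left (h3.trans ?_) (by norm_num)
          gcongr
      _ = 6 * b₃ ^ 2 * ‖w‖ ^ 6 + 6 * b ^ 2 * ‖w‖ ^ 8 := by ring
      _ ≤ 6 * b₃ ^ 2 * (6 * (64 * p ^ 3) * X) + 6 * b ^ 2 * (24 * (256 * p ^ 4) * X) := by gcongr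
      _ = 2304 * (b₃ ^ 2 * p ^ 3) * X + 36864 * (b ^ 2 * p ^ 4) * X := by ring
      _ ≤ _ := by gcongr
  -- The coefficients of b p² add up to 18432 + 3 + 36864, below 100000.
  have hX0 : 0 ≤ (b * p ^ 2) * X := by positivity
  have hX0' : 0 ≤ (b₃ ^ 2 * p ^ 3) * X := by positivity
  nlinarith

/-- The absolute value is taken before averaging over signs. The averaged integrand is then bounded
pointwise, by a multiple of a slightly weakened Gaussian. -/
theorem abs_integral_center_le {P Θ : E p → ℝ} {Ω : Set (E p)} {b₃ b ρ : ℝ} (hp : 1 ≤ p)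
    (hP : JetBound P Ω 0 b) (hΘ : JetBound Θ Ω b₃ b) (hΩ : Convex ℝ Ω) (hb₃ : 0 ≤ b₃) (hb : 0 < b)
    (hρΩ : Metric.ball 0 ρ ⊆ Ω) (hbp : b * p ^ 2 ≤ 1)
    (hρ : 2 * b * ρ ^ 4 + 2 * p * b ^ 2 * ρ ^ 8 ≤ 1) :
    IntegrableOn (fun w => Real.exp (-(1 / 2) * ‖w‖ ^ 2) *
      (Real.exp (P w) * Real.cos (Θ w) - 1)) (Metric.ball 0 ρ) ∧
    |∫ w in Metric.ball 0 ρ, Real.exp (-(1 / 2) * ‖w‖ ^ 2) *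
      (Real.exp (P w) * Real.cos (Θ w) - 1)| ≤
      200000 * (b * p ^ 2 + b₃ ^ 2 * p ^ 3) * gaussZ p := by
  have hp' : (1 : ℝ) ≤ p := by exact_mod_cast hp
  set F : E p → ℝ := fun w => Real.exp (P w) * Real.cos (Θ w) - 1 with hF
  have hcb : ∀ w ∈ Metric.ball (0 : E p) ρ, Metric.closedBall 0 ‖w‖ ⊆ Ω := fun w hw =>
    (Metric.closedBall_subset_ball (by simpa using hw)).trans hρΩ
  have hcont : ContinuousOn (fun w => Real.exp (-(1 / 2) * ‖w‖ ^ 2) * F w) (Metric.ball 0 ρ) := by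
    have hPc : ContinuousOn P (Metric.ball 0 ρ) := fun w hw =>
      (hP.smooth w (hρΩ hw)).continuousAt.continuousWithinAt
    have hΘc : ContinuousOn Θ (Metric.ball 0 ρ) := fun w hw =>
      (hΘ.smooth w (hρΩ hw)).continuousAt.continuousWithinAt
    refine ContinuousOn.mul (by fun_prop) ?_
    exact ((Real.continuous_exp.comp_continuousOn hPc).mul
      (Real.continuous_cos.comp_continuousOn hΘc)).sub continuousOn_const
  have hint : IntegrableOn (fun w => Real.exp (-(1 / 2) * ‖w‖ ^ 2) * F w) (Metric.ball 0 ρ) := by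
    refine IntegrableOn.of_bound measure_ball_lt_top (hcont.aestronglyMeasurable measurableSet_ball)
      (Real.exp (p * b * ρ ^ 4) + 1) ?_
    refine (ae_restrict_iff' measurableSet_ball).2 (Eventually.of_forall fun w hw => ?_)
    have h1 := hP.abs_le hΩ (hcb w hw (by simp)) le_rfl hb.le (hρΩ hw)
    have hwρ : ‖w‖ ≤ ρ := (mem_ball_zero_iff.1 hw).le
    have h2 : P w ≤ p * b * ρ ^ 4 := by
      refine (le_abs_self _).trans (h1.trans ?_)
      calc p * (0 + b * ‖w‖) * ‖w‖ ^ 3 = p * b * ‖w‖ ^ 4 := by ring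
        _ ≤ _ := by gcongr
    have h3 : |F w| ≤ Real.exp (P w) + 1 := by
      refine (abs_sub _ _).trans ?_
      rw [abs_mul, Real.abs_exp, abs_one]
      have := mul_le_of_le_one_right (Real.exp_pos (P w)).le (Real.abs_cos_le_one (Θ w))
      linarith
    rw [norm_mul, Real.norm_of_nonneg (Real.exp_pos _).le]
    have h4 : Real.exp (-(1 / 2) * ‖w‖ ^ 2) ≤ 1 := Real.exp_le_one_iff.2 (by nlinarith [sq_nonneg ‖w‖])
    calc _ ≤ 1 * |F w| := mul_le_mul_of_nonneg_right h4 (abs_nonneg _)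
      _ ≤ Real.exp (P w) + 1 := by rwa [one_mul]
      _ ≤ _ := by gcongr
  refine ⟨hint, ?_⟩
  set G : E p → ℝ := (Metric.ball 0 ρ).indicator fun w => Real.exp (-(1 / 2) * ‖w‖ ^ 2) * |F w| with hG
  have hGint : Integrable G := by
    rw [hG, integrable_indicator_iff measurableSet_ball]
    refine hint.norm.congr (Eventually.of_forall fun w => ?_)
    simp only [norm_mul, Real.norm_of_nonneg (Real.exp_pos _).le, Real.norm_eq_abs]
  obtain ⟨hA, hAe⟩ := integral_signAvg hGint
  calc |∫ w in Metric.ball 0 ρ, Real.exp (-(1 / 2) * ‖w‖ ^ 2) * F w|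
      ≤ ∫ w in Metric.ball 0 ρ, Real.exp (-(1 / 2) * ‖w‖ ^ 2) * |F w| := by
        rw [← Real.norm_eq_abs]
        refine (norm_integral_le_integral_norm _).trans (le_of_eq ?_)
        refine integral_congr_ae (Eventually.of_forall fun w => ?_)
        simp only [norm_mul, Real.norm_of_nonneg (Real.exp_pos _).le, Real.norm_eq_abs]
    _ = ∫ w, G w := (integral_indicator measurableSet_ball).symm
    _ = ∫ w, signAvg G w := hAe.symm
    _ ≤ ∫ w : E p, 100000 * (b * p ^ 2 + b₃ ^ 2 * p ^ 3) *
          Real.exp (-(1 / 2 - 1 / (4 * p)) * ‖w‖ ^ 2) := by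
        refine integral_mono hA (Integrable.const_mul (integrable_exp_neg_mul_sq ?_) _) fun w => ?_
        · have hx : (1 : ℝ) / (4 * p) ≤ 1 / 4 := by
            rw [div_le_div_iff₀ (by positivity) (by norm_num)]; linarith
          linarith
        -- The sphere through w is stable under sign changes, and on it the Gaussian weight and the
        -- indicator of the ball are constant, so both leave the average.
        have hs : ∀ j, ∀ x ∈ {x : E p | ‖x‖ = ‖w‖}, flip j x ∈ {x : E p | ‖x‖ = ‖w‖} :=
          fun j x hx => by simpa [norm_flip] using hx
        by_cases hw : w ∈ Metric.ball (0 : E p) ρ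
        · have h1 : signAvg G w ≤ Real.exp (-(1 / 2) * ‖w‖ ^ 2) * signAvg (fun x => |F x|) w := by
            rw [signAvg, signAvg, ← congrFun (avgL_smul _ _ _) w]
            refine avgL_mono hs _ (fun x hx => ?_) w rfl
            rw [Set.mem_ofPred_eq] at hx
            have hxm : x ∈ Metric.ball (0 : E p) ρ := by
              rw [mem_ball_zero_iff] at hw ⊢; rwa [hx]
            simp only [hG, Set.indicator_of_mem hxm, hx, le_refl]
          have h2 := signAvg_abs_exp_mul_cos_sub_one_le hp hP hΘ hΩ hb₃ hb (hcb w hw)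
            (mem_ball_zero_iff.1 hw).le hbp hρ
          calc signAvg G w ≤ Real.exp (-(1 / 2) * ‖w‖ ^ 2) * (100000 * (b * p ^ 2 + b₃ ^ 2 * p ^ 3) *
                Real.exp (1 / (4 * p) * ‖w‖ ^ 2)) := h1.trans (by gcongr)
            _ = 100000 * (b * p ^ 2 + b₃ ^ 2 * p ^ 3) * (Real.exp (-(1 / 2) * ‖w‖ ^ 2) *
                Real.exp (1 / (4 * p) * ‖w‖ ^ 2)) := by ring
            _ = _ := by rw [← Real.exp_add]; congr 2; ring
        · have h1 : signAvg G w ≤ 0 := by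
            refine avgL_le_of_le hs _ (fun x hx => ?_) w rfl
            rw [Set.mem_ofPred_eq] at hx
            have hxm : x ∉ Metric.ball (0 : E p) ρ := by
              rw [mem_ball_zero_iff] at hw ⊢; rwa [hx]
            simp only [hG, Set.indicator_of_notMem hxm, le_refl]
          refine h1.trans ?_
          positivity
    _ ≤ 100000 * (b * p ^ 2 + b₃ ^ 2 * p ^ 3) * (2 * gaussZ p) := by
        rw [integral_const_mul]
        gcongr
        exact integral_exp_moment_le hp
    _ = _ := by ring

end Saddlepoint

/-! ### Gaussian tails and the integral over the whole transformed ball -/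

namespace Saddlepoint

variable {p : ℕ}

/-- Beyond ρ, ‖w‖²/2 ≥ ρ²/4 + ‖w‖²/8; the last term integrates to 4^(p/2) `gaussZ p`, a factor that
ρ² of order p log n will absorb. -/
lemma integral_compl_ball_gauss_le {ρ : ℝ} (hρ : 0 ≤ ρ) :
    ∫ w in (Metric.ball (0 : E p) ρ)ᶜ, Real.exp (-(1 / 2) * ‖w‖ ^ 2) ≤
      Real.exp (-(ρ ^ 2 / 4)) * (4 ^ ((p : ℝ) / 2) * gaussZ p) := by
  have h8 := integrable_exp_neg_mul_sq (p := p) (c := 1 / 8) (by norm_num)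
  calc ∫ w in (Metric.ball (0 : E p) ρ)ᶜ, Real.exp (-(1 / 2) * ‖w‖ ^ 2)
      ≤ ∫ w in (Metric.ball (0 : E p) ρ)ᶜ, Real.exp (-(ρ ^ 2 / 4)) * Real.exp (-(1 / 8) * ‖w‖ ^ 2) := by
        refine setIntegral_mono_on (integrable_exp_neg_mul_sq (by norm_num)).integrableOn
          (h8.const_mul _).integrableOn measurableSet_ball.compl fun w hw => ?_
        rw [← Real.exp_add]
        refine Real.exp_le_exp.2 ?_
        have : ρ ≤ ‖w‖ := by simpa using hw
        nlinarith
    _ ≤ ∫ w : E p, Real.exp (-(ρ ^ 2 / 4)) * Real.exp (-(1 / 8) * ‖w‖ ^ 2) :=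
        setIntegral_le_integral (h8.const_mul _) (Eventually.of_forall fun w => by positivity)
    _ = _ := by
        rw [integral_const_mul, integral_exp_eq_gaussZ_mul (by norm_num)]
        norm_num

/-- The central part of the integral together with Gaussian bounds for the remainder. -/
theorem abs_integral_sub_gaussZ_le {P Θ h : E p → ℝ} {Ω D : Set (E p)} {b₃ b ρ q κ : ℝ} (hp : 1 ≤ p)
    (hP : JetBound P Ω 0 b) (hΘ : JetBound Θ Ω b₃ b) (hΩ : Convex ℝ Ω) (hb₃ : 0 ≤ b₃) (hb : 0 < b)
    (hρ0 : 0 ≤ ρ) (hκ : 0 < κ)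
    (hρΩ : Metric.ball 0 ρ ⊆ Ω) (hbp : b * p ^ 2 ≤ 1)
    (hρ : 2 * b * ρ ^ 4 + 2 * p * b ^ 2 * ρ ^ 8 ≤ 1)
    (hD : MeasurableSet D) (hρD : Metric.ball 0 ρ ⊆ D) (hint : IntegrableOn h D)
    (hball : ∀ w ∈ Metric.ball (0 : E p) ρ,
      h w = Real.exp (-(1 / 2) * ‖w‖ ^ 2) * (Real.exp (P w) * Real.cos (Θ w)))
    (hout : ∀ w ∈ D \ Metric.ball (0 : E p) ρ,
      |h w| ≤ Real.exp (-(ρ ^ 2 / 4)) * Real.exp (-(1 / 8) * ‖w‖ ^ 2) +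
        Real.exp (-q) * Real.exp (-κ * ‖w‖ ^ 2)) :
    |(∫ w in D, h w) - gaussZ p| ≤
      (200000 * (b * p ^ 2 + b₃ ^ 2 * p ^ 3) + 2 * (Real.exp (-(ρ ^ 2 / 4)) * 4 ^ ((p : ℝ) / 2)) +
        Real.exp (-q) * (1 / (2 * κ)) ^ ((p : ℝ) / 2)) * gaussZ p := by
  obtain ⟨hi, hc⟩ := abs_integral_center_le hp hP hΘ hΩ hb₃ hb hρΩ hbp hρ
  set B := Metric.ball (0 : E p) ρ
  have hB : MeasurableSet B := measurableSet_ball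
  have hφ := integrable_exp_neg_mul_sq (p := p) (c := 1 / 2) (by norm_num)
  have h8 := integrable_exp_neg_mul_sq (p := p) (c := 1 / 8) (by norm_num)
  have hk := integrable_exp_neg_mul_sq (p := p) hκ
  have h1 : ∫ w in D, h w = (∫ w in B, h w) + ∫ w in D \ B, h w := by
    rw [← setIntegral_union Set.disjoint_sdiff_right (hD.diff hB) (hint.mono_set hρD)
      (hint.mono_set Set.sdiff_subset), Set.union_sdiff_cancel hρD]
  have h2 : ∫ w in B, h w = (∫ w in B, Real.exp (-(1 / 2) * ‖w‖ ^ 2) *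
      (Real.exp (P w) * Real.cos (Θ w) - 1)) + ∫ w in B, Real.exp (-(1 / 2) * ‖w‖ ^ 2) := by
    rw [← integral_add hi hφ.integrableOn]
    refine setIntegral_congr_fun hB fun w hw => ?_
    simp only [hball w hw]
    ring
  have h3 : (∫ w in B, Real.exp (-(1 / 2) * ‖w‖ ^ 2)) +
      ∫ w in Bᶜ, Real.exp (-(1 / 2) * ‖w‖ ^ 2) = gaussZ p := by
    rw [integral_add_compl hB hφ, integral_exp_eq_gaussZ_mul (by norm_num)]
    norm_num
  have h4 : |∫ w in D \ B, h w| ≤ Real.exp (-(ρ ^ 2 / 4)) * (4 ^ ((p : ℝ) / 2) * gaussZ p) +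
      Real.exp (-q) * ((1 / (2 * κ)) ^ ((p : ℝ) / 2) * gaussZ p) := by
    set f := fun w : E p => Real.exp (-(ρ ^ 2 / 4)) * Real.exp (-(1 / 8) * ‖w‖ ^ 2) +
        Real.exp (-q) * Real.exp (-κ * ‖w‖ ^ 2)
    have hf : Integrable f := (h8.const_mul _).add (hk.const_mul _)
    calc |∫ w in D \ B, h w| ≤ ∫ w in D \ B, f w := by
          rw [← Real.norm_eq_abs]
          exact norm_integral_le_of_norm_le hf.integrableOn
            ((ae_restrict_iff' (hD.diff hB)).2 (Eventually.of_forall hout))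
      _ ≤ ∫ w, f w := setIntegral_le_integral hf (Eventually.of_forall fun w => by
          simp only [f]; positivity)
      _ = _ := by
          rw [integral_add (h8.const_mul _) (hk.const_mul _), integral_const_mul,
            integral_const_mul, integral_exp_eq_gaussZ_mul (by norm_num),
            integral_exp_eq_gaussZ_mul hκ]
          norm_num
  -- This is the Gaussian mass missing from the ball. The same quantity already bounds part of h
  -- outside the ball, hence the factor 2 in the conclusion.
  have h5 := integral_compl_ball_gauss_le (p := p) hρ0
  have h6 : 0 ≤ ∫ w in Bᶜ, Real.exp (-(1 / 2) * ‖w‖ ^ 2) :=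
    integral_nonneg fun w => (Real.exp_pos _).le
  rw [h1, h2]
  rw [abs_le] at *
  constructor <;> linarith [h4.1, h4.2, hc.1, hc.2]

end Saddlepoint

namespace Saddlepoint

variable {p : ℕ}

/-! ### Smoothness of Laplace transforms -/

section Laplace

variable {W Z : Type} [NormedAddCommGroup W]
  [NormedAddCommGroup Z] [NormedSpace ℂ Z]

/-- Growth slower than any exponential. -/
def SubExp {V : Type} [NormedAddCommGroup V] (q : W → V) : Prop :=
  ∀ ε : ℝ, 0 < ε → ∃ C : ℝ, ∀ w, ‖q w‖ ≤ C * Real.exp (ε * ‖w‖)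

lemma abs_re_pairing_sub_le {B : W → Z →L[ℂ] ℂ} (hB : ∀ w, ‖B w‖ ≤ ‖w‖) (w : W) (z z' : Z) :
    (B w z').re ≤ (B w z).re + ‖z' - z‖ * ‖w‖ := by
  have h1 : (B w z').re - (B w z).re = (B w (z' - z)).re := by simp
  have h2 := (Complex.re_le_norm (B w (z' - z))).trans ((B w).le_opNorm (z' - z))
  have h3 := mul_le_mul_of_nonneg_right (hB w) (norm_nonneg (z' - z))
  nlinarith

/-- Differentiating the transform multiplies q by a factor of size ‖w‖, which half of the allowed
exponential absorbs: the class `SubExp` is closed under the operation. -/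
lemma SubExp.smulRight {V : Type} [NormedAddCommGroup V] [NormedSpace ℂ V] {q : W → V}
    (hq : SubExp q) {B : W → Z →L[ℂ] ℂ} (hB : ∀ w, ‖B w‖ ≤ ‖w‖) : SubExp fun w => (B w).smulRight (q w) := by
  intro ε hε
  obtain ⟨C, hC⟩ := hq (ε / 2) (by positivity)
  refine ⟨2 / ε * C, fun w => ?_⟩
  rw [ContinuousLinearMap.norm_smulRight_apply]
  have h1 : ‖w‖ ≤ 2 / ε * Real.exp (ε / 2 * ‖w‖) := by
    have := Real.add_one_le_exp (ε / 2 * ‖w‖)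
    rw [div_mul_eq_mul_div, le_div_iff₀ hε]
    nlinarith
  have h0 : 0 ≤ C * Real.exp (ε / 2 * ‖w‖) := (norm_nonneg _).trans (hC w)
  calc ‖B w‖ * ‖q w‖ ≤ ‖w‖ * (C * Real.exp (ε / 2 * ‖w‖)) :=
        mul_le_mul (hB w) (hC w) (norm_nonneg _) (by positivity)
    _ ≤ (2 / ε * Real.exp (ε / 2 * ‖w‖)) * (C * Real.exp (ε / 2 * ‖w‖)) := by gcongr
    _ = 2 / ε * C * (Real.exp (ε / 2 * ‖w‖) * Real.exp (ε / 2 * ‖w‖)) := by ring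
    _ = _ := by rw [← Real.exp_add]; congr 2; ring

variable [MeasurableSpace W]

/-- The arguments near which the Laplace transform of `μ` with respect to the pairing `B` is
defined. -/
def laplaceDomain (μ : Measure W) (B : W → Z →L[ℂ] ℂ) : Set Z :=
  {z | ∃ ε : ℝ, 0 < ε ∧ Integrable (fun w => Real.exp ((B w z).re + ε * ‖w‖)) μ}

variable [BorelSpace W] [SecondCountableTopology W]

lemma isOpen_laplaceDomain (μ : Measure W) {B : W → Z →L[ℂ] ℂ} (hBc : Continuous B)
    (hB : ∀ w, ‖B w‖ ≤ ‖w‖) :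
    IsOpen (laplaceDomain μ B) := by
  rw [Metric.isOpen_iff]
  rintro z ⟨ε, hε, hz⟩
  refine ⟨ε / 2, by positivity, fun z' hz' => ⟨ε / 2, by positivity, ?_⟩⟩
  refine hz.mono' (by fun_prop) (Eventually.of_forall fun w => ?_)
  rw [Real.norm_of_nonneg (Real.exp_pos _).le]
  refine Real.exp_le_exp.2 ?_
  have h1 := abs_re_pairing_sub_le hB w z z'
  have h2 : ‖z' - z‖ ≤ ε / 2 := (mem_ball_iff_norm.1 hz').le
  nlinarith [mul_le_mul_of_nonneg_right h2 (norm_nonneg w)]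

lemma integrable_laplace {μ : Measure W} {B : W → Z →L[ℂ] ℂ} (hBc : Continuous B) {V : Type} [NormedAddCommGroup V]
    [NormedSpace ℂ V] {q : W → V} (hqc : Continuous q) (hq : SubExp q)
    {z : Z} (hz : z ∈ laplaceDomain μ B) : Integrable (fun w => Complex.exp (B w z) • q w) μ := by
  obtain ⟨ε, hε, hint⟩ := hz
  obtain ⟨C, hC⟩ := hq ε hε
  have : Continuous (fun w => Complex.exp (B w z) • q w) := by fun_prop
  refine (hint.const_mul C).mono' this.aestronglyMeasurable (Eventually.of_forall fun w => ?_)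
  rw [norm_smul, Complex.norm_exp, Real.exp_add]
  calc _ ≤ Real.exp (B w z).re * (C * Real.exp (ε * ‖w‖)) := by gcongr; exact hC w
    _ = _ := by ring

/-- The exponential margin ε of `laplaceDomain` is spent in halves: one for moving z within a ball
of radius ε/2, one for the growth of the differentiated integrand. -/
lemma hasFDerivAt_laplace {μ : Measure W} {B : W → Z →L[ℂ] ℂ} (hBc : Continuous B) (hB : ∀ w, ‖B w‖ ≤ ‖w‖) {V : Type}
    [NormedAddCommGroup V] [NormedSpace ℂ V] [CompleteSpace V] {q : W → V} (hqc : Continuous q)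
    (hq : SubExp q) {z : Z} (hz : z ∈ laplaceDomain μ B) :
    HasFDerivAt (fun z => ∫ w, Complex.exp (B w z) • q w ∂μ)
      (∫ w, Complex.exp (B w z) • (B w).smulRight (q w) ∂μ) z := by
  obtain ⟨ε, hε, hint⟩ := hz
  obtain ⟨C, hC⟩ := (hq.smulRight hB) (ε / 2) (by positivity)
  have hqc' : Continuous fun w => (B w).smulRight (q w) :=
    ((ContinuousLinearMap.smulRightL ℂ Z V).continuous.comp hBc).clm_apply hqc
  refine hasFDerivAt_integral_of_dominated_of_fderiv_le (𝕜 := ℂ)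
    (F' := fun z w => Complex.exp (B w z) • (B w).smulRight (q w))
    (bound := fun w => C * Real.exp ((B w z).re + ε * ‖w‖))
    (Metric.ball_mem_nhds z (ε := ε / 2) (by positivity))
    (Eventually.of_forall fun z' => ?_) (integrable_laplace hBc hqc hq ⟨ε, hε, hint⟩) ?_
    (Eventually.of_forall fun w z' hz' => ?_) (hint.const_mul C)
    (Eventually.of_forall fun w z' _ => ?_)
  · have : Continuous (fun w => Complex.exp (B w z') • q w) := by fun_prop
    exact this.aestronglyMeasurable
  · have : Continuous (fun w => Complex.exp (B w z) • (B w).smulRight (q w)) := by fun_prop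
    exact this.aestronglyMeasurable
  · rw [norm_smul, Complex.norm_exp]
    have h0 : 0 ≤ C * Real.exp (ε / 2 * ‖w‖) := (norm_nonneg _).trans (hC w)
    have h1 := abs_re_pairing_sub_le hB w z z'
    have h2 : ‖z' - z‖ ≤ ε / 2 := (mem_ball_iff_norm.1 hz').le
    have h3 := mul_le_mul_of_nonneg_right h2 (norm_nonneg w)
    calc _ ≤ Real.exp ((B w z).re + ε / 2 * ‖w‖) * (C * Real.exp (ε / 2 * ‖w‖)) := by
          gcongr
          · linarith
          · exact hC w
      _ = C * (Real.exp ((B w z).re + ε / 2 * ‖w‖) * Real.exp (ε / 2 * ‖w‖)) := by ring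
      _ = _ := by rw [← Real.exp_add]; congr 2; ring
  · have h1 : HasFDerivAt (fun z => Complex.exp (B w z)) (Complex.exp (B w z') • B w) z' :=
      (B w).hasFDerivAt.cexp
    have h2 := h1.smul_const (q w)
    convert h2 using 1
    ext v
    simp [mul_smul]

/-- The derivative is a transform of the same type with q replaced by `(B w).smulRight (q w)`, so
the induction has to run over all target spaces V. -/
theorem contDiffOn_laplace {μ : Measure W} {B : W → Z →L[ℂ] ℂ} (hBc : Continuous B) (hB : ∀ w, ‖B w‖ ≤ ‖w‖) (n : ℕ) {V : Type}
    [NormedAddCommGroup V] [NormedSpace ℂ V] [CompleteSpace V] {q : W → V} (hqc : Continuous q)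
    (hq : SubExp q) :
    ContDiffOn ℂ n (fun z => ∫ w, Complex.exp (B w z) • q w ∂μ) (laplaceDomain μ B) := by
  induction n generalizing V with
  | zero =>
    rw [Nat.cast_zero, contDiffOn_zero]
    exact fun z hz => (hasFDerivAt_laplace hBc hB hqc hq hz).continuousAt.continuousWithinAt
  | succ n ih =>
    have hqc' : Continuous fun w => (B w).smulRight (q w) := ((ContinuousLinearMap.smulRightL ℂ Z V).continuous.comp hBc).clm_apply hqc
    rw [Nat.cast_add, Nat.cast_one, contDiffOn_succ_iff_fderiv_of_isOpen (isOpen_laplaceDomain μ hBc hB)]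
    refine ⟨fun z hz => (hasFDerivAt_laplace hBc hB hqc hq hz).differentiableAt.differentiableWithinAt,
      by simp, ?_⟩
    exact (ih hqc' (hq.smulRight hB)).congr fun z hz => (hasFDerivAt_laplace hBc hB hqc hq hz).fderiv

end Laplace

/-! ### Logarithms of nonvanishing functions -/

/-- The form dm/m is locally the differential of a principal logarithm, hence closed. By the
Poincaré lemma on a convex set it has a primitive f, and e^{-f} m is constant. -/
lemma exists_log_of_ne_zero {V : Type*} [NormedAddCommGroup V] [NormedSpace ℝ V] {s : Set V}
    (hs : IsOpen s) (hc : Convex ℝ s) (h0 : (0 : V) ∈ s) {m : V → ℂ}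
    (hm : ∀ y ∈ s, ContDiffAt ℝ 2 m y) (hne : ∀ y ∈ s, m y ≠ 0) :
    ∃ L : V → ℂ, L 0 = 0 ∧ (∀ y ∈ s, Complex.exp (L y) = m y / m 0) ∧
      ∀ y₀ ∈ s, ∀ᶠ y in 𝓝 y₀, L y = L y₀ + Complex.log (m y / m y₀) := by
  have hlog : ∀ a ∈ s, ContDiffAt ℝ 2 (fun y => Complex.log (m y / m a)) a := by
    intro a ha
    have h1 : ContDiffAt ℝ 2 (fun y => m y / m a) a := (hm a ha).div_const _
    refine ContDiffAt.comp a (g := Complex.log) ?_ h1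
    refine (Complex.contDiffAt_log ?_).restrict_scalars ℝ
    rw [div_self (hne a ha)]
    exact Complex.one_mem_slitPlane
  have hnear : ∀ a ∈ s, ∀ᶠ y in 𝓝 a, m y / m a ∈ Complex.slitPlane := by
    intro a ha
    have h1 : ContinuousAt (fun y => m y / m a) a := (hm a ha).continuousAt.div_const _
    refine h1.eventually_mem (Complex.isOpen_slitPlane.mem_nhds ?_)
    rw [div_self (hne a ha)]
    exact Complex.one_mem_slitPlane
  have hd : ∀ a ∈ s, ∀ᶠ y in 𝓝 a,
      HasFDerivAt (fun y => Complex.log (m y / m a)) ((m y)⁻¹ • fderiv ℝ m y) y := by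
    intro a ha
    filter_upwards [hnear a ha, hs.mem_nhds ha] with y hy hys
    have h1 : HasFDerivAt (fun y => m y / m a) ((m a)⁻¹ • fderiv ℝ m y) y := by
      have := ((hm y hys).differentiableAt (by norm_num)).hasFDerivAt.const_mul (m a)⁻¹
      simpa [div_eq_inv_mul] using this
    have h2 := ((Complex.hasDerivAt_log hy).hasFDerivAt.restrictScalars ℝ).comp y h1
    refine h2.congr_fderiv ?_
    ext v
    have := hne a ha
    have := hne y hys
    simp
    field_simp
  set ω : V → V →L[ℝ] ℂ := fun y => (m y)⁻¹ • fderiv ℝ m y with hω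
  have hev : ∀ a ∈ s, fderiv ℝ (fun y => Complex.log (m y / m a)) =ᶠ[𝓝 a] ω := fun a ha =>
    (hd a ha).mono fun y hy => hy.fderiv
  obtain ⟨f, hf⟩ := hc.exists_forall_hasFDerivAt_of_fderiv_symmetric (ω := ω) hs (by
    intro a ha
    have h1 : DifferentiableAt ℝ (fderiv ℝ fun y => Complex.log (m y / m a)) a :=
      ((hlog a ha).fderiv_right (m := 1) (by norm_num)).differentiableAt (by norm_num)
    exact ((hev a ha).differentiableAt_iff.1 h1).differentiableWithinAt) (by
    intro a ha x y
    rw [← (hev a ha).fderiv_eq]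
    exact (hlog a ha).isSymmSndFDerivAt (by simp) x y)
  have hconst : ∀ y ∈ s, Complex.exp (-f y) * m y = Complex.exp (-f 0) * m 0 := by
    intro y hy
    refine hs.is_const_of_fderiv_eq_zero (𝕜 := ℝ) hc.isPreconnected
      (f := fun y => Complex.exp (-f y) * m y) ?_ ?_ hy h0
    · intro y hy
      exact ((hf y hy).differentiableAt.neg.cexp.mul
        ((hm y hy).differentiableAt (by norm_num))).differentiableWithinAt
    · intro y hy
      have h1 := ((hf y hy).neg.cexp).mul ((hm y hy).differentiableAt (by norm_num)).hasFDerivAt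
      refine h1.fderiv.trans ?_
      ext v
      have := hne y hy
      simp [hω]
      field_simp
      ring
  have hexp : ∀ y ∈ s, Complex.exp (f y - f 0) = m y / m 0 := by
    intro y hy
    have h1 := hconst y hy
    rw [eq_div_iff (hne 0 h0), sub_eq_add_neg, Complex.exp_add, mul_assoc, ← h1, ← mul_assoc,
      ← Complex.exp_add]
    simp
  refine ⟨fun y => f y - f 0, by simp, hexp, fun y₀ hy₀ => ?_⟩
  have hcont : ContinuousAt (fun y => (f y - f y₀).im) y₀ := by
    have := (hf y₀ hy₀).continuousAt
    fun_prop
  -- Near y₀ the increment of f has imaginary part in (-π, π), where the principal logarithm inverts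
  -- exp.
  have hsm : ∀ᶠ y in 𝓝 y₀, (f y - f y₀).im ∈ Set.Ioo (-Real.pi) Real.pi := by
    refine hcont.eventually_mem (Ioo_mem_nhds ?_ ?_) <;> simp [Real.pi_pos]
  filter_upwards [hsm, hs.mem_nhds hy₀] with y hy hys
  have h1 : m y / m y₀ = Complex.exp (f y - f y₀) := by
    have h2 : f y - f y₀ = (f y - f 0) - (f y₀ - f 0) := by ring
    rw [h2, Complex.exp_sub, hexp y hys, hexp y₀ hy₀]
    have := hne 0 h0
    have := hne y₀ hy₀
    field_simp
  rw [h1, Complex.log_exp hy.1 hy.2.le]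
  ring

end Saddlepoint

namespace Saddlepoint

variable {p : ℕ}

/-! ### Derivatives along affine maps -/

lemma iteratedFDeriv_comp_clm {V W F : Type*} [NormedAddCommGroup V] [NormedSpace ℝ V]
    [NormedAddCommGroup W] [NormedSpace ℝ W] [NormedAddCommGroup F] [NormedSpace ℝ F]
    {f : W → F} (A : V →L[ℝ] W) {x : V} {n : ℕ} (hf : ContDiffAt ℝ n f (A x)) (m : Fin n → V) :
    iteratedFDeriv ℝ n (fun x => f (A x)) x m = iteratedFDeriv ℝ n f (A x) (fun i => A (m i)) := by
  obtain ⟨U, hU, hxU, hfU⟩ := hf.contDiffWithinAt.contDiffOn' (s := Set.univ) le_rfl (by simp)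
  rw [Set.insert_eq_of_mem (Set.mem_univ _), Set.univ_inter] at hfU
  have hV : IsOpen (A ⁻¹' U) := hU.preimage A.continuous
  have h := A.iteratedFDerivWithin_comp_right hfU hU.uniqueDiffOn hV.uniqueDiffOn hxU le_rfl
  rw [iteratedFDerivWithin_of_isOpen n hV hxU, iteratedFDerivWithin_of_isOpen n hU hxU] at h
  exact congrFun (congrArg DFunLike.coe h) m

/-- Expresses real derivatives through complex ones. Applied to x ↦ x and y ↦ i y it relates
derivatives along the imaginary axes to those along the real axes, in place of the Cauchy-Riemann
equations. -/
lemma iteratedFDeriv_comp_affine {V Z F : Type*} [NormedAddCommGroup V] [NormedSpace ℝ V]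
    [NormedAddCommGroup Z] [NormedSpace ℂ Z] [NormedAddCommGroup F] [NormedSpace ℂ F]
    {Ψ : Z → F} (A : V →L[ℝ] Z) (z : Z) {x : V} {n : ℕ} (h : ContDiffAt ℂ n Ψ (z + A x))
    (m : Fin n → V) :
    iteratedFDeriv ℝ n (fun x => Ψ (z + A x)) x m =
      iteratedFDeriv ℂ n Ψ (z + A x) (fun i => A (m i)) := by
  have h1 : ContDiffAt ℝ n (fun w => Ψ (z + w)) (A x) :=
    (h.restrict_scalars ℝ).comp (A x) (by fun_prop)
  rw [iteratedFDeriv_comp_clm A h1, iteratedFDeriv_comp_add_left,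
    ← h.restrictScalars_iteratedFDeriv (𝕜 := ℝ)]
  rfl

/-! ### The complex moment generating function -/

/-- Evaluation at a point, as a complex linear map on complex valued linear functionals. -/
noncomputable def evalCLM (w : E p) : (E p →L[ℝ] ℂ) →L[ℂ] ℂ where
  toFun z := z w
  map_add' _ _ := rfl
  map_smul' _ _ := rfl
  cont := (ContinuousLinearMap.apply ℝ ℂ w).continuous

lemma norm_evalCLM_le (w : E p) : ‖evalCLM w‖ ≤ ‖w‖ :=
  ContinuousLinearMap.opNorm_le_bound _ (norm_nonneg _) fun z => by
    rw [mul_comm]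
    exact z.le_opNorm w

lemma continuous_evalCLM : Continuous (evalCLM (p := p)) := by
  suffices LipschitzWith 1 (evalCLM (p := p)) from this.continuous
  refine LipschitzWith.of_dist_le_mul fun w w' => ?_
  have h : evalCLM w - evalCLM w' = evalCLM (w - w') :=
    ContinuousLinearMap.ext fun z => (map_sub z w w').symm
  rw [dist_eq_norm, dist_eq_norm, h, NNReal.coe_one, one_mul]
  exact norm_evalCLM_le _

/-- Real vectors as linear functionals. -/
noncomputable def embed (p : ℕ) : E p →L[ℝ] (E p →L[ℝ] ℂ) :=
  LinearMap.toContinuousLinearMap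
    { toFun := fun x => Complex.ofRealCLM.comp (innerSL ℝ x)
      map_add' := fun x y => by ext w; simp
      map_smul' := fun c x => by ext w; simp }

@[simp] lemma evalCLM_apply (w : E p) (z : E p →L[ℝ] ℂ) : evalCLM w z = z w := rfl

@[simp] lemma embed_apply (x w : E p) : embed p x w = ((⟪x, w⟫ : ℝ) : ℂ) := rfl

/-- The moment generating function as a function of a complex linear functional. -/
noncomputable def mgfF (μ : Measure (E p)) (z : E p →L[ℝ] ℂ) : ℂ :=
  ∫ w, Complex.exp (evalCLM w z) • (1 : ℂ) ∂μ

/-- The complex argument `x + i y`. -/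
noncomputable def cpoint (x y : E p) : E p →L[ℝ] ℂ := embed p x + Complex.I • embed p y

lemma cpoint_apply (x y w : E p) : cpoint x y w = (⟪x, w⟫ : ℂ) + Complex.I * (⟪y, w⟫ : ℂ) := rfl

lemma mgfF_cpoint (μ : Measure (E p)) (x y : E p) : mgfF μ (cpoint x y) = mgfC μ x y := by
  simp only [mgfF, mgfC, evalCLM_apply, cpoint_apply, smul_eq_mul, mul_one]

lemma re_cpoint (x y w : E p) : (cpoint x y w).re = ⟪x, w⟫ := by
  simp [cpoint_apply]

lemma contDiffAt_mgfF {μ : Measure (E p)} {z : E p →L[ℝ] ℂ} (hz : z ∈ laplaceDomain μ evalCLM)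
    (n : ℕ) : ContDiffAt ℂ n (mgfF μ) z := by
  refine (contDiffOn_laplace continuous_evalCLM norm_evalCLM_le (V := ℂ) (q := fun _ => 1) n continuous_const ?_).contDiffAt
    ((isOpen_laplaceDomain μ continuous_evalCLM norm_evalCLM_le).mem_nhds hz)
  exact fun ε hε => ⟨1, fun w => by simpa using Real.one_le_exp (by positivity)⟩

/-- Dominates an exponential of the norm by exponentials of linear functionals, the only ones that
`mgfDomain` controls. A largest coordinate has ‖w‖ ≤ (p + 1)|w j|; the summand 1 in p + 1 avoids
division by zero for p = 0. -/
lemma exp_norm_le (w : E p) {c : ℝ} (hc : 0 ≤ c) :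
    Real.exp (c / (p + 1) * ‖w‖) ≤ 1 + ∑ j, (Real.exp (c * w j) + Real.exp (-c * w j)) := by
  have hnn : ∀ j, 0 ≤ Real.exp (c * w j) + Real.exp (-c * w j) := fun j => by positivity
  rcases Nat.eq_zero_or_pos p with hp | hp
  · subst hp
    have : w = 0 := Subsingleton.elim _ _
    simp [this]
  · have : Nonempty (Fin p) := ⟨⟨0, hp⟩⟩
    obtain ⟨j, hj⟩ := Finite.exists_max (fun j => |w j|)
    have h1 : ‖w‖ ≤ (p + 1) * |w j| := by
      have h2 : ‖w‖ ≤ ∑ k, |w k| := by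
        conv_lhs => rw [← sum_mul_e w]
        refine (norm_sum_le _ _).trans (Finset.sum_le_sum fun k _ => ?_)
        rw [norm_smul, norm_e, mul_one, Real.norm_eq_abs]
      have h3 : ∑ k, |w k| ≤ ∑ _k : Fin p, |w j| := Finset.sum_le_sum fun k _ => hj k
      rw [Finset.sum_const, Finset.card_univ, Fintype.card_fin, nsmul_eq_mul] at h3
      nlinarith [abs_nonneg (w j)]
    have h2 : c / (p + 1) * ‖w‖ ≤ c * |w j| := by
      calc _ ≤ c / (p + 1) * ((p + 1) * |w j|) := by gcongr
        _ = _ := by field_simp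
    have h3 : Real.exp (c * |w j|) ≤ Real.exp (c * w j) + Real.exp (-c * w j) := by
      rcases abs_choice (w j) with h | h <;> rw [h]
      · linarith [Real.exp_pos (-c * w j)]
      · rw [show c * -w j = -c * w j by ring]; linarith [Real.exp_pos (c * w j)]
    have h4 := Finset.single_le_sum (fun k _ => hnn k) (Finset.mem_univ j)
    have := (Real.exp_le_exp.2 h2).trans h3
    linarith

lemma inner_e (j : Fin p) (w : E p) : ⟪(e j : E p), w⟫ = w j := by
  simp [e, EuclideanSpace.inner_single_left]

/-- Since t is interior, the points t ± (r/2) e_j also lie in the domain, and by `exp_norm_le` this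
gives an exponential margin in ‖w‖. The imaginary part does not affect the modulus. -/
lemma cpoint_mem_laplaceDomain {μ : Measure (E p)} {t : E p} (ht : t ∈ interior (mgfDomain μ))
    (y : E p) : cpoint t y ∈ laplaceDomain μ evalCLM := by
  obtain ⟨r, hr, hsub⟩ := Metric.mem_nhds_iff.1 (mem_interior_iff_mem_nhds.1 ht)
  have hc : 0 < r / 2 := by positivity
  have hmem : ∀ s : ℝ, |s| = r / 2 → ∀ j,
      Integrable (fun w : E p => Real.exp (⟪t, w⟫ + s * w j)) μ := by
    intro s hs j
    have h1 : t + s • e j ∈ Metric.ball t r := by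
      rw [mem_ball_iff_norm, add_sub_cancel_left, norm_smul, norm_e, mul_one, Real.norm_eq_abs, hs]
      linarith
    have h2 : Integrable (fun w : E p => Real.exp ⟪t + s • e j, w⟫) μ := hsub h1
    refine h2.congr (Eventually.of_forall fun w => ?_)
    simp only [inner_add_left, real_inner_smul_left, inner_e]
  refine ⟨r / 2 / (p + 1), by positivity, ?_⟩
  have htm : t ∈ mgfDomain μ := interior_subset ht
  have ht0 : Integrable (fun w : E p => Real.exp ⟪t, w⟫) μ := htm
  have hI : Integrable (fun w : E p => Real.exp ⟪t, w⟫ +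
      ∑ j, (Real.exp (⟪t, w⟫ + r / 2 * w j) + Real.exp (⟪t, w⟫ + -(r / 2) * w j))) μ :=
    ht0.add (integrable_finsetSum _ fun j _ => (hmem (r / 2) (abs_of_pos hc) j).add
      (hmem (-(r / 2)) (by rw [abs_neg, abs_of_pos hc]) j))
  refine hI.mono' (by simp only [evalCLM_apply, re_cpoint]; fun_prop) (Eventually.of_forall fun w => ?_)
  rw [Real.norm_of_nonneg (Real.exp_pos _).le, evalCLM_apply, re_cpoint, Real.exp_add]
  have := exp_norm_le w hc.le
  calc _ ≤ Real.exp ⟪t, w⟫ *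
        (1 + ∑ j, (Real.exp (r / 2 * w j) + Real.exp (-(r / 2) * w j))) := by gcongr
    _ = _ := by
      rw [mul_add, mul_one, Finset.mul_sum]
      congr 1
      refine Finset.sum_congr rfl fun j _ => ?_
      rw [mul_add, Real.exp_add, Real.exp_add]

/-! ### The cumulant generating function along the imaginary directions -/

lemma contDiffAt_mgfC_right {μ : Measure (E p)} {t : E p} (ht : t ∈ interior (mgfDomain μ))
    (y : E p) (n : ℕ) : ContDiffAt ℝ n (fun y => mgfC μ t y) y := by
  have h1 := (contDiffAt_mgfF (cpoint_mem_laplaceDomain ht y) n).restrict_scalars ℝ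
  have h2 : ContDiffAt ℝ n (fun y : E p => cpoint t y) y := by unfold cpoint; fun_prop
  have := ContDiffAt.comp y h1 h2
  simpa only [Function.comp_def, mgfF_cpoint] using this

/-- Local logarithm of the moment generating function. -/
noncomputable def localLog (μ : Measure (E p)) (z₀ z : E p →L[ℝ] ℂ) : ℂ :=
  Complex.log (mgfF μ z / mgfF μ z₀)

lemma contDiffAt_localLog {μ : Measure (E p)} {t y : E p} (ht : t ∈ interior (mgfDomain μ))
    (hne : mgfC μ t y ≠ 0) (n : ℕ) :
    ContDiffAt ℂ n (localLog μ (cpoint t y)) (cpoint t y) := by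
  rw [← mgfF_cpoint] at hne
  have h1 : ContDiffAt ℂ n (fun z => mgfF μ z / mgfF μ (cpoint t y)) (cpoint t y) :=
    (contDiffAt_mgfF (cpoint_mem_laplaceDomain ht y) n).div_const _
  refine ContDiffAt.comp _ (g := Complex.log) (Complex.contDiffAt_log ?_) h1
  rw [div_self hne]
  exact Complex.one_mem_slitPlane

lemma localCgf_eq (μ : Measure (E p)) (t y : E p) :
    localCgf μ t y = fun x => localLog μ (cpoint t y) (Complex.I • embed p y + embed p x) := by
  funext x
  rw [localCgf, localLog, ← mgfF_cpoint, ← mgfF_cpoint, cpoint, add_comm (embed p x)]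

lemma contDiffAt_localCgf {μ : Measure (E p)} {t y : E p} (ht : t ∈ interior (mgfDomain μ))
    (hne : mgfC μ t y ≠ 0) (n : ℕ) : ContDiffAt ℝ n (localCgf μ t y) t := by
  rw [localCgf_eq]
  have h1 := (contDiffAt_localLog ht hne n).restrict_scalars ℝ
  refine ContDiffAt.comp t (g := localLog μ (cpoint t y)) ?_ (by fun_prop)
  rwa [add_comm, ← cpoint]

lemma iteratedFDeriv_localCgf {μ : Measure (E p)} {t y : E p} (ht : t ∈ interior (mgfDomain μ))
    (hne : mgfC μ t y ≠ 0) (n : ℕ) (m : Fin n → E p) :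
    iteratedFDeriv ℝ n (localCgf μ t y) t m =
      iteratedFDeriv ℂ n (localLog μ (cpoint t y)) (cpoint t y) fun i => embed p (m i) := by
  have hz : Complex.I • embed p y + embed p t = cpoint t y := by rw [cpoint, add_comm]
  rw [localCgf_eq, iteratedFDeriv_comp_affine (embed p) (Complex.I • embed p y)
    (by rw [hz]; exact contDiffAt_localLog ht hne n), hz]

/-- Multiplication by `i` of real vectors, as linear functionals. -/
noncomputable def embedI (p : ℕ) : E p →L[ℝ] (E p →L[ℝ] ℂ) := Complex.I • embed p

/-- On a ball where the moment generating function at `t + i y` does not vanish, there is a smooth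
logarithm, whose derivatives are those of the cumulant generating function. -/
theorem exists_log_mgfC {μ : Measure (E p)} {t : E p} {δ : ℝ} (hδ : 0 < δ)
    (ht : t ∈ interior (mgfDomain μ))
    (hne : ∀ y ∈ Metric.ball (0 : E p) δ, mgfC μ t y ≠ 0) :
    ∃ L : E p → ℂ, L 0 = 0 ∧
      ∀ y ∈ Metric.ball (0 : E p) δ, Complex.exp (L y) = mgfC μ t y / mgfC μ t 0 ∧
        ContDiffAt ℝ 4 L y ∧ ∀ n : ℕ, n ≠ 0 → n ≤ 4 → ∀ m : Fin n → E p,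
          iteratedFDeriv ℝ n L y m =
            Complex.I ^ n * iteratedFDeriv ℝ n (localCgf μ t y) t m := by
  obtain ⟨L, hL0, hexp, hloc⟩ := exists_log_of_ne_zero (Metric.isOpen_ball (x := (0 : E p)) (ε := δ))
    (convex_ball _ _) (by simpa using hδ) (fun y _ => contDiffAt_mgfC_right ht y 2) hne
  refine ⟨L, hL0, fun y hy => ⟨hexp y hy, ?_⟩⟩
  have hz : embed p t + embedI p y = cpoint t y := rfl
  have hd := fun n => contDiffAt_localLog ht (hne y hy) n
  have hev : L =ᶠ[𝓝 y] (fun _ => L y) + fun y' => localLog μ (cpoint t y) (embed p t + embedI p y') := by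
    filter_upwards [hloc y hy] with y' hy'
    rw [hy', Pi.add_apply, localLog, ← mgfF_cpoint, ← mgfF_cpoint]
    rfl
  have hΨ : ∀ n : ℕ, ContDiffAt ℝ n
      (fun y' => localLog μ (cpoint t y) (embed p t + embedI p y')) y := fun n =>
    ContDiffAt.comp y (g := localLog μ (cpoint t y)) ((hd n).restrict_scalars ℝ) (by fun_prop)
  refine ⟨((contDiffAt_const).add (hΨ 4)).congr_of_eventuallyEq hev, fun n hn _ m => ?_⟩
  rw [(hev.iteratedFDeriv (𝕜 := ℝ) n).self_of_nhds, iteratedFDeriv_add_apply contDiffAt_const (hΨ n),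
    iteratedFDeriv_const_of_ne hn, Pi.zero_apply, zero_add,
    iteratedFDeriv_comp_affine (embedI p) (embed p t) (by rw [hz]; exact hd n), hz,
    iteratedFDeriv_localCgf ht (hne y hy)]
  -- Every slot holds i times a real vector; complex multilinearity takes out the factor i^n.
  have := (iteratedFDeriv ℂ n (localLog μ (cpoint t y)) (cpoint t y)).map_smul_univ
    (fun _ => Complex.I) fun i => embed p (m i)
  simpa [embedI] using this

lemma iteratedFDeriv_localU {μ : Measure (E p)} {t y : E p} (ht : t ∈ interior (mgfDomain μ))
    (hne : mgfC μ t y ≠ 0) (n : ℕ) (m : Fin n → E p) :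
    iteratedFDeriv ℝ n (localU μ t y) t m = (iteratedFDeriv ℝ n (localCgf μ t y) t m).re := by
  have := Complex.reCLM.iteratedFDeriv_comp_left (contDiffAt_localCgf ht hne n) (le_refl (n : WithTop ℕ∞))
  exact congrFun (congrArg DFunLike.coe this) m

lemma iteratedFDeriv_localV {μ : Measure (E p)} {t y : E p} (ht : t ∈ interior (mgfDomain μ))
    (hne : mgfC μ t y ≠ 0) (n : ℕ) (m : Fin n → E p) :
    iteratedFDeriv ℝ n (localV μ t y) t m = (iteratedFDeriv ℝ n (localCgf μ t y) t m).im := by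
  have := Complex.imCLM.iteratedFDeriv_comp_left (contDiffAt_localCgf ht hne n) (le_refl (n : WithTop ℕ∞))
  exact congrFun (congrArg DFunLike.coe this) m

lemma contDiffAt_localU {μ : Measure (E p)} {t y : E p} (ht : t ∈ interior (mgfDomain μ))
    (hne : mgfC μ t y ≠ 0) (n : ℕ) : ContDiffAt ℝ n (localU μ t y) t :=
  (contDiffAt_localCgf ht hne n).continuousLinearMap_comp Complex.reCLM

lemma contDiffAt_localV {μ : Measure (E p)} {t y : E p} (ht : t ∈ interior (mgfDomain μ))
    (hne : mgfC μ t y ≠ 0) (n : ℕ) : ContDiffAt ℝ n (localV μ t y) t :=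
  (contDiffAt_localCgf ht hne n).continuousLinearMap_comp Complex.imCLM

/-- The two outermost arguments of an iterated derivative commute. -/
lemma iteratedFDeriv_swap {V F : Type*} [NormedAddCommGroup V] [NormedSpace ℝ V]
    [NormedAddCommGroup F] [NormedSpace ℝ F] {f : V → F} {x : V} {n : ℕ}
    (hf : ContDiffAt ℝ (n + 2) f x) (a b : V) (m : Fin n → V) :
    iteratedFDeriv ℝ (n + 2) f x (Fin.cons a (Fin.cons b m)) =
      iteratedFDeriv ℝ (n + 2) f x (Fin.cons b (Fin.cons a m)) := by
  have h2 : ContDiffAt ℝ 2 (iteratedFDeriv ℝ n f) x :=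
    hf.iteratedFDeriv_right (by rw [add_comm])
  have hsymm := h2.isSymmSndFDerivAt (by simp)
  have hd : DifferentiableAt ℝ (iteratedFDeriv ℝ (n + 1) f) x :=
    hf.differentiableAt_iteratedFDeriv (by exact_mod_cast Nat.lt_succ_self (n + 1))
  have hd' : DifferentiableAt ℝ (fderiv ℝ (iteratedFDeriv ℝ n f)) x :=
    (h2.fderiv_right (m := 1) (by norm_num)).differentiableAt (by norm_num)
  have key : ∀ a b : V, iteratedFDeriv ℝ (n + 2) f x (Fin.cons a (Fin.cons b m)) =
      fderiv ℝ (fderiv ℝ (iteratedFDeriv ℝ n f)) x a b m := by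
    intro a b
    rw [hd.iteratedFDeriv_succ_apply_left']
    have h3 : (fun y => iteratedFDeriv ℝ (n + 1) f y
        (Fin.tail (Fin.cons a (Fin.cons b m) : Fin (n + 2) → V))) =
        fun y => (ContinuousMultilinearMap.apply ℝ (fun _ : Fin n => V) F m)
          (fderiv ℝ (iteratedFDeriv ℝ n f) y b) := by
      funext y
      rw [Fin.tail_cons, iteratedFDeriv_succ_apply_left]
      simp
    rw [h3, Fin.cons_zero]
    have h4 : HasFDerivAt (fun y => (ContinuousMultilinearMap.apply ℝ (fun _ : Fin n => V) F m)
          (fderiv ℝ (iteratedFDeriv ℝ n f) y b)) _ x :=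
      ((ContinuousMultilinearMap.apply ℝ (fun _ : Fin n => V) F m).hasFDerivAt).comp x
        (hd'.hasFDerivAt.clm_apply (hasFDerivAt_const b x))
    rw [h4.fderiv]
    simp
  rw [key, key, hsymm]

end Saddlepoint

namespace Saddlepoint

variable {p : ℕ}

/-! ### Quadratic forms -/

/-- The linear map of a matrix. -/
noncomputable abbrev mclm (A : Matrix (Fin p) (Fin p) ℝ) : E p →L[ℝ] E p :=
  Matrix.toEuclideanCLM (n := Fin p) (𝕜 := ℝ) A

lemma mclm_apply (A : Matrix (Fin p) (Fin p) ℝ) (v : E p) (j : Fin p) :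
    mclm A v j = ∑ k, A j k * v k := by
  have := congrFun (Matrix.ofLp_toEuclideanCLM (n := Fin p) (𝕜 := ℝ) A v) j
  exact this

lemma inner_mclm (A : Matrix (Fin p) (Fin p) ℝ) (u v : E p) :
    ⟪u, mclm A v⟫ = ∑ j, ∑ k, u j * v k * A j k := by
  simp only [PiLp.inner_apply, mclm_apply, RCLike.inner_apply, conj_trivial]
  refine Finset.sum_congr rfl fun j _ => ?_
  rw [Finset.sum_mul]
  exact Finset.sum_congr rfl fun k _ => by ring

lemma mclm_e (A : Matrix (Fin p) (Fin p) ℝ) (k j : Fin p) : mclm A (e k) j = A j k := by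
  simp [mclm_apply, e_apply]

lemma EigenvaluesIn.le_inner {A : Matrix (Fin p) (Fin p) ℝ} {a b : ℝ} (hA : A.IsHermitian)
    (h : EigenvaluesIn A a b) (v : E p) : a * ‖v‖ ^ 2 ≤ ⟪v, mclm A v⟫ := by
  have hB : (A - algebraMap ℝ _ a).IsHermitian := by
    refine hA.sub ?_
    rw [Algebra.algebraMap_eq_smul_one]
    exact Matrix.isHermitian_one.smul rfl
  have hpos : (A - algebraMap ℝ _ a).PosSemidef := by
    rw [hB.posSemidef_iff_eigenvalues_nonneg]
    intro i
    have h1 := hB.eigenvalues_mem_spectrum_real i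
    rw [← spectrum.sub_singleton_eq, Set.sub_singleton, Set.mem_image] at h1
    obtain ⟨r, hr, hr'⟩ := h1
    have := (h r hr).1
    simp only [Pi.zero_apply, ← hr']
    linarith
  have h2 := hpos.dotProduct_mulVec_nonneg v
  rw [Matrix.sub_mulVec, dotProduct_sub, Algebra.algebraMap_eq_smul_one, Matrix.smul_mulVec,
    Matrix.one_mulVec, dotProduct_smul] at h2
  have h3 : star v.ofLp ⬝ᵥ v.ofLp = ‖v‖ ^ 2 := by
    rw [EuclideanSpace.norm_sq_eq]
    simp [dotProduct, sq]
  have h4 : star v.ofLp ⬝ᵥ A.mulVec v.ofLp = ⟪v, mclm A v⟫ := by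
    rw [Matrix.inner_toEuclideanCLM]
    simp
  rw [h3, h4, smul_eq_mul] at h2
  linarith

lemma EigenvaluesIn.inner_le {A : Matrix (Fin p) (Fin p) ℝ} {a b : ℝ} (hA : A.IsHermitian)
    (h : EigenvaluesIn A a b) (v : E p) : ⟪v, mclm A v⟫ ≤ b * ‖v‖ ^ 2 := by
  have h' : EigenvaluesIn (-A) (-b) (-a) := by
    intro r hr
    rw [← spectrum.neg_eq, Set.mem_neg] at hr
    have := h _ hr
    constructor <;> linarith
  have := h'.le_inner hA.neg v
  rw [inner_mclm] at this ⊢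
  simp only [Matrix.neg_apply, mul_neg, Finset.sum_neg_distrib] at this
  linarith

lemma inner_mclm_comm {A : Matrix (Fin p) (Fin p) ℝ} (hA : A.IsHermitian) (u v : E p) :
    ⟪u, mclm A v⟫ = ⟪v, mclm A u⟫ := by
  rw [inner_mclm, inner_mclm, Finset.sum_comm]
  refine Finset.sum_congr rfl fun j _ => Finset.sum_congr rfl fun k _ => ?_
  have : A k j = A j k := by simpa using hA.apply j k
  rw [this]
  ring

/-- Polarization on unit vectors: 4|⟨u, Av⟩| ≤ c(‖u+v‖² + ‖u-v‖²) = 4c by the parallelogram law. The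
general case follows by scaling. -/
lemma EigenvaluesIn.abs_inner_le {A : Matrix (Fin p) (Fin p) ℝ} {a b c : ℝ} (hA : A.IsHermitian)
    (h : EigenvaluesIn A a b) (ha : |a| ≤ c) (hb : |b| ≤ c) (u v : E p) :
    |⟪u, mclm A v⟫| ≤ c * ‖u‖ * ‖v‖ := by
  have hq : ∀ v : E p, |⟪v, mclm A v⟫| ≤ c * ‖v‖ ^ 2 := by
    intro v
    have h1 := h.le_inner hA v
    have h2 := h.inner_le hA v
    rw [abs_le] at ha hb ⊢
    have := sq_nonneg ‖v‖
    constructor <;> nlinarith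
  have hunit : ∀ u v : E p, ‖u‖ = 1 → ‖v‖ = 1 → |⟪u, mclm A v⟫| ≤ c := by
    intro u v hu hv
    have h1 : ⟪u + v, mclm A (u + v)⟫ - ⟪u - v, mclm A (u - v)⟫ = 4 * ⟪u, mclm A v⟫ := by
      simp only [map_add, map_sub, inner_add_left, inner_add_right, inner_sub_left, inner_sub_right,
        inner_mclm_comm hA v u]
      ring
    have h2 := hq (u + v)
    have h3 := hq (u - v)
    have h4 := parallelogram_law_with_norm ℝ u v
    rw [hu, hv] at h4
    rw [abs_le] at *
    constructor <;> nlinarith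
  rcases eq_or_ne u 0 with rfl | hu
  · simp
  rcases eq_or_ne v 0 with rfl | hv
  · simp
  have hu' := norm_ne_zero_iff.2 hu
  have hv' := norm_ne_zero_iff.2 hv
  have h5 := hunit (‖u‖⁻¹ • u) (‖v‖⁻¹ • v) (by rw [norm_smul, norm_inv, norm_norm, inv_mul_cancel₀ hu'])
    (by rw [norm_smul, norm_inv, norm_norm, inv_mul_cancel₀ hv'])
  rw [map_smul, real_inner_smul_left, real_inner_smul_right, ← mul_assoc, abs_mul, abs_mul, abs_inv,
    abs_inv, abs_norm, abs_norm, ← mul_inv, inv_mul_le_iff₀ (by positivity)] at h5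
  linarith

/-! ### Matrices of iterated derivatives -/

/-- The matrix of an iterated derivative in its two outermost arguments. -/
noncomputable def headMatrix {n : ℕ} (f : E p → ℝ) (x : E p) (m : Fin n → E p) :
    Matrix (Fin p) (Fin p) ℝ :=
  Matrix.of fun j k => iteratedFDeriv ℝ (n + 2) f x (Fin.cons (e j) (Fin.cons (e k) m))

variable {n : ℕ} {f : E p → ℝ} {x : E p}

lemma isHermitian_headMatrix (hf : ContDiffAt ℝ (n + 2) f x) (m : Fin n → E p) :
    (headMatrix f x m).IsHermitian := by
  ext j k
  simpa [headMatrix] using iteratedFDeriv_swap hf (e k) (e j) m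

/-- Only the outermost slot can be expanded in coordinates, so the second one is exchanged with it
first. -/
lemma iteratedFDeriv_eq_inner (hf : ContDiffAt ℝ (n + 2) f x) (m : Fin n → E p) (u v : E p) :
    iteratedFDeriv ℝ (n + 2) f x (Fin.cons u (Fin.cons v m)) = ⟪u, mclm (headMatrix f x m) v⟫ := by
  rw [inner_mclm, iteratedFDeriv_cons_eq_sum]
  refine Finset.sum_congr rfl fun j _ => ?_
  rw [iteratedFDeriv_swap hf, iteratedFDeriv_cons_eq_sum, Finset.mul_sum]
  refine Finset.sum_congr rfl fun k _ => ?_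
  rw [iteratedFDeriv_swap hf, headMatrix, Matrix.of_apply]
  ring

/-- Bound for linear forms on columns of a matrix. -/
lemma abs_clm_mclm_e_le {β : E p →L[ℝ] ℝ} {M R : ℝ} {S : Matrix (Fin p) (Fin p) ℝ} (hM0 : 0 ≤ M)
    (hM : ∀ l, |β (e l)| ≤ M) (k : Fin p) (hR : ∑ l, |S l k| ≤ R) :
    |β (mclm S (e k))| ≤ R * M := by
  rw [← sum_mul_e (mclm S (e k)), map_sum]
  calc _ ≤ ∑ l, |S l k| * M := by
        refine (Finset.abs_sum_le_sum_abs _ _).trans (Finset.sum_le_sum fun l _ => ?_)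
        rw [map_smul, smul_eq_mul, abs_mul, mclm_e]
        exact mul_le_mul_of_nonneg_left (hM l) (abs_nonneg _)
    _ = (∑ l, |S l k|) * M := by rw [Finset.sum_mul]
    _ ≤ _ := by gcongr

lemma iteratedFDeriv_three_le {S : Matrix (Fin p) (Fin p) ℝ} {M R : ℝ} (hM0 : 0 ≤ M) (u v : E p)
    (h : ∀ l, |iteratedFDeriv ℝ 3 f x ![u, v, e l]| ≤ M) (k : Fin p)
    (hR : ∀ k, ∑ l, |S l k| ≤ R) :
    |iteratedFDeriv ℝ 3 f x ![u, v, mclm S (e k)]| ≤ R * M := by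
  have hβ : ∀ a, (iteratedFDeriv ℝ 3 f x).curryRight ![u, v] a = iteratedFDeriv ℝ 3 f x ![u, v, a] := by
    intro a
    rw [ContinuousMultilinearMap.curryRight_apply]
    congr 1
    funext i
    fin_cases i <;> rfl
  rw [← hβ]
  exact abs_clm_mclm_e_le hM0 (fun l => by rw [hβ]; exact h l) k (hR k)

/-- Each slot filled with a column of S costs one absolute column sum R, whatever the first two
slots hold. -/
lemma iteratedFDeriv_four_le {S : Matrix (Fin p) (Fin p) ℝ} {M R : ℝ} (hM0 : 0 ≤ M) (hR0 : 0 ≤ R)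
    (u v : E p)
    (h : ∀ l m, |iteratedFDeriv ℝ 4 f x ![u, v, e l, e m]| ≤ M) (j k : Fin p)
    (hR : ∀ k, ∑ l, |S l k| ≤ R) :
    |iteratedFDeriv ℝ 4 f x ![u, v, mclm S (e j), mclm S (e k)]| ≤ R * (R * M) := by
  have hβ : ∀ a b, (iteratedFDeriv ℝ 4 f x).curryRight ![u, v, a] b =
      iteratedFDeriv ℝ 4 f x ![u, v, a, b] := by
    intro a b
    rw [ContinuousMultilinearMap.curryRight_apply]
    congr 1
    funext i
    fin_cases i <;> rfl
  have hβ' : ∀ a b, (iteratedFDeriv ℝ 4 f x).curryRight.curryRight ![u, v] a b =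
      iteratedFDeriv ℝ 4 f x ![u, v, a, b] := by
    intro a b
    rw [ContinuousMultilinearMap.curryRight_apply, ← hβ]
    congr 2
    funext i
    fin_cases i <;> rfl
  rw [← hβ]
  refine abs_clm_mclm_e_le (by positivity) (fun l => ?_) k (hR k)
  rw [hβ, ← hβ']
  exact abs_clm_mclm_e_le
    (β := ((iteratedFDeriv ℝ 4 f x).curryRight.curryRight ![u, v]).flip (e l)) hM0
    (fun m => by rw [ContinuousLinearMap.flip_apply, hβ']; exact h m l) j (hR j)

/-! ### The inverse square root -/

/-- `S` is the inverse square root of a matrix with lowest eigenvalue at least `N`, and its absolute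
row sums are bounded by `R`. -/
structure InvSqrt (A S : Matrix (Fin p) (Fin p) ℝ) (N R : ℝ) : Prop where
  inner : ∀ u v : E p, ⟪mclm S u, mclm A (mclm S v)⟫ = ⟪u, v⟫
  norm_sq : ∀ u : E p, N * ‖mclm S u‖ ^ 2 ≤ ‖u‖ ^ 2
  col : ∀ k, ∑ l, |S l k| ≤ R

lemma InvSqrt.mk' {A S : Matrix (Fin p) (Fin p) ℝ} {a b R : ℝ} (hA : A.IsHermitian)
    (h : EigenvaluesIn A a b) (hS : S.PosSemidef) (hSA : S * S * A = 1) (hR : rowSumNorm S ≤ R) :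
    InvSqrt A S a R := by
  have hSAS : S * (A * S) = 1 := by
    have h1 : (S * A) * S = 1 := by
      rw [mul_assoc] at hSA
      exact mul_eq_one_comm.1 hSA
    rw [← mul_assoc, h1]
  have hin : ∀ u v : E p, ⟪mclm S u, mclm A (mclm S v)⟫ = ⟪u, v⟫ := by
    intro u v
    rw [real_inner_comm, inner_mclm_comm hS.1]
    have h2 : mclm S (mclm A (mclm S v)) = v := by
      have h3 : mclm S (mclm A (mclm S v)) = mclm (S * (A * S)) v := by
        simp only [mclm, map_mul]
        rfl
      rw [h3, hSAS]
      simp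
    rw [h2]
  refine ⟨hin, fun u => ?_, fun k => ?_⟩
  · have h1 := h.le_inner hA (mclm S u)
    rwa [hin, real_inner_self_eq_norm_sq] at h1
  · have h2 : ∑ l, |S l k| = ∑ l, |S k l| :=
      Finset.sum_congr rfl fun l _ => by
        have : S l k = S k l := by simpa using hS.1.apply k l
        rw [this]
    rw [h2]
    refine le_trans ?_ hR
    exact le_ciSup (f := fun j => ∑ k, |S j k|) (Set.finite_range _).bddAbove k

end Saddlepoint

namespace Saddlepoint

variable {p : ℕ}

/-! ### Derivatives of linear and quadratic functions -/

lemma iteratedFDeriv_clm_one {V : Type*} [NormedAddCommGroup V] [NormedSpace ℝ V] {F : Type*}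
    [NormedAddCommGroup F] [NormedSpace ℝ F] (ℓ : V →L[ℝ] F) (x v : V) :
    iteratedFDeriv ℝ 1 ℓ x ![v] = ℓ v := by
  simp [iteratedFDeriv_one_apply]

lemma iteratedFDeriv_clm_of_two_le {V : Type*} [NormedAddCommGroup V] [NormedSpace ℝ V] {F : Type*}
    [NormedAddCommGroup F] [NormedSpace ℝ F] (ℓ : V →L[ℝ] F) (x : V) (n : ℕ) :
    iteratedFDeriv ℝ (n + 2) ℓ x = 0 := by
  ext m
  rw [iteratedFDeriv_succ_apply_right]
  have : (fun y => fderiv ℝ ℓ y) = fun _ => ℓ := by funext y; simp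
  rw [this, iteratedFDeriv_const_of_ne (Nat.succ_ne_zero n)]
  rfl

/-- Half the squared norm. -/
noncomputable def halfSq (p : ℕ) (w : E p) : ℝ := ‖w‖ ^ 2 / 2

lemma fderiv_halfSq : (fun y => fderiv ℝ (halfSq p) y) = innerSL ℝ := by
  funext y
  have h := ((hasStrictFDerivAt_norm_sq y).hasFDerivAt.const_mul (1 / 2 : ℝ)).fderiv
  have h2 : halfSq p = fun w => 1 / 2 * ‖w‖ ^ 2 := by funext w; rw [halfSq]; ring
  rw [h2, h]
  ext v
  simp

lemma iteratedFDeriv_halfSq_one (x v : E p) : iteratedFDeriv ℝ 1 (halfSq p) x ![v] = ⟪x, v⟫ := by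
  rw [iteratedFDeriv_one_apply, congrFun fderiv_halfSq x]
  rfl

lemma iteratedFDeriv_halfSq_two (x u v : E p) :
    iteratedFDeriv ℝ 2 (halfSq p) x ![u, v] = ⟪u, v⟫ := by
  rw [iteratedFDeriv_two_apply]
  have : fderiv ℝ (halfSq p) = innerSL ℝ := fderiv_halfSq
  rw [this, ContinuousLinearMap.fderiv]
  rfl

lemma iteratedFDeriv_halfSq_of_three_le (x : E p) (n : ℕ) :
    iteratedFDeriv ℝ (n + 3) (halfSq p) x = 0 := by
  ext m
  rw [iteratedFDeriv_succ_apply_right, fderiv_halfSq, iteratedFDeriv_clm_of_two_le]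
  rfl

lemma contDiff_halfSq (n : WithTop ℕ∞) : ContDiff ℝ n (halfSq p) := by
  unfold halfSq
  exact (contDiff_norm_sq ℝ).div_const 2

/-! ### The cumulant generating function at real arguments -/

section Real

variable {μ : Measure (E p)}

lemma mgfC_zero (x : E p) : mgfC μ x 0 = ((∫ w, Real.exp ⟪x, w⟫ ∂μ : ℝ) : ℂ) := by
  rw [← integral_complex_ofReal]
  simp [mgfC]

lemma integral_exp_inner_pos [IsProbabilityMeasure μ] {x : E p} (hx : x ∈ mgfDomain μ) :
    0 < ∫ w, Real.exp ⟪x, w⟫ ∂μ := integral_exp_pos hx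

/-- A quotient of nonnegative integrals has argument 0. Hence at y = 0 the factors i^n leave odd
derivatives purely imaginary and even ones real, which sorts them between phase and modulus. -/
lemma localV_zero (t : E p) : localV μ t 0 = fun _ => 0 := by
  funext x
  rw [localV, localCgf, mgfC_zero, mgfC_zero, ← Complex.ofReal_div, Complex.log_im,
    Complex.arg_ofReal_of_nonneg]
  exact div_nonneg (integral_nonneg fun w => (Real.exp_pos _).le)
    (integral_nonneg fun w => (Real.exp_pos _).le)

lemma mgfC_zero_ne_zero [IsProbabilityMeasure μ] {t : E p} (ht : t ∈ mgfDomain μ) :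
    mgfC μ t 0 ≠ 0 := by
  rw [mgfC_zero]
  exact_mod_cast (integral_exp_inner_pos ht).ne'

lemma iteratedFDeriv_localU_one [IsProbabilityMeasure μ] {s t : E p} (h : IsSaddlepoint μ s t)
    (v : E p) : iteratedFDeriv ℝ 1 (localU μ t 0) t ![v] = ⟪s, v⟫ := by
  have hev : localU μ t 0 =ᶠ[𝓝 t] fun x => cgf μ x - cgf μ t := by
    filter_upwards [mem_interior_iff_mem_nhds.1 h.1] with x hx
    have h1 := integral_exp_inner_pos hx
    have h2 := integral_exp_inner_pos (interior_subset h.1)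
    rw [localU, localCgf, mgfC_zero, mgfC_zero, ← Complex.ofReal_div, Complex.log_ofReal_re,
      Real.log_div h1.ne' h2.ne']
    rfl
  rw [iteratedFDeriv_one_apply, hev.fderiv_eq, fderiv_sub_const, h.2.hasFDerivAt.fderiv]
  simp

end Real

/-! ### The logarithm of the integrand in normalized coordinates -/

/-- `L` is a smooth logarithm of `y ↦ M(t, y) / M(t, 0)` on the ball of radius `δ`, with the
derivatives given by `exists_log_mgfC`. -/
def IsLog (μ : Measure (E p)) (t : E p) (δ : ℝ) (L : E p → ℂ) : Prop :=
  L 0 = 0 ∧ ∀ y ∈ Metric.ball (0 : E p) δ, Complex.exp (L y) = mgfC μ t y / mgfC μ t 0 ∧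
    ContDiffAt ℝ 4 L y ∧ ∀ n : ℕ, n ≠ 0 → n ≤ 4 → ∀ m : Fin n → E p,
      iteratedFDeriv ℝ n L y m = Complex.I ^ n * iteratedFDeriv ℝ n (localCgf μ t y) t m

/-- Logarithm of the modulus of the integrand, relative to the Gaussian density. -/
noncomputable def modPart (L : E p → ℂ) (S : Matrix (Fin p) (Fin p) ℝ) (w : E p) : ℝ :=
  (L (mclm S w)).re + halfSq p w

/-- The phase of the integrand. -/
noncomputable def phasePart (L : E p → ℂ) (S : Matrix (Fin p) (Fin p) ℝ) (s w : E p) : ℝ :=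
  (L (mclm S w)).im - ⟪s, mclm S w⟫

section Jets

variable {μ : Measure (E p)} {t s : E p} {δ : ℝ} {L : E p → ℂ} {S : Matrix (Fin p) (Fin p) ℝ}

lemma contDiffAt_re {L : E p → ℂ} {y : E p} (h : ContDiffAt ℝ 4 L y) :
    ContDiffAt ℝ 4 (fun y => (L y).re) y := h.continuousLinearMap_comp Complex.reCLM

lemma contDiffAt_im {L : E p → ℂ} {y : E p} (h : ContDiffAt ℝ 4 L y) :
    ContDiffAt ℝ 4 (fun y => (L y).im) y := h.continuousLinearMap_comp Complex.imCLM

lemma iteratedFDeriv_re {L : E p → ℂ} {y : E p} (h : ContDiffAt ℝ 4 L y) {n : ℕ} (hn : n ≤ 4)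
    (m : Fin n → E p) :
    iteratedFDeriv ℝ n (fun y => (L y).re) y m = (iteratedFDeriv ℝ n L y m).re := by
  have := Complex.reCLM.iteratedFDeriv_comp_left h (i := n) (by exact_mod_cast hn)
  exact congrFun (congrArg DFunLike.coe this) m

lemma iteratedFDeriv_im {L : E p → ℂ} {y : E p} (h : ContDiffAt ℝ 4 L y) {n : ℕ} (hn : n ≤ 4)
    (m : Fin n → E p) :
    iteratedFDeriv ℝ n (fun y => (L y).im) y m = (iteratedFDeriv ℝ n L y m).im := by
  have := Complex.imCLM.iteratedFDeriv_comp_left h (i := n) (by exact_mod_cast hn)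
  exact congrFun (congrArg DFunLike.coe this) m

lemma contDiffAt_modPart {w : E p} (h : ContDiffAt ℝ 4 L (mclm S w)) :
    ContDiffAt ℝ 4 (modPart L S) w := by
  have h1 : ContDiffAt ℝ 4 (fun w => (L (mclm S w)).re) w :=
    ContDiffAt.comp w (g := fun y => (L y).re) (contDiffAt_re h) (by fun_prop)
  exact h1.add (contDiff_halfSq 4).contDiffAt

lemma contDiffAt_phasePart {w : E p} (h : ContDiffAt ℝ 4 L (mclm S w)) :
    ContDiffAt ℝ 4 (phasePart L S s) w := by
  have h1 : ContDiffAt ℝ 4 (fun w => (L (mclm S w)).im) w :=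
    ContDiffAt.comp w (g := fun y => (L y).im) (contDiffAt_im h) (by fun_prop)
  exact h1.sub (((innerSL ℝ s).comp (mclm S)).contDiff.contDiffAt)

lemma iteratedFDeriv_modPart {w : E p} (h : ContDiffAt ℝ 4 L (mclm S w)) {n : ℕ} (hn : n ≤ 4)
    (m : Fin n → E p) :
    iteratedFDeriv ℝ n (modPart L S) w m =
      (iteratedFDeriv ℝ n L (mclm S w) fun i => mclm S (m i)).re + iteratedFDeriv ℝ n (halfSq p) w m := by
  have hn' : (n : WithTop ℕ∞) ≤ 4 := by exact_mod_cast hn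
  have h0 : ContDiffAt ℝ n (fun y => (L y).re) (mclm S w) := (contDiffAt_re h).of_le hn'
  have h1 : ContDiffAt ℝ n (fun w => (L (mclm S w)).re) w :=
    ContDiffAt.comp w (g := fun y => (L y).re) h0 (by fun_prop)
  have h2 : modPart L S = (fun w => (L (mclm S w)).re) + halfSq p := rfl
  rw [h2, iteratedFDeriv_add_apply h1 (contDiff_halfSq n).contDiffAt,
    add_apply,
    iteratedFDeriv_comp_clm (f := fun y => (L y).re) (mclm S) h0, iteratedFDeriv_re h hn]

lemma iteratedFDeriv_phasePart {w : E p} (h : ContDiffAt ℝ 4 L (mclm S w)) {n : ℕ} (hn : n ≤ 4)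
    (m : Fin n → E p) :
    iteratedFDeriv ℝ n (phasePart L S s) w m =
      (iteratedFDeriv ℝ n L (mclm S w) fun i => mclm S (m i)).im -
        iteratedFDeriv ℝ n ((innerSL ℝ s).comp (mclm S)) w m := by
  have hn' : (n : WithTop ℕ∞) ≤ 4 := by exact_mod_cast hn
  have h0 : ContDiffAt ℝ n (fun y => (L y).im) (mclm S w) := (contDiffAt_im h).of_le hn'
  have h1 : ContDiffAt ℝ n (fun w => (L (mclm S w)).im) w :=
    ContDiffAt.comp w (g := fun y => (L y).im) h0 (by fun_prop)
  have h2 : phasePart L S s =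
      (fun w => (L (mclm S w)).im) - ⇑((innerSL ℝ s).comp (mclm S)) := rfl
  rw [h2, iteratedFDeriv_sub_apply h1 (ContinuousLinearMap.contDiff _).contDiffAt,
    sub_apply,
    iteratedFDeriv_comp_clm (f := fun y => (L y).im) (mclm S) h0, iteratedFDeriv_im h hn]

lemma map_vec1 (a : E p) : (fun i => mclm S (![a] i)) = ![mclm S a] := by
  funext i; fin_cases i; rfl

lemma map_vec2 (a b : E p) : (fun i => mclm S (![a, b] i)) = ![mclm S a, mclm S b] := by
  funext i; fin_cases i <;> rfl

lemma map_vec3 (a b c : E p) :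
    (fun i => mclm S (![a, b, c] i)) = ![mclm S a, mclm S b, mclm S c] := by
  funext i; fin_cases i <;> rfl

lemma map_vec4 (a b c d : E p) :
    (fun i => mclm S (![a, b, c, d] i)) = ![mclm S a, mclm S b, mclm S c, mclm S d] := by
  funext i; fin_cases i <;> rfl

lemma le_of_second_deriv_le {g g' g'' : ℝ → ℝ} {c : ℝ}
    (h1 : ∀ u ∈ Set.Icc (0 : ℝ) 1, HasDerivAt g (g' u) u)
    (h2 : ∀ u ∈ Set.Icc (0 : ℝ) 1, HasDerivAt g' (g'' u) u)
    (hc : ∀ u ∈ Set.Icc (0 : ℝ) 1, g'' u ≤ -c) (h0 : g 0 = 0) (h0' : g' 0 = 0) :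
    g 1 ≤ -c / 2 := by
  have hmono : ∀ u ∈ Set.Icc (0 : ℝ) 1, g' u + c * u ≤ 0 := by
    have hanti : AntitoneOn (fun u => g' u + c * u) (Set.Icc 0 1) := by
      refine antitoneOn_of_hasDerivWithinAt_nonpos (f' := fun u => g'' u + c) (convex_Icc _ _)
        (fun u hu => ?_) (fun u hu => ?_) (fun u hu => ?_)
      · exact (((h2 u hu).add ((hasDerivAt_id u).const_mul c)).continuousAt).continuousWithinAt
      · have := (h2 u (interior_subset hu)).add ((hasDerivAt_id u).const_mul c)
        rw [mul_one] at this
        exact this.hasDerivWithinAt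
      · linarith [hc u (interior_subset hu)]
    intro u hu
    have := hanti (Set.left_mem_Icc.2 zero_le_one) hu hu.1
    simpa [h0'] using this
  have hanti : AntitoneOn (fun u => g u + c * u ^ 2 / 2) (Set.Icc 0 1) := by
    have hd : ∀ u ∈ Set.Icc (0 : ℝ) 1, HasDerivAt (fun u => g u + c * u ^ 2 / 2) (g' u + c * u) u := by
      intro u hu
      refine ((h1 u hu).add (((hasDerivAt_pow 2 u).const_mul c).div_const 2)).congr_deriv ?_
      norm_num
      ring
    refine antitoneOn_of_hasDerivWithinAt_nonpos (f' := fun u => g' u + c * u) (convex_Icc _ _)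
      (fun u hu => (hd u hu).continuousAt.continuousWithinAt)
      (fun u hu => (hd u (interior_subset hu)).hasDerivWithinAt)
      (fun u hu => hmono u (interior_subset hu))
  have := hanti (Set.left_mem_Icc.2 zero_le_one) (Set.right_mem_Icc.2 zero_le_one) zero_le_one
  simp only [h0] at this
  linarith

lemma iteratedFDeriv_localV_zero (n : ℕ) (m : Fin n → E p) :
    iteratedFDeriv ℝ n (localV μ t 0) t m = 0 := by
  rw [localV_zero]
  rcases Nat.eq_zero_or_pos n with rfl | hn
  · simp
  · rw [iteratedFDeriv_const_of_ne hn.ne']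
    rfl

lemma localCgf_re_im (ht : t ∈ interior (mgfDomain μ)) {y : E p} (hne : mgfC μ t y ≠ 0) (n : ℕ)
    (m : Fin n → E p) : iteratedFDeriv ℝ n (localCgf μ t y) t m =
      iteratedFDeriv ℝ n (localU μ t y) t m + Complex.I * iteratedFDeriv ℝ n (localV μ t y) t m := by
  rw [iteratedFDeriv_localU ht hne, iteratedFDeriv_localV ht hne, mul_comm, Complex.re_add_im]

/-- `‖S u‖ ≤ N^{-1/2} ‖u‖`. -/
lemma InvSqrt.norm_le {A S : Matrix (Fin p) (Fin p) ℝ} {N R : ℝ} (h : InvSqrt A S N R) (hN : 0 < N)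
    (u : E p) : ‖mclm S u‖ ≤ ‖u‖ / √N := by
  rw [le_div_iff₀ (Real.sqrt_pos.2 hN)]
  refine abs_le_of_sq_le_sq' ?_ (norm_nonneg u) |>.2
  rw [mul_pow, Real.sq_sqrt hN.le, mul_comm]
  exact h.norm_sq u

variable {N a₃ a₄ R γ : ℝ}

section

variable (hst : IsSaddlepoint μ s t) (hδ : 0 < δ) (hγ : 0 < γ) (hγδ : γ ≤ δ) (hN : 0 < N)
  (hR : 0 ≤ R)
  (hne : ∀ y ∈ Metric.ball (0 : E p) δ, mgfC μ t y ≠ 0) (hL : IsLog μ t δ L)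
  (hS : InvSqrt (U2 μ t 0) S N R)

include hst hne in
lemma abs_localU_four_le {lo hi : ℝ} (hlo : |lo| ≤ a₄) (hhi : |hi| ≤ a₄) {y : E p}
    (hy : y ∈ Metric.ball (0 : E p) δ) (h : ∀ l m, EigenvaluesIn (U4 μ t y l m) lo hi)
    (u v : E p) (l m : Fin p) :
    |iteratedFDeriv ℝ 4 (localU μ t y) t ![u, v, e l, e m]| ≤ a₄ * ‖u‖ * ‖v‖ := by
  have hc := contDiffAt_localU hst.1 (hne y hy) 4
  have h1 := iteratedFDeriv_eq_inner (n := 2) (by exact_mod_cast hc) ![e l, e m] u v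
  have h2 := isHermitian_headMatrix (n := 2) (by exact_mod_cast hc) (![e l, e m] : Fin 2 → E p)
  have h3 : headMatrix (localU μ t y) t (![e l, e m] : Fin 2 → E p) = U4 μ t y l m := rfl
  rw [h3] at h1 h2
  have h4 := (h l m).abs_inner_le h2 hlo hhi u v
  rw [← h1] at h4
  exact h4

include hst hne in
lemma abs_localV_four_le {lo hi : ℝ} (hlo : |lo| ≤ a₄) (hhi : |hi| ≤ a₄) {y : E p}
    (hy : y ∈ Metric.ball (0 : E p) δ) (h : ∀ l m, EigenvaluesIn (V4 μ t y l m) lo hi)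
    (u v : E p) (l m : Fin p) :
    |iteratedFDeriv ℝ 4 (localV μ t y) t ![u, v, e l, e m]| ≤ a₄ * ‖u‖ * ‖v‖ := by
  have hc := contDiffAt_localV hst.1 (hne y hy) 4
  have h1 := iteratedFDeriv_eq_inner (n := 2) (by exact_mod_cast hc) ![e l, e m] u v
  have h2 := isHermitian_headMatrix (n := 2) (by exact_mod_cast hc) (![e l, e m] : Fin 2 → E p)
  have h3 : headMatrix (localV μ t y) t (![e l, e m] : Fin 2 → E p) = V4 μ t y l m := rfl
  rw [h3] at h1 h2
  have h4 := (h l m).abs_inner_le h2 hlo hhi u v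
  rw [← h1] at h4
  exact h4

include hN hR hS in
lemma abs_four_comp_le {f : E p → ℝ} {x : E p} (ha₄ : 0 ≤ a₄)
    (h : ∀ u v l m, |iteratedFDeriv ℝ 4 f x ![u, v, e l, e m]| ≤ a₄ * ‖u‖ * ‖v‖)
    (u v : E p) (j k : Fin p) :
    |iteratedFDeriv ℝ 4 f x ![mclm S u, mclm S v, mclm S (e j), mclm S (e k)]| ≤
      (R ^ 2 * a₄ / N) * ‖u‖ * ‖v‖ := by
  refine (iteratedFDeriv_four_le (M := a₄ * ‖mclm S u‖ * ‖mclm S v‖) (by positivity) hR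
    _ _ (fun l m => h _ _ l m) j k hS.col).trans ?_
  calc R * (R * (a₄ * ‖mclm S u‖ * ‖mclm S v‖)) ≤ R * (R * (a₄ * (‖u‖ / √N) * (‖v‖ / √N))) := by
        gcongr <;> exact hS.norm_le hN _
    _ = R ^ 2 * a₄ / (√N * √N) * ‖u‖ * ‖v‖ := by ring
    _ = _ := by rw [Real.mul_self_sqrt hN.le]

include hst hδ hγδ hN hR hne hL hS in
-- At 0 the first and third derivatives of L are imaginary and the second is -⟨u, v⟩, cancelled by
-- `halfSq`; so the third-order constant is 0. In the fourth derivative the two basis slots cost R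
-- each and the two others N^{-1/2} each.
theorem jetBound_modPart [IsProbabilityMeasure μ] (ha₄ : 0 ≤ a₄) {lo hi : ℝ} (hlo : |lo| ≤ a₄) (hhi : |hi| ≤ a₄)
    (h : ∀ y ∈ Metric.ball (0 : E p) γ, ∀ l m, EigenvaluesIn (U4 μ t y l m) lo hi) :
    JetBound (modPart L S) (mclm S ⁻¹' Metric.ball 0 γ) 0 (R ^ 2 * a₄ / N) := by
  have h0 : (0 : E p) ∈ Metric.ball (0 : E p) δ := by simpa using hδ
  have hs0 : ContDiffAt ℝ 4 L (mclm S 0) := by rw [map_zero]; exact (hL.2 0 h0).2.1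
  have hV := fun (n : ℕ) (m : Fin n → E p) => iteratedFDeriv_localV_zero (μ := μ) (t := t) n m
  have hre := fun (n : ℕ) (m : Fin n → E p) => localCgf_re_im hst.1 (hne 0 h0) n m
  have hD := (hL.2 0 h0).2.2
  refine ⟨fun x hx => ?_, ?_, fun v => ?_, fun u v => ?_, fun u j k => ?_, fun x hx u v j k => ?_⟩
  · have hxδ : mclm S x ∈ Metric.ball (0 : E p) δ := Metric.ball_subset_ball hγδ hx
    exact contDiffAt_modPart (hL.2 _ hxδ).2.1
  · simp [modPart, hL.1, halfSq]
  · rw [iteratedFDeriv_modPart hs0 (by norm_num), map_vec1, map_zero, hD 1 (by norm_num) (by norm_num),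
      hre, hV, iteratedFDeriv_halfSq_one]
    simp
  · have hU := iteratedFDeriv_eq_inner (n := 0) (by exact_mod_cast contDiffAt_localU hst.1 (hne 0 h0) 2)
      ![] (mclm S u) (mclm S v)
    have hU' : iteratedFDeriv ℝ 2 (localU μ t 0) t ![mclm S u, mclm S v] = ⟪u, v⟫ := by
      rw [← hS.inner u v]
      exact hU
    rw [iteratedFDeriv_modPart hs0 (by norm_num), map_vec2, map_zero, hD 2 (by norm_num) (by norm_num),
      hre, hV, iteratedFDeriv_halfSq_two, hU']
    simp
  · rw [iteratedFDeriv_modPart hs0 (by norm_num), map_vec3, map_zero, hD 3 (by norm_num) (by norm_num),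
      hre, hV, iteratedFDeriv_halfSq_of_three_le _ 0]
    simp [pow_succ]
  · have hxδ : mclm S x ∈ Metric.ball (0 : E p) δ := Metric.ball_subset_ball hγδ hx
    have hD4 := (hL.2 _ hxδ).2.2 4 (by norm_num) le_rfl
    rw [iteratedFDeriv_modPart (hL.2 _ hxδ).2.1 le_rfl, map_vec4,
      hD4, iteratedFDeriv_halfSq_of_three_le _ 1,
      Complex.I_pow_four, one_mul, ← iteratedFDeriv_localU hst.1 (hne _ hxδ), zero_apply, add_zero]
    exact abs_four_comp_le hN hR hS ha₄ (abs_localU_four_le hst hne hlo hhi hxδ (h _ hx)) u v j k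

include hst hδ hγδ hN hR hne hL hS in
-- The first derivative is ⟨s, S v⟩ by the saddlepoint equation and cancels; the second is real and
-- drops out; the third is, up to sign, that of U, with one slot costing R and two costing N^{-1/2}.
theorem jetBound_phasePart [IsProbabilityMeasure μ] (ha₃ : 0 ≤ a₃) (ha₄ : 0 ≤ a₄) {lo₃ hi₃ lo hi : ℝ} (hlo₃ : |lo₃| ≤ a₃)
    (hhi₃ : |hi₃| ≤ a₃) (h₃ : ∀ l, EigenvaluesIn (U3 μ t 0 l) lo₃ hi₃)
    (hlo : |lo| ≤ a₄) (hhi : |hi| ≤ a₄)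
    (h : ∀ y ∈ Metric.ball (0 : E p) γ, ∀ l m, EigenvaluesIn (V4 μ t y l m) lo hi) :
    JetBound (phasePart L S s) (mclm S ⁻¹' Metric.ball 0 γ) (R * a₃ / N) (R ^ 2 * a₄ / N) := by
  have h0 : (0 : E p) ∈ Metric.ball (0 : E p) δ := by simpa using hδ
  have hs0 : ContDiffAt ℝ 4 L (mclm S 0) := by rw [map_zero]; exact (hL.2 0 h0).2.1
  have hV := fun (n : ℕ) (m : Fin n → E p) => iteratedFDeriv_localV_zero (μ := μ) (t := t) n m
  have hre := fun (n : ℕ) (m : Fin n → E p) => localCgf_re_im hst.1 (hne 0 h0) n m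
  have hD := (hL.2 0 h0).2.2
  refine ⟨fun x hx => ?_, ?_, fun v => ?_, fun u v => ?_, fun u j k => ?_, fun x hx u v j k => ?_⟩
  · have hxδ : mclm S x ∈ Metric.ball (0 : E p) δ := Metric.ball_subset_ball hγδ hx
    exact contDiffAt_phasePart (hL.2 _ hxδ).2.1
  · simp [phasePart, hL.1]
  · rw [iteratedFDeriv_phasePart hs0 (by norm_num), map_vec1, map_zero,
      hD 1 (by norm_num) (by norm_num), hre, hV, iteratedFDeriv_clm_one,
      iteratedFDeriv_localU_one hst]
    simp
  · rw [iteratedFDeriv_phasePart hs0 (by norm_num), map_vec2, map_zero,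
      hD 2 (by norm_num) (by norm_num), hre, hV, iteratedFDeriv_clm_of_two_le _ _ 0]
    simp
  · rw [iteratedFDeriv_phasePart hs0 (by norm_num), map_vec3, map_zero,
      hD 3 (by norm_num) (by norm_num), hre, hV, iteratedFDeriv_clm_of_two_le _ _ 1]
    have h5 : ∀ r : ℝ, (Complex.I ^ 3 * ((r : ℂ) + Complex.I * ((0 : ℝ) : ℂ))).im = -r := by
      intro r; simp [pow_succ]
    rw [h5, zero_apply, sub_zero, abs_neg]
    have hc := contDiffAt_localU hst.1 (hne 0 h0) 3
    refine (iteratedFDeriv_three_le (M := a₃ * ‖mclm S u‖ * ‖mclm S (e j)‖) (by positivity)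
      _ _ (fun l => ?_) k hS.col).trans ?_
    · have h1 := iteratedFDeriv_eq_inner (n := 1) (by exact_mod_cast hc) ![e l] (mclm S u)
        (mclm S (e j))
      have h2 := isHermitian_headMatrix (n := 1) (by exact_mod_cast hc) (![e l] : Fin 1 → E p)
      have h3 : headMatrix (localU μ t 0) t (![e l] : Fin 1 → E p) = U3 μ t 0 l := rfl
      rw [h3] at h1 h2
      have h4 := (h₃ l).abs_inner_le h2 hlo₃ hhi₃ (mclm S u) (mclm S (e j))
      rw [← h1] at h4
      exact h4
    · calc R * (a₃ * ‖mclm S u‖ * ‖mclm S (e j)‖)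
          ≤ R * (a₃ * (‖u‖ / √N) * (‖(e j : E p)‖ / √N)) := by
            gcongr <;> exact hS.norm_le hN _
        _ = R * a₃ / (√N * √N) * ‖u‖ := by rw [norm_e]; ring
        _ = _ := by rw [Real.mul_self_sqrt hN.le]
  · have hxδ : mclm S x ∈ Metric.ball (0 : E p) δ := Metric.ball_subset_ball hγδ hx
    have hD4 := (hL.2 _ hxδ).2.2 4 (by norm_num) le_rfl
    rw [iteratedFDeriv_phasePart (hL.2 _ hxδ).2.1 le_rfl, map_vec4,
      hD4, iteratedFDeriv_clm_of_two_le _ _ 2,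
      Complex.I_pow_four, one_mul, ← iteratedFDeriv_localV hst.1 (hne _ hxδ), zero_apply, sub_zero]
    exact abs_four_comp_le hN hR hS ha₄ (abs_localV_four_le hst hne hlo hhi hxδ (h _ hx)) u v j k

end

/-! ### Decay along rays -/

/-- Along the ray to y the second derivative of Re L is -⟨y, U2 y⟩ ≤ -N‖y‖², and the first vanishes
at 0. The spectral bound at complex arguments makes this valid on all of the δ-ball. -/
theorem re_log_le (hst : IsSaddlepoint μ s t) (hδ : 0 < δ)
    (hne : ∀ y ∈ Metric.ball (0 : E p) δ, mgfC μ t y ≠ 0) (hL : IsLog μ t δ L) {N' : ℝ}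
    (h8 : ∀ y ∈ Metric.ball (0 : E p) δ, EigenvaluesIn (U2 μ t y) N N')
    {y : E p} (hy : y ∈ Metric.ball (0 : E p) δ) : (L y).re ≤ -(N * ‖y‖ ^ 2) / 2 := by
  have h0 : (0 : E p) ∈ Metric.ball (0 : E p) δ := by simpa using hδ
  have hray : ∀ u ∈ Set.Icc (0 : ℝ) 1, 0 + u • y ∈ Metric.ball (0 : E p) δ := fun u hu =>
    JetBound.ray (convex_ball _ _) h0 hy hu
  set f : E p → ℝ := fun y => (L y).re with hf
  have key := le_of_second_deriv_le (c := N * ‖y‖ ^ 2)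
    (g := fun u : ℝ => iteratedFDeriv ℝ 0 f (0 + u • y) ![])
    (g' := fun u : ℝ => iteratedFDeriv ℝ 1 f (0 + u • y) ![y])
    (g'' := fun u : ℝ => iteratedFDeriv ℝ 2 f (0 + u • y) ![y, y]) ?_ ?_ ?_ ?_ ?_
  · simpa [hf] using key
  · intro u hu
    exact hasDerivAt_iteratedFDeriv (n := 0) ((contDiffAt_re (hL.2 _ (hray u hu)).2.1).of_le
      (by norm_num)) ![]
  · intro u hu
    exact hasDerivAt_iteratedFDeriv (n := 1) ((contDiffAt_re (hL.2 _ (hray u hu)).2.1).of_le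
      (by norm_num)) ![y]
  · intro u hu
    have hu' := hray u hu
    have hc := contDiffAt_localU hst.1 (hne _ hu') 2
    have h1 := iteratedFDeriv_eq_inner (n := 0) (by exact_mod_cast hc) ![] y y
    have h2 := isHermitian_headMatrix (n := 0) (by exact_mod_cast hc) (![] : Fin 0 → E p)
    have h3 : headMatrix (localU μ t (0 + u • y)) t (![] : Fin 0 → E p) = U2 μ t (0 + u • y) := rfl
    rw [h3] at h1 h2
    have h4 := (h8 _ hu').le_inner h2 y
    rw [← h1] at h4
    have h5 : iteratedFDeriv ℝ 2 f (0 + u • y) ![y, y] =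
        -iteratedFDeriv ℝ 2 (localU μ t (0 + u • y)) t ![y, y] := by
      rw [hf, iteratedFDeriv_re (hL.2 _ hu').2.1 (by norm_num),
        (hL.2 _ hu').2.2 2 (by norm_num) (by norm_num), Complex.I_sq,
        iteratedFDeriv_localU hst.1 (hne _ hu')]
      simp
    rw [h5]
    exact neg_le_neg h4
  · simp [hf, hL.1]
  · simp only [zero_smul, add_zero]
    rw [hf, iteratedFDeriv_re (hL.2 0 h0).2.1 (by norm_num),
      (hL.2 0 h0).2.2 1 (by norm_num) (by norm_num), localCgf_re_im hst.1 (hne 0 h0),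
      iteratedFDeriv_localV_zero]
    simp

end Jets

end Saddlepoint

namespace Saddlepoint

variable {p : ℕ}

/-! ### Fourier inversion -/

section Inversion

open scoped FourierTransform

variable {μ : Measure (E p)} {f : E p → ℝ} {s t : E p}

lemma integral_density (hf : IsDensity μ f) (G : E p → ℂ) :
    ∫ w, G w ∂μ = ∫ w, (f w : ℂ) * G w := by
  rw [hf.2.2, integral_withDensity_eq_integral_toReal_smul hf.1.ennreal_ofReal
    (Eventually.of_forall fun _ => ENNReal.ofReal_lt_top)]
  refine integral_congr_ae (Eventually.of_forall fun w => ?_)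
  simp [ENNReal.toReal_ofReal (hf.2.1 w)]

lemma integrable_density_iff (hf : IsDensity μ f) (G : E p → ℝ) :
    Integrable G μ ↔ Integrable fun w => G w * f w := by
  rw [hf.2.2, integrable_withDensity_iff hf.1.ennreal_ofReal
    (Eventually.of_forall fun _ => ENNReal.ofReal_lt_top)]
  simp only [ENNReal.toReal_ofReal (hf.2.1 _)]

lemma continuous_mgfC (ht : t ∈ interior (mgfDomain μ)) : Continuous (mgfC μ t) :=
  continuous_iff_continuousAt.2 fun y => (contDiffAt_mgfC_right ht y 0).continuousAt

lemma continuous_integrand (s : E p) (ht : t ∈ interior (mgfDomain μ)) :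
    Continuous (integrand μ s t) := by
  have := continuous_mgfC ht
  unfold integrand
  fun_prop

lemma integrable_integrand (s : E p) {δ : ℝ} (ht : t ∈ interior (mgfDomain μ))
    (h : IntegrableOn (integrand μ s t) (Metric.ball 0 δ)ᶜ) : Integrable (integrand μ s t) := by
  rw [← integrableOn_univ, ← Set.union_compl_self (Metric.ball (0 : E p) δ)]
  refine IntegrableOn.union ?_ h
  exact ((continuous_integrand s ht).continuousOn.integrableOn_compact
    (isCompact_closedBall 0 δ)).mono_set Metric.ball_subset_closedBall

lemma mgfC_mul_exp [IsProbabilityMeasure μ] (ht : t ∈ mgfDomain μ) (y : E p) :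
    Complex.exp (-(Complex.I * (⟪y, s⟫ : ℂ))) * mgfC μ t y = mgfC μ t 0 * integrand μ s t y := by
  have := mgfC_zero_ne_zero ht
  rw [integrand]
  field_simp

lemma integrable_mgfC [IsProbabilityMeasure μ] (ht : t ∈ interior (mgfDomain μ))
    (h : Integrable (integrand μ s t)) : Integrable (mgfC μ t) := by
  refine (h.const_mul (mgfC μ t 0)).mono (continuous_mgfC ht).aestronglyMeasurable
    (Eventually.of_forall fun y => ?_)
  rw [← mgfC_mul_exp (interior_subset ht), norm_mul, Complex.norm_exp]
  simp

/-- Fourier inversion for the tilted density. -/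
theorem integral_integrand [IsProbabilityMeasure μ] (hf : IsDensity μ f) (hs : ContinuousAt f s)
    (ht : t ∈ interior (mgfDomain μ)) (h : Integrable (integrand μ s t)) :
    ∫ y, integrand μ s t y =
      (((2 * Real.pi) ^ p * (Real.exp ⟪t, s⟫ * f s) / ∫ w, Real.exp ⟪t, w⟫ ∂μ : ℝ) : ℂ) := by
  set g : E p → ℂ := fun x => ((Real.exp ⟪t, x⟫ * f x : ℝ) : ℂ) with hg
  have htd : Integrable (fun w => Real.exp ⟪t, w⟫) μ := interior_subset (s := mgfDomain μ) ht
  have hgi : Integrable g := ((integrable_density_iff hf _).1 htd).ofReal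
  have hgs : ContinuousAt g s := by
    have : ContinuousAt (fun x => Real.exp ⟪t, x⟫ * f x) s :=
      ContinuousAt.mul (by fun_prop) hs
    exact Complex.continuous_ofReal.continuousAt.comp this
  -- In Mathlib's normalization the transform of the tilted density is M(t, -2πw); undoing the
  -- scaling later produces the factor (2π)^p.
  have hF : 𝓕 g = fun w => mgfC μ t ((-(2 * Real.pi)) • w) := by
    funext w
    rw [Real.fourier_eq', mgfC, integral_density hf]
    refine integral_congr_ae (Eventually.of_forall fun v => ?_)
    simp only [hg, smul_eq_mul, Complex.ofReal_mul, Complex.ofReal_exp, real_inner_smul_left]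
    rw [Complex.exp_add, real_inner_comm]
    push_cast
    rw [show Complex.I * (-(2 * (Real.pi : ℂ)) * (⟪w, v⟫ : ℂ)) =
      -2 * Real.pi * (⟪w, v⟫ : ℂ) * Complex.I by ring]
    ring
  have hpi : -(2 * Real.pi) ≠ 0 := by have := Real.pi_pos; linarith
  have hFi : Integrable (𝓕 g) := by
    rw [hF]
    exact (integrable_mgfC ht h).comp_smul hpi
  have hinv := hgi.fourierInv_fourier_eq hFi hgs
  have hm := integral_exp_inner_pos (interior_subset ht)
  have hI : 𝓕⁻ (𝓕 g) s = ∫ v, mgfC μ t 0 * integrand μ s t ((-(2 * Real.pi)) • v) := by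
    rw [Real.fourierInv_eq', hF]
    refine integral_congr_ae (Eventually.of_forall fun v => ?_)
    simp only [smul_eq_mul]
    rw [← mgfC_mul_exp (interior_subset ht), real_inner_smul_left]
    congr 2
    push_cast
    ring
  rw [hI, integral_const_mul, Measure.integral_comp_smul, mgfC_zero] at hinv
  have hab : |((-(2 * Real.pi)) ^ Module.finrank ℝ (E p))⁻¹| = ((2 * Real.pi) ^ p)⁻¹ := by
    rw [finrank_euclideanSpace_fin, abs_inv, abs_pow, abs_neg, abs_of_pos (by positivity)]
  rw [hab] at hinv
  have hm' : ((∫ w, Real.exp ⟪t, w⟫ ∂μ : ℝ) : ℂ) ≠ 0 := by exact_mod_cast hm.ne'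
  have hpi' : (((2 * Real.pi) ^ p : ℝ) : ℂ) ≠ 0 := by
    exact_mod_cast (by positivity : (0 : ℝ) < (2 * Real.pi) ^ p).ne'
  rw [Complex.real_smul, hg] at hinv
  simp only at hinv
  rw [Complex.ofReal_div, Complex.ofReal_mul, ← hinv, Complex.ofReal_inv]
  field_simp

/-- The ratio of the density to its saddlepoint approximation is a normalized integral. -/
theorem div_approx [IsProbabilityMeasure μ] (hf : IsDensity μ f) (hs : ContinuousAt f s)
    (ht : t ∈ interior (mgfDomain μ)) (h : Integrable (integrand μ s t)) :
    ((f s / approx μ s t : ℝ) : ℂ) =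
      ((Real.sqrt (U2 μ t 0).det / (2 * Real.pi) ^ ((p : ℝ) / 2) : ℝ) : ℂ) *
        ∫ y, integrand μ s t y := by
  rw [integral_integrand hf hs ht h, ← Complex.ofReal_mul]
  congr 1
  have hm := integral_exp_inner_pos (interior_subset ht)
  have h2 : (2 * Real.pi) ^ p = (2 * Real.pi) ^ ((p : ℝ) / 2) * (2 * Real.pi) ^ ((p : ℝ) / 2) := by
    rw [← Real.rpow_add (by positivity), add_halves, Real.rpow_natCast]
  rw [h2, approx, Real.exp_sub, cgf, Real.exp_log hm]
  have h3 : (0 : ℝ) < (2 * Real.pi) ^ ((p : ℝ) / 2) := by positivity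
  have h4 := Real.exp_pos ⟪t, s⟫
  field_simp

end Inversion

/-! ### Change of variables -/

lemma det_mclm (S : Matrix (Fin p) (Fin p) ℝ) : (mclm S).det = S.det := by
  have : (mclm S : E p →ₗ[ℝ] E p) = Matrix.toLpLin 2 2 S := rfl
  rw [ContinuousLinearMap.det, this, LinearMap.det_toLpLin]

/-- The inverse square root has determinant `det A ^ (-1/2)`. -/
lemma sqrt_det_mul_det {A S : Matrix (Fin p) (Fin p) ℝ} (hS : S.PosSemidef) (hSA : S * S * A = 1) :
    √A.det * S.det = 1 := by
  have h1 : S.det * S.det * A.det = 1 := by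
    rw [← Matrix.det_mul, ← Matrix.det_mul, hSA, Matrix.det_one]
  have h2 : 0 ≤ S.det := hS.det_nonneg
  have h3 : 0 < S.det := lt_of_le_of_ne h2 (by rintro h; rw [← h] at h1; simp at h1)
  have h4 : A.det = (S.det⁻¹) ^ 2 := by field_simp; linarith
  rw [h4, Real.sqrt_sq (by positivity), inv_mul_cancel₀ h3.ne']

/-- The Jacobian of w ↦ S w is det S = (det A)^{-1/2}, so the prefactor of the integral disappears
in normalized coordinates. -/
lemma sqrt_det_mul_integral {A S : Matrix (Fin p) (Fin p) ℝ} (hS : S.PosSemidef)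
    (hSA : S * S * A = 1) (B : Set (E p)) (hB : MeasurableSet B) {g : E p → ℝ}
    (hg : IntegrableOn g B) :
    IntegrableOn (fun w => g (mclm S w)) (mclm S ⁻¹' B) ∧
      √A.det * ∫ y in B, g y = ∫ w in mclm S ⁻¹' B, g (mclm S w) := by
  have hdet := sqrt_det_mul_det hS hSA
  have h0 : S.det ≠ 0 := right_ne_zero_of_mul_eq_one hdet
  have hu : S * (S * A) = 1 := by rw [← mul_assoc, hSA]
  have hinv : ∀ w, mclm (S * A) (mclm S w) = w := by
    intro w
    have h3 : mclm (S * A) (mclm S w) = mclm ((S * A) * S) w := by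
      simp only [mclm, map_mul]
      rfl
    rw [h3, mul_eq_one_comm.1 hu]
    simp
  have hinv' : ∀ w, mclm S (mclm (S * A) w) = w := by
    intro w
    have h3 : mclm S (mclm (S * A) w) = mclm (S * (S * A)) w := by
      simp only [mclm, map_mul]
      rfl
    rw [h3, hu]
    simp
  have hinj : Function.Injective (mclm S) := Function.LeftInverse.injective hinv
  have himg : mclm S '' (mclm S ⁻¹' B) = B :=
    Set.image_preimage_eq B (Function.RightInverse.surjective hinv')
  have hm : MeasurableSet (mclm S ⁻¹' B) := (mclm S).continuous.measurable hB
  have hd : ∀ x ∈ mclm S ⁻¹' B, HasFDerivWithinAt (mclm S) (mclm S) (mclm S ⁻¹' B) x :=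
    fun x _ => (mclm S).hasFDerivAt.hasFDerivWithinAt
  have h1 := integrableOn_image_iff_integrableOn_abs_det_fderiv_smul volume hm hd hinj.injOn g
  have h2 := integral_image_eq_integral_abs_det_fderiv_smul volume hm hd hinj.injOn g
  rw [himg, det_mclm, abs_of_nonneg hS.det_nonneg] at h1 h2
  constructor
  · have := (h1.1 hg).const_mul (S.det⁻¹)
    refine this.congr (Eventually.of_forall fun w => ?_)
    simp only [smul_eq_mul]
    rw [inv_mul_cancel_left₀ h0]
  · rw [h2]
    simp only [smul_eq_mul]
    rw [integral_const_mul, ← mul_assoc, hdet, one_mul]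

/-! ### Nonvanishing -/

/-- Where the spectrum of the Hessian is bounded below by a positive number, the moment generating
function does not vanish. -/
lemma mgfC_ne_zero_of_eigenvaluesIn {μ : Measure (E p)} {t y : E p} {N N' : ℝ} (hp : 1 ≤ p)
    (hN : 0 < N) (h : EigenvaluesIn (U2 μ t y) N N') : mgfC μ t y ≠ 0 := by
  intro h0
  -- If M(t,y) = 0, the conventions x/0 = 0 and log 0 = 0 make `localU` identically zero, so `U2` is
  -- the zero matrix, whose spectrum contains 0 as p ≥ 1.
  have h1 : localU μ t y = fun _ => 0 := by
    funext x
    simp [localU, localCgf, h0]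
  have h2 : U2 μ t y = 0 := by
    ext j k
    rw [U2, h1, Matrix.of_apply, iteratedFDeriv_const_of_ne (by norm_num)]
    rfl
  have : Nonempty (Fin p) := ⟨⟨0, hp⟩⟩
  have h3 : (0 : ℝ) ∈ spectrum ℝ (U2 μ t y) := by
    rw [h2, spectrum.zero_eq]
    rfl
  linarith [(h 0 h3).1]

end Saddlepoint

namespace Saddlepoint

variable {p : ℕ}

/-! ### The error bound for one distribution -/

section Bound

variable {μ : Measure (E p)} {f : E p → ℝ} {s t : E p} {δ : ℝ} {L : E p → ℂ}

lemma re_integrand (hL : IsLog μ t δ L) {y : E p} (hy : y ∈ Metric.ball (0 : E p) δ) :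
    (integrand μ s t y).re = Real.exp (L y).re * Real.cos ((L y).im - ⟪s, y⟫) := by
  rw [integrand, ← (hL.2 y hy).1, ← Complex.exp_add, Complex.exp_re]
  congr 2 <;> simp [real_inner_comm, sub_eq_add_neg]

lemma re_integrand_mclm (hL : IsLog μ t δ L) {S : Matrix (Fin p) (Fin p) ℝ} {w : E p}
    (hw : mclm S w ∈ Metric.ball (0 : E p) δ) :
    (integrand μ s t (mclm S w)).re =
      Real.exp (-(1 / 2) * ‖w‖ ^ 2) * (Real.exp (modPart L S w) * Real.cos (phasePart L S s w)) := by
  rw [re_integrand hL hw, ← mul_assoc, ← Real.exp_add, modPart, phasePart, halfSq]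
  ring_nf

/-- Explicit error bound for the saddlepoint approximation. -/
theorem abs_div_approx_sub_one_le [IsProbabilityMeasure μ] (hf : IsDensity μ f)
    (hs : ContinuousAt f s) (hst : IsSaddlepoint μ s t) (hp : 1 ≤ p) (hδ : 0 < δ)
    {γ N N' R a₃ a₄ lo₃ hi₃ lo hi : ℝ} (hγ : 0 < γ) (hγδ : γ ≤ δ) (hN : 0 < N) (hN' : 0 < N')
    (hR : 0 < R) (ha₄ : 0 < a₄)
    (htail : IntegrableOn (integrand μ s t) (Metric.ball 0 δ)ᶜ)
    (h8 : ∀ y ∈ Metric.ball (0 : E p) δ, EigenvaluesIn (U2 μ t y) N N')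
    (h8' : InvSqrtRowSumNormLE (U2 μ t 0) R)
    (hlo₃ : |lo₃| ≤ a₃) (hhi₃ : |hi₃| ≤ a₃) (h9 : ∀ l, EigenvaluesIn (U3 μ t 0 l) lo₃ hi₃)
    (hlo : |lo| ≤ a₄) (hhi : |hi| ≤ a₄)
    (h10 : ∀ y ∈ Metric.ball (0 : E p) γ, ∀ l m,
      EigenvaluesIn (U4 μ t y l m) lo hi ∧ EigenvaluesIn (V4 μ t y l m) lo hi)
    {b b₃ ρ : ℝ} (hb : b = R ^ 2 * a₄ / N) (hb₃ : b₃ = R * a₃ / N) (hρ : ρ = √N * γ)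
    (hbp : b * p ^ 2 ≤ 1) (hbρ : 2 * b * ρ ^ 4 + 2 * p * b ^ 2 * ρ ^ 8 ≤ 1)
    (hbγ : p * b * (N' * γ ^ 2) ≤ 1 / 8) :
    |f s / approx μ s t - 1| ≤
      200000 * (b * p ^ 2 + b₃ ^ 2 * p ^ 3) + 2 * (Real.exp (-(ρ ^ 2 / 4)) * 4 ^ ((p : ℝ) / 2)) +
        Real.exp (-(3 / 8 * ρ ^ 2)) * (4 * N' / N) ^ ((p : ℝ) / 2) +
        ‖((√(U2 μ t 0).det / (2 * Real.pi) ^ ((p : ℝ) / 2) : ℝ) : ℂ) *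
          ∫ y in (Metric.ball 0 δ)ᶜ, integrand μ s t y‖ := by
  have h0 : (0 : E p) ∈ Metric.ball (0 : E p) δ := by simpa using hδ
  have hne : ∀ y ∈ Metric.ball (0 : E p) δ, mgfC μ t y ≠ 0 := fun y hy =>
    mgfC_ne_zero_of_eigenvaluesIn hp hN (h8 y hy)
  obtain ⟨L, hL⟩ : ∃ L, IsLog μ t δ L := exists_log_mgfC hδ hst.1 hne
  obtain ⟨S, hS, hSA, hSR⟩ := h8'
  have hA : (U2 μ t 0).IsHermitian := isHermitian_headMatrix (n := 0)
    (by exact_mod_cast contDiffAt_localU hst.1 (hne 0 h0) 2) (![] : Fin 0 → E p)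
  have hI : InvSqrt (U2 μ t 0) S N R := InvSqrt.mk' hA (h8 0 h0) hS hSA hSR
  have ha₃ : 0 ≤ a₃ := (abs_nonneg _).trans hlo₃
  have hP := jetBound_modPart hst hδ hγδ hN hR.le hne hL hI ha₄.le hlo hhi
    fun y hy l m => (h10 y hy l m).1
  have hΘ := jetBound_phasePart hst hδ hγδ hN hR.le hne hL hI ha₃ ha₄.le hlo₃ hhi₃ h9 hlo hhi
    fun y hy l m => (h10 y hy l m).2
  rw [← hb] at hP
  rw [← hb, ← hb₃] at hΘ
  have hb0 : 0 < b := by rw [hb]; positivity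
  have hb₃0 : 0 ≤ b₃ := by rw [hb₃]; positivity
  have hρ0 : 0 ≤ ρ := by rw [hρ]; positivity
  have hρ2 : ρ ^ 2 = N * γ ^ 2 := by rw [hρ, mul_pow, Real.sq_sqrt hN.le]
  -- The upper spectral bound translates lengths back: outside the γ-ball the decay in ‖S w‖ becomes
  -- decay in ‖w‖.
  have hupper : ∀ w, ‖w‖ ^ 2 ≤ N' * ‖mclm S w‖ ^ 2 := fun w => by
    have := (h8 0 h0).inner_le hA (mclm S w)
    rwa [hI.inner, real_inner_self_eq_norm_sq] at this
  have hΩ : Convex ℝ (mclm S ⁻¹' Metric.ball 0 γ) :=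
    (convex_ball (0 : E p) γ).linear_preimage (mclm S : E p →ₗ[ℝ] E p)
  have hρΩ : Metric.ball 0 ρ ⊆ mclm S ⁻¹' Metric.ball 0 γ := fun w hw => by
    rw [mem_ball_zero_iff] at hw
    rw [Set.mem_preimage, mem_ball_zero_iff]
    refine (hI.norm_le hN w).trans_lt ?_
    rw [div_lt_iff₀ (Real.sqrt_pos.2 hN), mul_comm, ← hρ]
    exact hw
  have h0Ω : (0 : E p) ∈ mclm S ⁻¹' Metric.ball 0 γ := by simpa using hγ
  have hΩD : mclm S ⁻¹' Metric.ball 0 γ ⊆ mclm S ⁻¹' Metric.ball 0 δ :=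
    Set.preimage_mono (Metric.ball_subset_ball hγδ)
  have hint := integrable_integrand s hst.1 htail
  obtain ⟨hD1, hD2⟩ := sqrt_det_mul_integral hS hSA (Metric.ball 0 δ) measurableSet_ball
    (g := fun y => (integrand μ s t y).re) hint.re.integrableOn
  have hκ : 0 < N / (8 * N') := by positivity
  have hmain := abs_integral_sub_gaussZ_le (q := 3 / 8 * ρ ^ 2) (κ := N / (8 * N')) hp hP hΘ hΩ hb₃0
    hb0 hρ0 hκ hρΩ hbp hbρ ((mclm S).continuous.measurable measurableSet_ball) (hρΩ.trans hΩD) hD1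
    (fun w hw => re_integrand_mclm hL (hΩD (hρΩ hw))) ?_
  · rw [← hD2] at hmain
    have hZ := gaussZ_pos p
    -- The ratio is real, so only the real part of the integral is needed; this is what turns the
    -- phase into a cosine.
    have hratio := congrArg Complex.re (div_approx hf hs hst.1 hint)
    rw [Complex.ofReal_re, ← integral_add_compl measurableSet_ball hint (s := Metric.ball 0 δ), mul_add,
      Complex.add_re, Complex.re_ofReal_mul] at hratio
    have hre : (∫ y in Metric.ball 0 δ, integrand μ s t y).re =
      ∫ y in Metric.ball 0 δ, (integrand μ s t y).re := (integral_re hint.integrableOn).symm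
    rw [hratio, hre, add_sub_right_comm]
    refine (abs_add_le _ _).trans (add_le_add ?_ (Complex.abs_re_le_norm _))
    have hκ' : 1 / (2 * (N / (8 * N'))) = 4 * N' / N := by field_simp; norm_num
    rw [hκ'] at hmain
    rw [← gaussZ, div_mul_eq_mul_div, div_sub_one hZ.ne', abs_div, abs_of_pos hZ, div_le_iff₀ hZ]
    exact hmain
  · rintro w ⟨hwD, hwρ⟩
    have hwρ' : ρ ≤ ‖w‖ := by simpa using hwρ
    have hwD' : mclm S w ∈ Metric.ball (0 : E p) δ := hwD
    -- Where the fourth derivatives are controlled, P ≤ ‖w‖²/8 leaves the exponent -(3/8)‖w‖² ≤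
    -- -ρ²/4 - ‖w‖²/8. Farther out only the decay along rays is available.
    by_cases hwΩ : w ∈ mclm S ⁻¹' Metric.ball 0 γ
    · refine le_add_of_le_of_nonneg ?_ (by positivity)
      have h1 := hP.abs_le hΩ h0Ω le_rfl hb0.le hwΩ
      rw [re_integrand_mclm hL hwD', abs_mul, abs_mul, Real.abs_exp, Real.abs_exp]
      have h2 : ‖w‖ ^ 2 ≤ N' * γ ^ 2 := (hupper w).trans (by
        have : ‖mclm S w‖ < γ := by simpa using hwΩ
        gcongr)
      have h3 : modPart L S w ≤ 1 / 8 * ‖w‖ ^ 2 := by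
        refine (le_abs_self _).trans (h1.trans ?_)
        calc p * (0 + b * ‖w‖) * ‖w‖ ^ 3 = p * b * ‖w‖ ^ 2 * ‖w‖ ^ 2 := by ring
          _ ≤ p * b * (N' * γ ^ 2) * ‖w‖ ^ 2 := by gcongr
          _ ≤ _ := by gcongr
      calc Real.exp (-(1 / 2) * ‖w‖ ^ 2) * (Real.exp (modPart L S w) * |Real.cos (phasePart L S s w)|)
          ≤ Real.exp (-(1 / 2) * ‖w‖ ^ 2) * (Real.exp (1 / 8 * ‖w‖ ^ 2) * 1) := by
            gcongr
            exact Real.abs_cos_le_one _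
        _ ≤ _ := by
            rw [mul_one, ← Real.exp_add, ← Real.exp_add]
            refine Real.exp_le_exp.2 ?_
            nlinarith
    · refine le_add_of_nonneg_of_le (by positivity) ?_
      have hw1 : γ ≤ ‖mclm S w‖ := by simpa using hwΩ
      have h1 := re_log_le hst hδ hne hL h8 hwD'
      rw [re_integrand hL hwD', abs_mul, Real.abs_exp]
      calc Real.exp (L (mclm S w)).re * |Real.cos ((L (mclm S w)).im - ⟪s, mclm S w⟫)|
          ≤ Real.exp (-(N * ‖mclm S w‖ ^ 2) / 2) * 1 := by
            gcongr
            exact Real.abs_cos_le_one _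
        _ ≤ _ := by
            rw [mul_one, ← Real.exp_add]
            refine Real.exp_le_exp.2 ?_
            -- The exponent N‖S w‖²/2 is split as 3/8 + 1/8: the first share gives at least (3/8)ρ²,
            -- the second gives decay in ‖w‖.
            have h2 : γ ^ 2 ≤ ‖mclm S w‖ ^ 2 := by gcongr
            have h3 : N / (8 * N') * ‖w‖ ^ 2 ≤ N / (8 * N') * (N' * ‖mclm S w‖ ^ 2) := by
              gcongr
              exact hupper w
            have h4 : N / (8 * N') * (N' * ‖mclm S w‖ ^ 2) = N * ‖mclm S w‖ ^ 2 / 8 := by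
              field_simp
            have h5 : N * γ ^ 2 ≤ N * ‖mclm S w‖ ^ 2 := by gcongr
            rw [hρ2]
            linarith

end Bound

end Saddlepoint

namespace Saddlepoint

/-! ### Asymptotics -/

section Asymp

lemma tendsto_rpow_mul_log_pow {ε : ℝ} (hε : 0 < ε) (k : ℕ) :
    Tendsto (fun n : ℕ => (n : ℝ) ^ (-ε) * Real.log n ^ k) atTop (𝓝 0) := by
  have h := (isLittleO_log_rpow_rpow_atTop (k : ℝ) hε).tendsto_div_nhds_zero.comp
    tendsto_natCast_atTop_atTop
  refine h.congr' ?_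
  filter_upwards with n
  simp only [Function.comp_apply]
  rw [Real.rpow_natCast, Real.rpow_neg (Nat.cast_nonneg n), div_eq_mul_inv, mul_comm]

lemma tendsto_rpow_div_mul_log_pow {P : ℕ → ℕ} {α β ν : ℝ}
    (hp : (fun n => (P n : ℝ)) =O[atTop] fun n => (n : ℝ) ^ α) (hβ : 0 ≤ β) (h : α * β < ν) (k : ℕ) :
    Tendsto (fun n : ℕ => (P n : ℝ) ^ β / (n : ℝ) ^ ν * Real.log n ^ k) atTop (𝓝 0) := by
  have h1 : (fun n => (P n : ℝ) ^ β) =O[atTop] fun n : ℕ => ((n : ℝ) ^ α) ^ β :=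
    hp.rpow hβ (Eventually.of_forall fun n => by positivity)
  have h2 := h1.mul (isBigO_refl (fun n : ℕ => ((n : ℝ) ^ ν)⁻¹ * Real.log n ^ k) atTop)
  refine (h2.congr_left fun n => ?_).trans_tendsto
    ((tendsto_rpow_mul_log_pow (sub_pos.2 h) k).congr' ?_)
  · ring
  · filter_upwards [eventually_gt_atTop 0] with n hn
    have hn' : (0 : ℝ) < n := by exact_mod_cast hn
    rw [← mul_assoc, ← Real.rpow_mul hn'.le, ← Real.rpow_neg hn'.le, ← Real.rpow_add hn']
    congr 2
    ring

/-- A dimension-dependent constant B^(P/2) is absorbed by part of the exponent once ℓ = log n is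
large. -/
lemma exp_mul_rpow_le {a a' ℓ B P : ℝ} (hB : 0 < B) (hP : 0 ≤ P)
    (h : Real.log B / 2 ≤ (a - a') * ℓ) :
    Real.exp (-(a * ℓ * P)) * B ^ (P / 2) ≤ Real.exp (-(a' * ℓ * P)) := by
  rw [Real.rpow_def_of_pos hB, ← Real.exp_add]
  refine Real.exp_le_exp.2 ?_
  have := mul_le_mul_of_nonneg_right h hP
  linarith

/-- The left side is n^(-ηP/4) ≤ n^(-ν), and P^β ≥ 1. This is the use of the lower bound on η₁ p. -/
lemma exp_le_rpow_div {n P : ℕ} (hn : 1 ≤ n) (hP : 1 ≤ P) {η ν β : ℝ} (hβ : 0 ≤ β)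
    (h : 4 * ν ≤ η * P) :
    Real.exp (-(η / 4 * Real.log n * P)) ≤ (P : ℝ) ^ β / (n : ℝ) ^ ν := by
  have hn' : (0 : ℝ) < n := by exact_mod_cast hn
  have hL : 0 ≤ Real.log n := Real.log_nonneg (by exact_mod_cast hn)
  rw [le_div_iff₀ (by positivity), Real.rpow_def_of_pos hn', ← Real.exp_add]
  refine le_trans (Real.exp_le_one_iff.2 ?_) (Real.one_le_rpow (by exact_mod_cast hP) hβ)
  nlinarith [mul_le_mul_of_nonneg_left h hL]

lemma EigenvaluesIn.mono {p : ℕ} {A : Matrix (Fin p) (Fin p) ℝ} {a b b' : ℝ}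
    (h : EigenvaluesIn A a b) (hb : b ≤ b') : EigenvaluesIn A a b' :=
  fun r hr => ⟨(h r hr).1, (h r hr).2.trans hb⟩

lemma InvSqrtRowSumNormLE.mono {p : ℕ} {A : Matrix (Fin p) (Fin p) ℝ} {b b' : ℝ}
    (h : InvSqrtRowSumNormLE A b) (hb : b ≤ b') : InvSqrtRowSumNormLE A b' := by
  obtain ⟨S, h1, h2, h3⟩ := h
  exact ⟨S, h1, h2, h3.trans hb⟩

/-- The conditions on the scale parameters follow from the smallness of one quantity. -/
lemma scale_conditions {P b ℓ η H y : ℝ} (hP : 1 ≤ P) (hb : 0 ≤ b) (hℓ : 1 ≤ ℓ) (hη : 0 < η)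
    (hH : 0 < H) (hy : y = b * P ^ 2 * √P * ℓ ^ 2) {ρ : ℝ} (hρ : ρ ^ 2 = 2 * η * ℓ * P)
    (h1 : y ≤ 1) (h2 : 2 * H * y ≤ 1 / 8) (h3 : 8 * η ^ 2 * y + 32 * η ^ 4 * y ^ 2 ≤ 1) :
    b * P ^ 2 ≤ 1 ∧ 2 * b * ρ ^ 4 + 2 * P * b ^ 2 * ρ ^ 8 ≤ 1 ∧ P * b * (H * (2 * ℓ * P)) ≤ 1 / 8 := by
  have hs : 1 ≤ √P := Real.one_le_sqrt.2 hP
  have hs2 : √P ^ 2 = P := Real.sq_sqrt (by linarith)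
  have hbP : 0 ≤ b * P ^ 2 := by positivity
  have hA : b * P ^ 2 * ℓ ^ 2 ≤ y := by
    rw [hy, mul_right_comm (b * P ^ 2) (√P)]
    exact le_mul_of_one_le_right (by positivity) hs
  have hB : b * P ^ 2 * ℓ ≤ b * P ^ 2 * ℓ ^ 2 := by
    gcongr
    nlinarith
  have hC : b * P ^ 2 ≤ b * P ^ 2 * ℓ := le_mul_of_one_le_right hbP hℓ
  refine ⟨by linarith, ?_, ?_⟩
  · have h4 : ρ ^ 4 = 4 * η ^ 2 * ℓ ^ 2 * P ^ 2 := by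
      rw [show ρ ^ 4 = (ρ ^ 2) ^ 2 by ring, hρ]; ring
    -- The sub-Gaussian variance is exactly of order y²; it is the reason for the extra √P in y.
    have h8 : P * b ^ 2 * ρ ^ 8 = 16 * η ^ 4 * y ^ 2 := by
      rw [show ρ ^ 8 = (ρ ^ 2) ^ 4 by ring, hρ, hy,
        show (b * P ^ 2 * √P * ℓ ^ 2) ^ 2 = b ^ 2 * P ^ 4 * √P ^ 2 * ℓ ^ 4 by ring, hs2]
      ring
    have h5 : 2 * b * ρ ^ 4 = 8 * η ^ 2 * (b * P ^ 2 * ℓ ^ 2) := by rw [h4]; ring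
    have h6 : 8 * η ^ 2 * (b * P ^ 2 * ℓ ^ 2) ≤ 8 * η ^ 2 * y := by gcongr
    linarith
  · have h4 : P * b * (H * (2 * ℓ * P)) = 2 * H * (b * P ^ 2 * ℓ) := by ring
    have h5 : 2 * H * (b * P ^ 2 * ℓ) ≤ 2 * H * y := by gcongr; linarith
    linarith

lemma rate_left_eq {n P : ℕ} (hn : 0 < n) (hP : 0 < P) {C η A c c3 : ℝ} :
    (C * ((P : ℝ) ^ c / √n) * (A * (n : ℝ) ^ c3) / (η * n)) ^ 2 * P ^ 3 =
      (C * A / η) ^ 2 * ((P : ℝ) ^ (3 + 2 * c) / (n : ℝ) ^ (3 - 2 * c3)) := by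
  have hn' : (0 : ℝ) < n := by exact_mod_cast hn
  have hP' : (0 : ℝ) < P := by exact_mod_cast hP
  have h1 : (P : ℝ) ^ (3 + 2 * c) = P ^ 3 * ((P : ℝ) ^ c) ^ 2 := by
    rw [Real.rpow_add hP', ← Real.rpow_natCast ((P : ℝ) ^ c), ← Real.rpow_mul hP'.le]
    norm_num [mul_comm]
  have h2 : (n : ℝ) ^ (3 - 2 * c3) = n ^ 3 / ((n : ℝ) ^ c3) ^ 2 := by
    rw [Real.rpow_sub hn', ← Real.rpow_natCast ((n : ℝ) ^ c3), ← Real.rpow_mul hn'.le]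
    norm_num [mul_comm]
  have h3 : √(n : ℝ) ^ 2 = n := Real.sq_sqrt hn'.le
  rw [h1, h2, div_pow, mul_pow, mul_pow, div_pow, h3, mul_pow, mul_pow, div_pow, mul_pow]
  have h4 : (0 : ℝ) < (n : ℝ) ^ c3 := by positivity
  field_simp

/-- The exponent β stays free because two values occur: β = 2 gives the second entry of the rate, β
= 5/2 the quantity required to be small in `scale_conditions`. -/
lemma rate_right_eq {n P : ℕ} (hn : 0 < n) (hP : 0 < P) {C η A c c4 β : ℝ} :
    (C * ((P : ℝ) ^ c / √n)) ^ 2 * (A * (n : ℝ) ^ c4) / (η * n) * (P : ℝ) ^ β =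
      C ^ 2 * A / η * ((P : ℝ) ^ (β + 2 * c) / (n : ℝ) ^ (2 - c4)) := by
  have hn' : (0 : ℝ) < n := by exact_mod_cast hn
  have hP' : (0 : ℝ) < P := by exact_mod_cast hP
  have h1 : (P : ℝ) ^ (β + 2 * c) = (P : ℝ) ^ β * ((P : ℝ) ^ c) ^ 2 := by
    rw [Real.rpow_add hP', ← Real.rpow_natCast ((P : ℝ) ^ c), ← Real.rpow_mul hP'.le]
    norm_num [mul_comm]
  have h2 : (n : ℝ) ^ (2 - c4) = n ^ 2 / (n : ℝ) ^ c4 := by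
    rw [Real.rpow_sub hn']
    norm_num
  have h3 : √(n : ℝ) ^ 2 = n := Real.sq_sqrt hn'.le
  rw [h1, h2, mul_pow, div_pow, h3]
  have h4 : (0 : ℝ) < (n : ℝ) ^ c4 := by positivity
  field_simp

lemma gam_sq (p : ℕ → ℕ) {n : ℕ} (hn : 1 ≤ n) :
    (√2 * gam p n) ^ 2 = 2 * Real.log n * p n / n := by
  have : 0 ≤ Real.log n := Real.log_nonneg (by exact_mod_cast hn)
  rw [gam, mul_pow, Real.sq_sqrt (by norm_num), Real.sq_sqrt (by positivity)]
  ring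

end Asymp

end Saddlepoint

/-! ### The main theorem: constants and thresholds -/

theorem mainTheorem8
    (p : ℕ → ℕ)
    (μ : ∀ n, Measure (Saddlepoint.E (p n)))
    (hμ : ∀ n, IsProbabilityMeasure (μ n))
    (f : ∀ n, Saddlepoint.E (p n) → ℝ)
    (hf : ∀ n, Saddlepoint.IsDensity (μ n) (f n))
    (A : ∀ n, Set (Saddlepoint.E (p n)))
    (hfA : ∀ n, ∀ s ∈ A n, ContinuousAt (f n) s)
    (t : ∀ n, Saddlepoint.E (p n) → Saddlepoint.E (p n))
    (ht : ∀ n, ∀ s ∈ A n, Saddlepoint.IsSaddlepoint (μ n) s (t n s))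
    (δ η₁ η₂ η₃ η₄ η₅ η₆ cinf c3 c4 α : ℝ)
    (hδ : 0 < δ) (hη₁ : 0 < η₁) (hcinf0 : 0 ≤ cinf) (hcinf1 : cinf ≤ 1 / 2)
    (hp : (fun n => (p n : ℝ)) =O[atTop] fun n => (n : ℝ) ^ α)
    (hα1 : α < 1) (hα : α < (4 - 2 * c4) / (5 + 4 * cinf))
    (hpη : ∀ᶠ n in atTop, 1 ≤ p n ∧ 4 * (2 - c4) ≤ η₁ * p n)
    (h7 : Saddlepoint.UniformTail μ A t δ (Saddlepoint.rate p cinf c3 c4))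
    (h8 : Saddlepoint.UniformHessian μ (fun n => t n '' A n) δ η₁ η₂ cinf)
    (h9 : Saddlepoint.UniformThird μ (fun n => t n '' A n) η₃ η₄ c3)
    (h10 : Saddlepoint.UniformFourth μ (fun n => t n '' A n) η₅ η₆ c4) :
    ∃ C : ℝ, ∀ᶠ n in atTop, ∀ s ∈ A n,
      |f n s / Saddlepoint.approx (μ n) s (t n s) - 1| ≤ C * Saddlepoint.rate p cinf c3 c4 n := by
  obtain ⟨C₇, h7⟩ := h7
  obtain ⟨h8, C₈, h8'⟩ := h8
  -- The maximum with η₁, and the summands 1 in C and A₄ below, make these constants positive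
  -- without sign information on η₂, C₈, η₅, η₆.
  set H : ℝ := max η₂ η₁ with hH
  have hH0 : 0 < H := lt_max_of_lt_right hη₁
  set C : ℝ := |C₈| + 1 with hC
  have hC0 : 0 < C := by positivity
  set A₃ : ℝ := max |η₃| |η₄| with hA₃
  set A₄ : ℝ := max |η₅| |η₆| + 1 with hA₄
  have hA₄0 : 0 < A₄ := by positivity
  set K : ℝ := C ^ 2 * A₄ / η₁ with hK
  have hK0 : 0 < K := by positivity
  have hlog : Tendsto (fun n : ℕ => Real.log n) atTop atTop :=
    Real.tendsto_log_atTop.comp tendsto_natCast_atTop_atTop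
  -- Since α < 1, p log n / n tends to 0, so the ball of radius √2 γ_n eventually lies in the
  -- δ-ball.
  have hγ0 := Saddlepoint.tendsto_rpow_div_mul_log_pow hp zero_le_one
    (show α * 1 < 1 by linarith) 1
  -- The requirement α(5/2 + 2c∞) < 2 - c4 is half of the hypothesis on α, cleared of its
  -- denominator.
  have hy0 := (Saddlepoint.tendsto_rpow_div_mul_log_pow (β := 5 / 2 + 2 * cinf) (ν := 2 - c4) hp
    (by positivity) (by rw [lt_div_iff₀ (by positivity)] at hα; linarith) 2).const_mul K
  rw [mul_zero] at hy0
  have hy1 := hy0.const_mul (2 * H)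
  have hy2 := (hy0.const_mul (8 * η₁ ^ 2)).add ((hy0.pow 2).const_mul (32 * η₁ ^ 4))
  rw [mul_zero] at hy1
  rw [zero_pow (by norm_num), mul_zero, mul_zero, add_zero] at hy2
  -- The 3 counts the tail terms: two Gaussian ones and one from the decay along rays.
  refine ⟨200000 * (K + (C * A₃ / η₁) ^ 2) + 3 + C₇, ?_⟩
  filter_upwards [hpη, h7, h8, h8', h9, h10, eventually_ge_atTop 2, hlog.eventually_ge_atTop 1,
    -- The two tails decay like n^(-η₁p/2) and n^(-3η₁p/4) up to factors B^(p/2). These thresholds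
    -- absorb the factors and leave n^(-η₁p/4).
    hlog.eventually_ge_atTop (Real.log 4 / 2 / (η₁ / 2 - η₁ / 4)),
    hlog.eventually_ge_atTop (Real.log (4 * (H / η₁)) / 2 / (3 / 4 * η₁ - η₁ / 4)),
    hγ0.eventually_le_const (show (0 : ℝ) < δ ^ 2 / 2 by positivity),
    hy0.eventually_le_const (show (0 : ℝ) < 1 by norm_num),
    hy1.eventually_le_const (show (0 : ℝ) < 1 / 8 by norm_num),
    hy2.eventually_le_const (show (0 : ℝ) < 1 by norm_num)]
    with n hpn h7 h8 h8' h9 h10 hn hℓ hℓ4 hℓH hγ hy hyH hyη s hs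
  obtain ⟨hp1, hpη⟩ := hpn
  have hT : t n s ∈ t n '' A n := Set.mem_image_of_mem _ hs
  have hn0 : 0 < n := by omega
  have hnR : (0 : ℝ) < n := by exact_mod_cast hn0
  have hpR : (1 : ℝ) ≤ p n := by exact_mod_cast hp1
  have hpR0 : (0 : ℝ) < p n := by linarith
  have hγsq := Saddlepoint.gam_sq p (n := n) (by omega)
  have hγpos : 0 < √2 * Saddlepoint.gam p n := by
    unfold Saddlepoint.gam
    positivity
  have hγδ : √2 * Saddlepoint.gam p n ≤ δ := by
    refine abs_le_of_sq_le_sq' ?_ hδ.le |>.2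
    rw [hγsq]
    rw [Real.rpow_one, Real.rpow_one, pow_one] at hγ
    linarith [show 2 * Real.log n * p n / n = 2 * ((p n : ℝ) / n * Real.log n) by ring]
  have hN : 0 < η₁ * n := by positivity
  have hN' : 0 < H * n := by positivity
  set R : ℝ := C * ((p n : ℝ) ^ cinf / √n) with hR
  have hR0 : 0 < R := by positivity
  have ha₄ : 0 < A₄ * (n : ℝ) ^ c4 := by positivity
  have habs : ∀ {x M : ℝ} (c : ℝ), |x| ≤ M → |x * (n : ℝ) ^ c| ≤ M * (n : ℝ) ^ c := by
    intro x M c hx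
    rw [abs_mul, abs_of_nonneg (show (0 : ℝ) ≤ (n : ℝ) ^ c by positivity)]
    gcongr
  set b : ℝ := R ^ 2 * (A₄ * (n : ℝ) ^ c4) / (η₁ * n) with hb
  set b₃ : ℝ := R * (A₃ * (n : ℝ) ^ c3) / (η₁ * n) with hb₃
  set ρ : ℝ := √(η₁ * n) * (√2 * Saddlepoint.gam p n) with hρ
  have hρ2 : ρ ^ 2 = 2 * η₁ * Real.log n * p n := by
    rw [hρ, mul_pow, Real.sq_sqrt hN.le, hγsq]
    field_simp
  have hyb : K * ((p n : ℝ) ^ (5 / 2 + 2 * cinf) / (n : ℝ) ^ (2 - c4) * Real.log n ^ 2) =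
      b * (p n : ℝ) ^ 2 * √(p n) * Real.log n ^ 2 := by
    rw [← mul_assoc, hK, ← Saddlepoint.rate_right_eq hn0 hp1, mul_assoc b,
      show (5 / 2 : ℝ) = (2 : ℕ) + 1 / 2 by norm_num, Real.rpow_add hpR0, Real.rpow_natCast,
      Real.sqrt_eq_rpow]
    ring
  obtain ⟨hc1, hc2, hc3⟩ := Saddlepoint.scale_conditions hpR (b := b) (by positivity) hℓ hη₁ hH0 hyb hρ2
    hy hyH hyη
  have := hμ n
  refine (Saddlepoint.abs_div_approx_sub_one_le (hf n) (hfA n s hs) (ht n s hs) hp1 hδ hγpos hγδ hN hN'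
    hR0 ha₄ (h7 s hs).1 (fun y hy => (h8 _ hT y hy).mono ?_)
    ((h8' _ hT 0 (by simpa using hδ)).mono ?_) (habs c3 (le_max_left _ _))
    (habs c3 (le_max_right _ _)) (h9 _ hT) (habs c4 ?_) (habs c4 ?_) (h10 _ hT) hb hb₃ hρ hc1 hc2 ?_).trans
    ?_
  · exact mul_le_mul_of_nonneg_right (le_max_left _ _) hnR.le
  · refine mul_le_mul_of_nonneg_right ?_ (by positivity)
    linarith [le_abs_self C₈]
  · linarith [le_max_left |η₅| |η₆|]
  · linarith [le_max_right |η₅| |η₆|]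
  · rw [hγsq]
    refine le_trans (le_of_eq ?_) hc3
    field_simp
  · have hr1 : (p n : ℝ) ^ (3 + 2 * cinf) / (n : ℝ) ^ (3 - 2 * c3) ≤ Saddlepoint.rate p cinf c3 c4 n :=
      le_max_left _ _
    have hr2 : (p n : ℝ) ^ (2 + 2 * cinf) / (n : ℝ) ^ (2 - c4) ≤ Saddlepoint.rate p cinf c3 c4 n :=
      le_max_right _ _
    have hexp := (Saddlepoint.exp_le_rpow_div (n := n) (by omega) hp1 (β := 2 + 2 * cinf)
      (by positivity) hpη).trans hr2
    have he1 : Real.exp (-(ρ ^ 2 / 4)) * 4 ^ ((p n : ℝ) / 2) ≤ Saddlepoint.rate p cinf c3 c4 n := by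
      refine le_trans ?_ hexp
      rw [hρ2, show 2 * η₁ * Real.log n * p n / 4 = η₁ / 2 * Real.log n * p n by ring]
      refine Saddlepoint.exp_mul_rpow_le (by norm_num) hpR0.le ?_
      rwa [div_le_iff₀' (by linarith)] at hℓ4
    have he2 : Real.exp (-(3 / 8 * ρ ^ 2)) * (4 * (H * n) / (η₁ * n)) ^ ((p n : ℝ) / 2) ≤
        Saddlepoint.rate p cinf c3 c4 n := by
      refine le_trans ?_ hexp
      rw [hρ2, show 3 / 8 * (2 * η₁ * Real.log n * p n) = 3 / 4 * η₁ * Real.log n * p n by ring,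
        show 4 * (H * n) / (η₁ * n) = 4 * (H / η₁) by field_simp]
      refine Saddlepoint.exp_mul_rpow_le (by positivity) hpR0.le ?_
      rwa [div_le_iff₀' (by linarith)] at hℓH
    have hb2 : b * (p n : ℝ) ^ 2 ≤ K * Saddlepoint.rate p cinf c3 c4 n := by
      have := Saddlepoint.rate_right_eq hn0 hp1 (C := C) (η := η₁) (A := A₄) (c := cinf) (c4 := c4)
        (β := 2)
      rw [Real.rpow_two] at this
      rw [hb, hR, this]
      gcongr
    have hb3 : b₃ ^ 2 * (p n : ℝ) ^ 3 ≤ (C * A₃ / η₁) ^ 2 * Saddlepoint.rate p cinf c3 c4 n := by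
      rw [hb₃, hR, Saddlepoint.rate_left_eq hn0 hp1]
      gcongr
    linarith [(h7 s hs).2]
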